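/- Let $(w_k)_{k\ge0}$ be non-negative real numbers such that $w_k\sim ck^{-\beta}$ as $k\to\infty$, for some $c>0$ and $\beta>2$. Let $\Phi(t)=\sum_{k\ge0}w_kt^k$, let $\rho$ be its radius of convergence, and let $\nu=\Psi(\rho)\in[0,\infty]$, where $\Psi(t)=\sum_k kw_kt^k\big/\sum_k w_kt^k$ (if $\Phi(\rho)=\infty$, $\Psi(\rho)$ means $\lim_{t\uparrow\rho}\Psi(t)$). For $m\ge0$, $n\ge1$ let $$Z(m,n)=\sum_{y\in\mathbb N_0^n:\ y_1+\dots+y_n=m}\ \prod_{i=1}^n w_{y_i},$$ and, when $Z(m,n)>0$, let $B_{m,n}=(Y_1,\dots,Y_n)$ be the random allocation of $m$ balls in $n$ boxes with $\mathbb P(B_{m,n}=y)=\prod_{i}w_{y_i}/Z(m,n)$ for $y\in\mathbb N_0^n$ with $\sum_i y_i=m$. Let $Y_{(1)}\ge Y_{(2)}\ge\dots\ge Y_{(n)}$ be $Y_1,\dots,Y_n$ in decreasing order. Then $\nu<\infty$. Suppose further that $m=m(n)$ satisfies $m/n\to\lambda$ as $n\to\infty$, where $\lambda$ is real and $\lambda>\nu$.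 Let $\alpha=\beta-1>1$, $c'=c/\Phi(1)$, and $\pi_k=w_k\rho^k/\Phi(\rho)$ (here $\rho=1$, so $\pi_k=w_k/\Phi(1)$). Then, as $n\to\infty$: (i) $Y_{(1)}=(\lambda-\nu)n+o_p(n)$ and $Y_{(2)}=o_p(n)$. (ii) $Z(m,n)\sim c(\lambda-\nu)^{-\beta}\,\Phi(1)^{n-1}\,n^{1-\beta}$. (In particular, $Z(m,n)>0$ for all large $n$.) (iii) Let $\xi_1,\dots,\xi_{n-1}$ be i.i.d. with distribution $(\pi_k)_{k\ge0}$, and let $\xi^*_{(1)}\ge\dots\ge\xi^*_{(n-1)}$ be these variables in decreasing order. Then there are couplings of the random vectors $$\bigl(Y_{(1)},Y_{(2)},\dots,Y_{(n)}\bigr)\quad\text{and}\quad\Bigl(m-\sum_{i=1}^{n-1}\xi_i,\ \xi^*_{(1)},\dots,\xi^*_{(n-1)}\Bigr)$$ under which they are equal with probability tending to $1$. (iv) If moreover $\beta<3$, i.e. $1<\alpha<2$, then $Y_{(1)}=m-\nu n+O_p(n^{1/\alpha})$ and $$n^{-1/\alpha}\bigl(m-\nu n-Y_{(1)}\bigr)\xrightarrow{d}X_\alpha,$$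 where $X_\alpha$ is an $\alpha$-stable random variable with Laplace transform $\mathbb E\,e^{-tX_\alpha}=\exp\bigl(c'\Gamma(-\alpha)t^\alpha\bigr)$ for all complex $t$ with $\operatorname{Re}t\ge0$ (the expectation being absolutely convergent). (v) $Y_{(2)}=O_p(n^{1/\alpha})$ and $n^{-1/\alpha}Y_{(2)}\xrightarrow{d}W$, where $W$ has the Fréchet distribution $\mathbb P(W\le x)=\exp\bigl(-\tfrac{c'}{\alpha}x^{-\alpha}\bigr)$ for $x>0$, and $\mathbb P(W\le 0)=0$. (vi) More generally, for each fixed $j\ge2$, $Y_{(j)}=O_p(n^{1/\alpha})$ and $n^{-1/\alpha}Y_{(j)}\xrightarrow{d}W_j$, where $W_j$ has the density $$c'x^{-\alpha-1}\,\frac{\bigl(c'\alpha^{-1}x^{-\alpha}\bigr)^{j-2}}{(j-2)!}\,\exp\bigl(-c'\alpha^{-1}x^{-\alpha}\bigr),\qquad x>0,$$ (and $0$ for $x\le0$), and $c'\alpha^{-1}W_j^{-\alpha}$ has the Gamma distribution $\Gamma(j-1,1)$. -/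

import Mathlib

open MeasureTheory ProbabilityTheory Filter Topology Asymptotics
open scoped ENNReal

noncomputable section

namespace BallsInBoxes

/-- The generating function `Φ(t) = ∑ₖ wₖ tᵏ` of a non-negative weight sequence, for
`t ∈ [0, ∞]`, with values in `[0, ∞]`. -/
def Phi (w : ℕ → ℝ) (t : ℝ≥0∞) : ℝ≥0∞ :=
  ∑' k : ℕ, ENNReal.ofReal (w k) * t ^ k

/-- The radius of convergence `ρ = 1 / limsup wₖ^(1/k)` of `Φ`, in `[0, ∞]`. -/
def radius (w : ℕ → ℝ) : ℝ≥0∞ :=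
  (limsup (fun k : ℕ => ENNReal.ofReal (w k) ^ (1 / (k : ℝ))) atTop)⁻¹

/-- `(∑ₖ k wₖ tᵏ) / (∑ₖ wₖ tᵏ)`, for `t` such that `Φ(t) < ∞`. -/
def Psi (w : ℕ → ℝ) (t : ℝ≥0∞) : ℝ≥0∞ :=
  (∑' k : ℕ, (k : ℝ≥0∞) * (ENNReal.ofReal (w k) * t ^ k)) / Phi w t

open Classical in
/-- `ν = Ψ(ρ) ∈ [0, ∞]`, where `Ψ(ρ)` is given by the quotient of the two series if
`Φ(ρ) < ∞`, and is the limit of `Ψ(t)` as `t ↑ ρ` if `Φ(ρ) = ∞`. -/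
def nu (w : ℕ → ℝ) : ℝ≥0∞ :=
  if Phi w (radius w) < ⊤ then Psi w (radius w)
  else limUnder (𝓝[<] (radius w)) (Psi w)

/-- The partition function `Z(m, n)`: the sum of the weights `∏ᵢ w_{yᵢ}` over all allocations
`y ∈ ℕⁿ` with `∑ᵢ yᵢ = m`. -/
def Z (w : ℕ → ℝ) (m n : ℕ) : ℝ :=
  ∑ y ∈ Finset.Nat.antidiagonalTuple n m, ∏ i, w (y i)

open Classical in
/-- The probability distribution proportional to `f`. (When `f` cannot be normalized, the
distribution is undefined in mathematics, and a point mass here.) -/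
def proportional {E : Type*} [Inhabited E] (f : E → ℝ≥0∞) : PMF E :=
  if h : (∑' x, f x) ≠ 0 ∧ (∑' x, f x) ≠ ⊤ then PMF.normalize f h.1 h.2 else PMF.pure default

/-- The law of the random allocation `B_{m,n} = (Y₁, …, Yₙ)` of `m` balls in `n` boxes:
`ℙ(B_{m,n} = y) = ∏ᵢ w_{yᵢ} / Z(m, n)` for `y ∈ ℕⁿ` with `∑ᵢ yᵢ = m`. -/
def allocation (w : ℕ → ℝ) (m n : ℕ) : Measure (Fin n → ℕ) :=
  (proportional fun y : Fin n → ℕ =>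
    if ∑ i, y i = m then ENNReal.ofReal (∏ i, w (y i)) else 0).toMeasure

instance (w : ℕ → ℝ) (m n : ℕ) : IsProbabilityMeasure (allocation w m n) :=
  PMF.toMeasure.isProbabilityMeasure _

/-- The canonical distribution `πₖ = wₖ ρᵏ / Φ(ρ)` on `ℕ`, in the phase `λ > ν`. -/
def canonical (w : ℕ → ℝ) : Measure ℕ :=
  (proportional fun k : ℕ => ENNReal.ofReal (w k) * radius w ^ k).toMeasure

instance (w : ℕ → ℝ) : IsProbabilityMeasure (canonical w) :=
  PMF.toMeasure.isProbabilityMeasure _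

/-- The `j`-th largest component `y_(j)` of `y ∈ ℕⁿ` (with multiplicity), `1 ≤ j ≤ n`. -/
def ordered {n : ℕ} (y : Fin n → ℕ) (j : ℕ) : ℕ :=
  if h : 1 ≤ j ∧ j ≤ n then y (Tuple.sort y (Fin.rev ⟨j - 1, by omega⟩)) else 0

/-- The vector `(y_(1), …, y_(n))`. -/
def orderedVector {n : ℕ} (y : Fin n → ℕ) : Fin n → ℤ :=
  fun i => (ordered y (i + 1) : ℤ)

/-- The vector `(m - ∑ᵢ xᵢ, x_(1), …, x_(n-1))` of length `n`, for `x ∈ ℕⁿ⁻¹`. -/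
def comparisonVector (m : ℕ) {n : ℕ} (x : Fin (n - 1) → ℕ) : Fin n → ℤ :=
  fun i => if (i : ℕ) = 0 then (m : ℤ) - ∑ l, (x l : ℤ) else (ordered x i : ℤ)

/-- `X = o_p(a)`: for random variables `Xₙ` defined on `(Eₙ, μₙ)`, `Xₙ / aₙ → 0` in
probability. -/
def IsLittleOp {E : ℕ → Type*} [∀ n, MeasurableSpace (E n)] (μ : ∀ n, Measure (E n))
    (X : ∀ n, E n → ℝ) (a : ℕ → ℝ) : Prop :=
  ∀ ε : ℝ, 0 < ε → Tendsto (fun n => μ n {y | ε ≤ |X n y / a n|}) atTop (𝓝 0)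

/-- `X = O_p(a)`: for random variables `Xₙ` defined on `(Eₙ, μₙ)`, the sequence `Xₙ / aₙ` is
stochastically bounded. -/
def IsBigOp {E : ℕ → Type*} [∀ n, MeasurableSpace (E n)] (μ : ∀ n, Measure (E n))
    (X : ∀ n, E n → ℝ) (a : ℕ → ℝ) : Prop :=
  ∀ ε : ℝ≥0∞, 0 < ε → ∃ K : ℝ, ∀ᶠ n in atTop, μ n {y | K < |X n y / a n|} ≤ ε

/-- Two sequences of laws are asymptotically equal: there are couplings `(X'ₙ, X''ₙ)` of `μₙ`
and `νₙ` such that `X'ₙ = X''ₙ` with probability tending to `1`. -/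
def ApproxEqualLaws {E : ℕ → Type*} [∀ n, MeasurableSpace (E n)]
    (μ ν : ∀ n, Measure (E n)) : Prop :=
  ∃ γ : ∀ n, Measure (E n × E n),
    (∀ n, (γ n).map Prod.fst = μ n ∧ (γ n).map Prod.snd = ν n) ∧
    Tendsto (fun n => γ n {p | p.1 = p.2}) atTop (𝓝 1)

/-- A (non-degenerate) `α`-stable law: if `X, X'` are independent with law `σ`, then for all
`a, b > 0` there is a real `d` such that `aX + bX'` has the same law as
`(a^α + b^α)^(1/α) X + d`. -/
def IsStableLaw (α : ℝ) (σ : Measure ℝ) : Prop :=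
  (∀ x : ℝ, σ ≠ Measure.dirac x) ∧
  ∀ a b : ℝ, 0 < a → 0 < b → ∃ d : ℝ,
    (σ.prod σ).map (fun p => a * p.1 + b * p.2) =
      σ.map (fun x => (a ^ α + b ^ α) ^ (1 / α) * x + d)

/-- The density of `W_j` (for `j ≥ 2`) with parameters `c'` and `α`. -/
def densityW (c' α : ℝ) (j : ℕ) (x : ℝ) : ℝ :=
  if 0 < x then
    c' * x ^ (-α - 1) * ((c' * α⁻¹ * x ^ (-α)) ^ (j - 2) / (Nat.factorial (j - 2) : ℝ)) *
      Real.exp (-(c' * α⁻¹ * x ^ (-α)))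
  else 0

end BallsInBoxes

end

/-! Since β > 2, the weights have radius of convergence 1, and both Φ(1) and the mean are finite. So
P = `canonical w` is a law with finite mean ν and atoms asymptotic to c' k^(-β). Dividing every
weight by Φ(1) leaves the law of the allocation unchanged, so the allocation is n independent
P-variables conditioned on their sum being m (`allocation_eq_cond`), and Z(m, n) = Φ(1)^n Pr(sum =
m).

A sum m ≈ λn with λ > ν is atypical, and under a power law the cheapest way to reach it is one big
jump: n - 1 variables behave normally and a single box takes the excess (λ - ν)n. This costs n
(choice of the box) times c'((λ - ν)n)^(-β). For the upper bound (`eventually_measureReal_sum_le`),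
a Chernoff estimate with tilt of order log n / n makes the event negligible when all entries are at
most δn, for small δ (`exists_tendsto_small_jumps`). Otherwise a big entry is removed; the others
determine it, so its atom is O(n^(-β)), with the sharp constant when the others have typical sum.
For the lower bound (`exists_le_measureReal_orderedVector`), configurations with one entry above δn
and a typical remainder are disjoint over the position of that entry, and on them the ordered vector
is the comparison vector of the remainder. The bound holds for all target sets at once, so after
division by the upper bound the conditioned law dominates almost the whole comparison law, and a
maximal coupling gives (iii) (`approxEqualLaws_orderedVector`).

The remaining limits concern n - 1 independent variables and pass through the coupling with an error
uniform over sets. The law of large numbers and a union bound give (i). For (v) and (vi), the number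
of rescaled variables above x is binomial with a Poisson limit. For (iv), Laplace transforms
converge and yield a stable law. Both limit laws rest on the Riemann sum lemma
`tendsto_mul_integral_scaled`, applied to an indicator and to e^(-ty) - 1 + ty, whose integral
against c' y^(-α-1) is c' Γ(-α) t^α. -/

namespace BallsInBoxes

/-! ### Power-law distributions on ℕ and Riemann sums -/

section PowerTail

variable {E : Type*} [NormedAddCommGroup E]

theorem integrable_nat_iff_summable {P : Measure ℕ} [IsFiniteMeasure P] {f : ℕ → E} :
    Integrable f P ↔ Summable fun k => P.real {k} * ‖f k‖ := by
  have h1 : ∀ k, ‖f k‖ₑ * P {k} = ENNReal.ofReal (P.real {k} * ‖f k‖) := by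
    intro k
    rw [ENNReal.ofReal_mul measureReal_nonneg, ofReal_measureReal, ofReal_norm, mul_comm]
  have hnn : ∀ k, 0 ≤ P.real {k} * ‖f k‖ := fun k => by positivity
  constructor
  · intro h
    have := h.2
    rw [hasFiniteIntegral_iff_enorm, lintegral_countable'] at this
    simp_rw [h1] at this
    exact (ENNReal.summable_toReal this.ne).congr fun k => ENNReal.toReal_ofReal (hnn k)
  · intro h
    refine ⟨StronglyMeasurable.of_discrete.aestronglyMeasurable, ?_⟩
    rw [hasFiniteIntegral_iff_enorm, lintegral_countable']
    simp_rw [h1]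
    exact h.tsum_ofReal_lt_top

theorem exists_le_rpow {p : ℕ → ℝ} (hp : ∀ k, 0 ≤ p k) {c β : ℝ}
    (h : p ~[atTop] fun k : ℕ => c * (k : ℝ) ^ (-β)) :
    ∃ C : ℝ, 0 < C ∧ ∀ k : ℕ, 1 ≤ k → p k ≤ C * (k : ℝ) ^ (-β) := by
  obtain ⟨C, hC⟩ := (h.isBigO.trans (isBigO_const_mul_self c _ _)).bound
  obtain ⟨n₀, hn⟩ := eventually_atTop.1 hC
  have hne : ∀ k : ℕ, 1 ≤ k → 0 < (k : ℝ) ^ (-β) := fun k hk =>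
    Real.rpow_pos_of_pos (by exact_mod_cast hk) _
  -- The asymptotic bound may fail for finitely many k; adding their non-negative ratios to the
  -- constant covers them.
  refine ⟨|C| + 1 + ∑ k ∈ Finset.range n₀, p k / (k : ℝ) ^ (-β), ?_, fun k hk => ?_⟩
  · have : 0 ≤ ∑ k ∈ Finset.range n₀, p k / (k : ℝ) ^ (-β) :=
      Finset.sum_nonneg fun k _ => div_nonneg (hp k) (Real.rpow_nonneg (by positivity) _)
    positivity
  · have hS : 0 ≤ ∑ k ∈ Finset.range n₀, p k / (k : ℝ) ^ (-β) :=
      Finset.sum_nonneg fun k _ => div_nonneg (hp k) (Real.rpow_nonneg (by positivity) _)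
    rcases lt_or_ge k n₀ with h0 | h0
    · have h2 : p k / (k : ℝ) ^ (-β) ≤ ∑ k ∈ Finset.range n₀, p k / (k : ℝ) ^ (-β) :=
        Finset.single_le_sum (f := fun k : ℕ => p k / (k : ℝ) ^ (-β))
          (fun k _ => div_nonneg (hp k) (Real.rpow_nonneg (by positivity) _))
          (Finset.mem_range.2 h0)
      rw [← div_le_iff₀ (hne k hk)]
      linarith [abs_nonneg C]
    · have h2 := hn k h0
      rw [Real.norm_of_nonneg (hp k), Real.norm_of_nonneg (hne k hk).le] at h2
      refine h2.trans (mul_le_mul_of_nonneg_right ?_ (hne k hk).le)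
      linarith [le_abs_self C]

theorem integrable_rpow {P : Measure ℕ} [IsFiniteMeasure P] {c β γ : ℝ}
    (h : (fun k => P.real {k}) ~[atTop] fun k : ℕ => c * (k : ℝ) ^ (-β)) (hγ : γ < β - 1) :
    Integrable (fun k : ℕ => (k : ℝ) ^ γ) P := by
  obtain ⟨C, hC, hk⟩ := exists_le_rpow (fun k => measureReal_nonneg) h
  rw [integrable_nat_iff_summable]
  have hs : Summable fun k : ℕ => C * (k : ℝ) ^ (γ - β) :=
    (Real.summable_nat_rpow.2 (by linarith)).mul_left C
  refine summable_of_isBigO_nat hs (IsBigO.of_bound 1 ?_)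
  filter_upwards [eventually_ge_atTop 1] with k hk1
  have hk0 : (0 : ℝ) < k := by exact_mod_cast hk1
  rw [norm_mul, norm_norm, one_mul, Real.norm_of_nonneg measureReal_nonneg,
    Real.norm_of_nonneg (Real.rpow_nonneg hk0.le _),
    Real.norm_of_nonneg (mul_nonneg hC.le (Real.rpow_nonneg hk0.le _)), sub_eq_add_neg,
    Real.rpow_add hk0]
  nlinarith [hk k hk1, Real.rpow_nonneg hk0.le γ]

/-- The integrand is a step function, equal to F (k + 1) on an interval of length 1/N. These steps
never see the index 0, hence the condition on F 0. -/
theorem hasSum_integral_ceil [NormedSpace ℝ E] [CompleteSpace E] {N : ℝ} (hN : 0 < N) {F : ℕ → E}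
    (hF0 : F 0 = 0) (hF : IntegrableOn (fun y => F ⌈N * y⌉₊) (Set.Ioi 0)) :
    HasSum F (N • ∫ y in Set.Ioi 0, F ⌈N * y⌉₊) := by
  let s : ℕ → Set ℝ := fun k => Set.Ioc (k / N) ((k + 1) / N)
  have hmem : ∀ k y, y ∈ s k ↔ 0 < y ∧ ⌈N * y⌉₊ = k + 1 := by
    intro k y
    simp only [s, Set.mem_Ioc]
    rw [Nat.ceil_eq_iff (by simp), div_lt_iff₀ hN, le_div_iff₀ hN, mul_comm y N]
    push_cast
    constructor
    · rintro ⟨h1, h2⟩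
      exact ⟨pos_of_mul_pos_right ((Nat.cast_nonneg k).trans_lt h1) hN.le, h1, h2⟩
    · exact fun h => h.2
  have hU : ⋃ k, s k = Set.Ioi 0 := by
    ext y
    simp only [Set.mem_iUnion, hmem, Set.mem_Ioi]
    refine ⟨fun ⟨k, h⟩ => h.1, fun h => ⟨⌈N * y⌉₊ - 1, h, ?_⟩⟩
    have : 0 < ⌈N * y⌉₊ := Nat.ceil_pos.2 (by positivity)
    omega
  have hd : Pairwise (Function.onFun Disjoint s) := by
    intro i j hij
    refine Set.disjoint_left.2 fun y hi hj => hij ?_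
    have h1 := ((hmem i y).1 hi).2
    have h2 := ((hmem j y).1 hj).2
    omega
  have hsum := hasSum_integral_iUnion (μ := volume) (s := s) (fun k => measurableSet_Ioc) hd
    (by rw [hU]; exact hF)
  rw [hU] at hsum
  have hval : ∀ k, ∫ y in s k, F ⌈N * y⌉₊ = N⁻¹ • F (k + 1) := by
    intro k
    rw [setIntegral_congr_fun (g := fun _ => F (k + 1)) measurableSet_Ioc
      (fun y hy => by simp only [((hmem k y).1 hy).2])]
    rw [setIntegral_const, measureReal_def, Real.volume_Ioc, ENNReal.toReal_ofReal]
    · congr 1; field_simp; ring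
    · rw [sub_nonneg]; gcongr; linarith
  simp_rw [hval] at hsum
  have h2 := hsum.const_smul N
  simp_rw [smul_smul, mul_inv_cancel₀ hN.ne', one_smul] at h2
  have h3 := (hasSum_nat_add_iff (f := F) 1).1 h2
  simpa [hF0] using h3

/-- Pointwise limit of the step-function density: ⌈N y⌉ / N → y, so the rounding disappears. -/
theorem tendsto_rpow_mul_ceil {p : ℕ → ℝ} {c β y : ℝ} (hy : 0 < y)
    (h : p ~[atTop] fun k : ℕ => c * (k : ℝ) ^ (-β)) {N : ℕ → ℝ} (hN : Tendsto N atTop atTop) :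
    Tendsto (fun n => N n ^ β * p ⌈N n * y⌉₊) atTop (𝓝 (c * y ^ (-β))) := by
  have hNy : Tendsto (fun n => N n * y) atTop atTop := hN.atTop_mul_const hy
  have hk : Tendsto (fun n => ⌈N n * y⌉₊) atTop atTop := tendsto_nat_ceil_atTop.comp hNy
  have hz : Tendsto (fun n => (⌈N n * y⌉₊ : ℝ) / N n) atTop (𝓝 y) := by
    have := (tendsto_nat_ceil_div_atTop (R := ℝ)).comp hNy
    have h2 := this.mul_const y
    rw [one_mul] at h2
    refine h2.congr' ?_
    filter_upwards [hN.eventually_gt_atTop 0] with n hn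
    simp only [Function.comp]
    field_simp
  have h1 := h.comp_tendsto hk
  have h2 : (fun n => N n ^ β * p ⌈N n * y⌉₊) ~[atTop]
      fun n => N n ^ β * (c * (⌈N n * y⌉₊ : ℝ) ^ (-β)) := IsEquivalent.refl.mul h1
  refine h2.symm.tendsto_nhds ?_
  have h3 : Tendsto (fun n => c * ((⌈N n * y⌉₊ : ℝ) / N n) ^ (-β)) atTop (𝓝 (c * y ^ (-β))) :=
    (hz.rpow_const (Or.inl hy.ne')).const_mul c
  refine h3.congr' ?_
  filter_upwards [hN.eventually_gt_atTop 0] with n hn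
  rw [Real.div_rpow (by positivity) hn.le, Real.rpow_neg hn.le]
  field_simp

/-- Riemann sum asymptotics against a power-law distribution. -/
theorem tendsto_mul_integral_scaled [NormedSpace ℝ E] [CompleteSpace E]
    {P : Measure ℕ} [IsProbabilityMeasure P] {c β : ℝ} (hβ : 2 < β)
    (h : (fun k => P.real {k}) ~[atTop] fun k : ℕ => c * (k : ℝ) ^ (-β))
    {g : ℝ → E} {D : ℝ → ℝ} (hg0 : g 0 = 0) (hD : AntitoneOn D (Set.Ioi 0))
    (hDi : IntegrableOn D (Set.Ioi 0)) (hgD : ∀ y, 0 < y → y ^ (-β) * ‖g y‖ ≤ D y)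
    (hgc : ∀ᵐ y ∂volume.restrict (Set.Ioi 0), ContinuousAt g y) :
    Tendsto (fun n : ℕ => (n : ℝ) • ∫ k, g ((n : ℝ) ^ (-(1 / (β - 1))) * k) ∂P) atTop
      (𝓝 (∫ y in Set.Ioi 0, (c * y ^ (-β)) • g y)) := by
  obtain ⟨C, hC, hk⟩ := exists_le_rpow (fun k => measureReal_nonneg) h
  set N : ℕ → ℝ := fun n => (n : ℝ) ^ (1 / (β - 1)) with hNdef
  have hb : 0 < 1 / (β - 1) := by apply one_div_pos.2; linarith
  have hNt : Tendsto N atTop atTop :=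
    (tendsto_rpow_atTop hb).comp tendsto_natCast_atTop_atTop
  have hNpos : ∀ n : ℕ, 1 ≤ n → 0 < N n := fun n hn =>
    Real.rpow_pos_of_pos (by exact_mod_cast hn) _
  -- The scale satisfies N^(β-1) = n, so the prefactor n times the factor N from
  -- `hasSum_integral_ceil` is exactly the N^β that normalizes atoms at distance of order N.
  have hnN : ∀ n : ℕ, 1 ≤ n → (n : ℝ) * N n = N n ^ β := by
    intro n hn
    have hn0 : (0 : ℝ) < n := by exact_mod_cast hn
    have : (n : ℝ) = N n ^ (β - 1) := by
      rw [hNdef]; simp only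
      rw [← Real.rpow_mul hn0.le, one_div_mul_cancel (by linarith), Real.rpow_one]
    calc (n : ℝ) * N n = N n ^ (β - 1) * N n ^ (1 : ℝ) := by rw [← this, Real.rpow_one]
      _ = N n ^ β := by rw [← Real.rpow_add (hNpos n hn)]; ring_nf
  have hNinv : ∀ n : ℕ, (n : ℝ) ^ (-(1 / (β - 1))) = (N n)⁻¹ := fun n =>
    Real.rpow_neg (Nat.cast_nonneg n) _
  let F : ℕ → ℕ → E := fun n k => P.real {k} • g ((N n)⁻¹ * k)
  have hF0 : ∀ n, F n 0 = 0 := fun n => by simp [F, hg0]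
  let H : ℕ → ℝ → E := fun n y => N n ^ β • F n ⌈N n * y⌉₊
  -- Rounding up evaluates g at some z ≥ y. Monotonicity of D brings the bound at z back to y,
  -- giving a majorant independent of n.
  have hHb : ∀ n : ℕ, 1 ≤ n → ∀ y ∈ Set.Ioi (0 : ℝ), ‖H n y‖ ≤ C * D y := by
    intro n hn y hy
    have hy0 : (0 : ℝ) < y := hy
    have hn0 := hNpos n hn
    have hc1 : 1 ≤ ⌈N n * y⌉₊ := Nat.ceil_pos.2 (by positivity)
    set z : ℝ := (N n)⁻¹ * ⌈N n * y⌉₊ with hz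
    have hyz : y ≤ z := by
      rw [hz, inv_mul_eq_div, le_div_iff₀ hn0, mul_comm]; exact Nat.le_ceil _
    have hz0 : 0 < z := hy0.trans_le hyz
    have hkz : (⌈N n * y⌉₊ : ℝ) = N n * z := by rw [hz]; field_simp
    have h1 := hk _ hc1
    rw [hkz, Real.mul_rpow hn0.le hz0.le] at h1
    have h2 : ‖H n y‖ = N n ^ β * (P.real {⌈N n * y⌉₊} * ‖g z‖) := by
      simp only [H, F, norm_smul, Real.norm_of_nonneg measureReal_nonneg,
        Real.norm_of_nonneg (Real.rpow_nonneg hn0.le β), hz]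
    rw [h2]
    have h3 : N n ^ β * N n ^ (-β) = 1 := by rw [← Real.rpow_add hn0]; simp
    calc N n ^ β * (P.real {⌈N n * y⌉₊} * ‖g z‖)
        ≤ N n ^ β * ((C * (N n ^ (-β) * z ^ (-β))) * ‖g z‖) := by gcongr
      _ = (N n ^ β * N n ^ (-β)) * (C * (z ^ (-β) * ‖g z‖)) := by ring
      _ = C * (z ^ (-β) * ‖g z‖) := by rw [h3, one_mul]
      _ ≤ C * D y := mul_le_mul_of_nonneg_left ((hgD z hz0).trans (hD hy hz0 hyz)) hC.le
  have hHm : ∀ n, AEStronglyMeasurable (H n) (volume.restrict (Set.Ioi 0)) := by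
    intro n
    have : StronglyMeasurable (fun y => F n ⌈N n * y⌉₊) :=
      (StronglyMeasurable.of_discrete (f := F n)).comp_measurable (by fun_prop)
    exact (this.const_smul _).aestronglyMeasurable
  have hHi : ∀ n : ℕ, 1 ≤ n → IntegrableOn (H n) (Set.Ioi 0) := fun n hn =>
    (hDi.const_mul C).mono' (hHm n)
      ((ae_restrict_iff' measurableSet_Ioi).2 (ae_of_all _ (hHb n hn)))
  have hlim : Tendsto (fun n => ∫ y in Set.Ioi 0, H n y) atTop
      (𝓝 (∫ y in Set.Ioi 0, (c * y ^ (-β)) • g y)) := by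
    refine tendsto_integral_filter_of_dominated_convergence (fun y => C * D y)
      (Eventually.of_forall hHm) ?_ (hDi.const_mul C) ?_
    · filter_upwards [eventually_ge_atTop 1] with n hn
      exact (ae_restrict_iff' measurableSet_Ioi).2 (ae_of_all _ (hHb n hn))
    · filter_upwards [hgc, self_mem_ae_restrict measurableSet_Ioi] with y hgy hy
      have hy0 : (0 : ℝ) < y := hy
      have h1 := tendsto_rpow_mul_ceil hy0 h hNt
      have hz : Tendsto (fun n => (N n)⁻¹ * (⌈N n * y⌉₊ : ℝ)) atTop (𝓝 y) := by
        have := (tendsto_nat_ceil_div_atTop (R := ℝ)).comp (hNt.atTop_mul_const hy0)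
        have h2 := this.mul_const y
        rw [one_mul] at h2
        refine h2.congr' ?_
        filter_upwards [hNt.eventually_gt_atTop 0] with n hn
        simp only [Function.comp]
        field_simp
      have h3 := h1.smul (hgy.tendsto.comp hz)
      refine h3.congr fun n => ?_
      simp only [H, F, smul_smul, Function.comp]
  refine hlim.congr' ?_
  filter_upwards [eventually_ge_atTop 1] with n hn
  have hn0 := hNpos n hn
  have hNb : N n ^ β ≠ 0 := (Real.rpow_pos_of_pos hn0 _).ne'
  have hFi : IntegrableOn (fun y => F n ⌈N n * y⌉₊) (Set.Ioi 0) := by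
    have := (hHi n hn).smul (N n ^ β)⁻¹
    refine this.congr (ae_of_all _ fun y => ?_)
    simp only [H, Pi.smul_apply, smul_smul, inv_mul_cancel₀ hNb, one_smul]
  have hs := hasSum_integral_ceil hn0 (hF0 n) hFi
  have hsn := hasSum_integral_ceil hn0 (F := fun k => ‖F n k‖) (by simp [hF0 n]) hFi.norm
  have hint : Integrable (fun k : ℕ => g ((N n)⁻¹ * k)) P := by
    rw [integrable_nat_iff_summable]
    refine hsn.summable.congr fun k => ?_
    simp only [F, norm_smul, Real.norm_of_nonneg measureReal_nonneg]
  simp_rw [hNinv]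
  rw [integral_countable hint, hs.tsum_eq, smul_smul, hnN n hn, ← integral_smul]

end PowerTail

/-! ### Order statistics and their Poisson limit -/

section OrderStatistics

/-- The bridge from sorting to counting: later facts about values of order statistics mostly go
through the number of entries above a threshold. Reading the sorted tuple backwards makes it
antitone. -/
theorem le_ordered_iff {n : ℕ} (y : Fin n → ℕ) {j : ℕ} (hj : 1 ≤ j) (hjn : j ≤ n) (t : ℕ) :
    t ≤ ordered y j ↔ j ≤ (Finset.univ.filter fun i => t ≤ y i).card := by
  have hanti : Antitone fun i : Fin n => y (Tuple.sort y (Fin.rev i)) := fun a b hab =>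
    Tuple.monotone_sort y (Fin.rev_le_rev.2 hab)
  have h := Tuple.lt_card_ge_iff_apply_ge_of_antitone (a := t) (j := ⟨j - 1, by omega⟩) hanti
  rw [ordered, dif_pos ⟨hj, hjn⟩, ← h]
  have hc : (Finset.univ.filter fun i : Fin n => t ≤ y (Tuple.sort y (Fin.rev i))).card =
      (Finset.univ.filter fun i => t ≤ y i).card := by
    refine Finset.card_bij (fun i _ => Tuple.sort y (Fin.rev i)) (by simp) ?_ ?_
    · intro a _ b _ hab
      exact Fin.rev_injective ((Tuple.sort y).injective hab)
    · intro b hb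
      exact ⟨Fin.rev ((Tuple.sort y).symm b), by simpa using hb, by simp⟩
  rw [hc]
  simp only
  omega

/-- The binomial law: the event splits according to the exact set s of indices reaching the
threshold, and each piece is a product set. -/
theorem measureReal_pi_card_eq (P : Measure ℕ) [IsProbabilityMeasure P] (N k : ℕ) (t : ℕ) :
    (Measure.pi fun _ : Fin N => P).real
      {x | (Finset.univ.filter fun i => t ≤ x i).card = k} =
      N.choose k * P.real {l | t ≤ l} ^ k * (1 - P.real {l | t ≤ l}) ^ (N - k) := by
  have hset : {x : Fin N → ℕ | (Finset.univ.filter fun i => t ≤ x i).card = k} =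
      ⋃ s ∈ Finset.powersetCard k (Finset.univ : Finset (Fin N)),
        Set.univ.pi fun i => if i ∈ s then {l | t ≤ l} else {l | t ≤ l}ᶜ := by
    ext x
    simp only [Set.mem_ofPred_eq, Set.mem_iUnion, Finset.mem_powersetCard, Set.mem_univ_pi]
    constructor
    · intro h
      refine ⟨Finset.univ.filter fun i => t ≤ x i, ⟨Finset.subset_univ _, h⟩, fun i => ?_⟩
      by_cases hi : t ≤ x i <;> simp [hi]
    · rintro ⟨s, ⟨-, hs⟩, hx⟩
      rw [← hs]
      congr 1
      ext i
      have := hx i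
      by_cases hi : i ∈ s <;> simp [hi] at this ⊢ <;> omega
  rw [hset, measureReal_biUnion_finset]
  · have : ∀ s ∈ Finset.powersetCard k (Finset.univ : Finset (Fin N)),
        (Measure.pi fun _ : Fin N => P).real
          (Set.univ.pi fun i => if i ∈ s then {l | t ≤ l} else {l | t ≤ l}ᶜ) =
        P.real {l | t ≤ l} ^ k * (1 - P.real {l | t ≤ l}) ^ (N - k) := by
      intro s hs
      obtain ⟨-, hs⟩ := Finset.mem_powersetCard.1 hs
      rw [measureReal_def, Measure.pi_pi, ENNReal.toReal_prod]
      have : ∀ i, (P (if i ∈ s then {l | t ≤ l} else {l | t ≤ l}ᶜ)).toReal =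
          if i ∈ s then P.real {l | t ≤ l} else 1 - P.real {l | t ≤ l} := by
        intro i
        split_ifs
        · rfl
        · exact probReal_compl_eq_one_sub (MeasurableSet.of_discrete)
      simp_rw [this]
      rw [Finset.prod_ite]
      simp only [Finset.prod_const]
      rw [Finset.filter_mem_eq_inter, Finset.univ_inter, hs, Finset.filter_not,
        Finset.filter_mem_eq_inter, Finset.univ_inter, Finset.card_sdiff_of_subset
        (Finset.subset_univ _), hs, Finset.card_univ, Fintype.card_fin]
    rw [Finset.sum_congr rfl this, Finset.sum_const, Finset.card_powersetCard, Finset.card_univ,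
      Fintype.card_fin, nsmul_eq_mul, mul_assoc]
  · intro s _ s' _ hss
    refine Set.disjoint_left.2 fun x hx hx' => hss ?_
    ext i
    have h1 := Set.mem_univ_pi.1 hx i
    have h2 := Set.mem_univ_pi.1 hx' i
    by_cases hi : i ∈ s <;> by_cases hi' : i ∈ s' <;> simp [hi, hi'] at h1 h2 ⊢ <;> omega
  · exact fun s _ => MeasurableSet.of_discrete

theorem measureReal_pi_card_lt (P : Measure ℕ) [IsProbabilityMeasure P] (N k : ℕ) (t : ℕ) :
    (Measure.pi fun _ : Fin N => P).real
      {x | (Finset.univ.filter fun i => t ≤ x i).card < k} =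
      ∑ i ∈ Finset.range k,
        N.choose i * P.real {l | t ≤ l} ^ i * (1 - P.real {l | t ≤ l}) ^ (N - i) := by
  have hset : {x : Fin N → ℕ | (Finset.univ.filter fun i => t ≤ x i).card < k} =
      ⋃ i ∈ Finset.range k, {x | (Finset.univ.filter fun i => t ≤ x i).card = i} := by
    ext x; simp
  rw [hset, measureReal_biUnion_finset]
  · exact Finset.sum_congr rfl fun i _ => measureReal_pi_card_eq P N i t
  · intro i _ j _ hij
    exact Set.disjoint_left.2 fun x hx hx' => hij (hx.symm.trans hx')
  · exact fun s _ => MeasurableSet.of_discrete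

theorem tendsto_mul_tail {P : Measure ℕ} [IsProbabilityMeasure P] {c β : ℝ} (hβ : 2 < β)
    (h : (fun k => P.real {k}) ~[atTop] fun k : ℕ => c * (k : ℝ) ^ (-β)) {x : ℝ} (hx : 0 < x) :
    Tendsto (fun n : ℕ => (n : ℝ) * P.real {k | x < (n : ℝ) ^ (-(1 / (β - 1))) * (k : ℝ)}) atTop
      (𝓝 (c / (β - 1) * x ^ (-(β - 1)))) := by
  have hb : -β < -1 := by linarith
  have key := tendsto_mul_integral_scaled (E := ℝ) hβ h
    -- Capping y^(-β) at its value in x makes the majorant integrable at 0 while keeping it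
    -- antitone.
    (g := (Set.Ioi x).indicator fun _ => 1) (D := fun y => min (x ^ (-β)) (y ^ (-β)))
    (by simp [hx.le]) ?_ ?_ ?_ ?_
  · have hval : ∫ y in Set.Ioi 0, (c * y ^ (-β)) • (Set.Ioi x).indicator (fun _ => (1 : ℝ)) y =
        c / (β - 1) * x ^ (-(β - 1)) := by
      have : ∀ y, (c * y ^ (-β)) • (Set.Ioi x).indicator (fun _ => (1 : ℝ)) y =
          (Set.Ioi x).indicator (fun y => c * y ^ (-β)) y := by
        intro y
        by_cases hy : y ∈ Set.Ioi x <;> simp [hy]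
      simp_rw [this]
      rw [setIntegral_indicator measurableSet_Ioi, Set.Ioi_inter_Ioi, max_eq_right hx.le,
        integral_const_mul, integral_Ioi_rpow_of_lt hb hx]
      have : -(β - 1) = -β + 1 := by ring
      rw [this, ← neg_div_neg_eq, neg_neg]
      have : -(-β + 1) = β - 1 := by ring
      rw [this]; ring
    rw [hval] at key
    refine key.congr fun n => ?_
    rw [smul_eq_mul]
    congr 1
    have : (fun k : ℕ => (Set.Ioi x).indicator (fun _ => (1 : ℝ))
        ((n : ℝ) ^ (-(1 / (β - 1))) * k)) =
        {k : ℕ | x < (n : ℝ) ^ (-(1 / (β - 1))) * (k : ℝ)}.indicator 1 := by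
      ext k
      simp [Set.indicator_apply]
    rw [this, integral_indicator_one MeasurableSet.of_discrete]
  · intro a ha b hb' hab
    exact min_le_min_left _ (Real.rpow_le_rpow_of_nonpos ha hab (by linarith))
  · rw [← Set.Ioc_union_Ioi_eq_Ioi hx.le]
    refine IntegrableOn.union ?_ ?_
    · refine Integrable.mono' (g := fun _ => x ^ (-β)) (by simp) ?_ ?_
      · exact Measurable.aestronglyMeasurable (by fun_prop)
      · refine (ae_restrict_iff' measurableSet_Ioc).2 (ae_of_all _ fun y hy => ?_)
        rw [Real.norm_of_nonneg (le_min (Real.rpow_nonneg hx.le _) (Real.rpow_nonneg hy.1.le _))]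
        exact min_le_left _ _
    · refine Integrable.mono' (integrableOn_Ioi_rpow_of_lt hb hx) ?_ ?_
      · exact Measurable.aestronglyMeasurable (by fun_prop)
      · refine (ae_restrict_iff' measurableSet_Ioi).2 (ae_of_all _ fun y hy => ?_)
        have hy0 : 0 < y := hx.trans hy
        rw [Real.norm_of_nonneg (le_min (Real.rpow_nonneg hx.le _) (Real.rpow_nonneg hy0.le _))]
        exact min_le_right _ _
  · intro y hy
    by_cases hxy : y ∈ Set.Ioi x
    · simp only [hxy, Set.indicator_of_mem, norm_one, mul_one]
      exact le_min (Real.rpow_le_rpow_of_nonpos hx (le_of_lt hxy) (by linarith)) le_rfl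
    · simp only [hxy, not_false_eq_true, Set.indicator_of_notMem, norm_zero, mul_zero]
      exact le_min (Real.rpow_nonneg hx.le _) (Real.rpow_nonneg hy.le _)
  · have : ∀ᵐ y ∂(volume : Measure ℝ), y ≠ x := by simp [ae_iff, measure_singleton]
    refine ae_restrict_of_ae (this.mono fun y hy => ?_)
    rcases lt_or_gt_of_ne hy with hlt | hgt
    · refine (continuousAt_const (y := (0 : ℝ))).congr ?_
      filter_upwards [Iio_mem_nhds hlt] with z hz
      simp [le_of_lt (Set.mem_Iio.1 hz)]
    · refine (continuousAt_const (y := (1 : ℝ))).congr ?_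
      filter_upwards [Ioi_mem_nhds hgt] with z hz
      simp [hz.out]

/-- `∑_{i < k} e^{-τ} τ^i / i!`, with `τ = (c / α) x^{-α}`. -/
noncomputable def limitCdf (c α : ℝ) (k : ℕ) (x : ℝ) : ℝ :=
  ∑ i ∈ Finset.range k,
    Real.exp (-(c / α * x ^ (-α))) * (c / α * x ^ (-α)) ^ i / (i.factorial : ℝ)

/-- The k-th largest value is at most x when fewer than k values exceed x. That count is binomial
with mean tending to τ = (c/α) x^(-α), so the probability tends to a Poisson(τ) distribution
function. -/
theorem tendsto_measureReal_ordered_le {P : Measure ℕ} [IsProbabilityMeasure P] {c β : ℝ}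
    (hβ : 2 < β) (h : (fun k => P.real {k}) ~[atTop] fun k : ℕ => c * (k : ℝ) ^ (-β))
    {k : ℕ} (hk : 1 ≤ k) {x : ℝ} (hx : 0 < x) :
    Tendsto (fun n : ℕ => (Measure.pi fun _ : Fin (n - 1) => P).real
      {v | (n : ℝ) ^ (-(1 / (β - 1))) * (ordered v k : ℝ) ≤ x}) atTop
      (𝓝 (limitCdf c (β - 1) k x)) := by
  set q : ℕ → ℝ := fun n => P.real {l | x < (n : ℝ) ^ (-(1 / (β - 1))) * (l : ℝ)} with hq
  have ht := tendsto_mul_tail hβ h hx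
  have hq0 : Tendsto q atTop (𝓝 0) := tendsto_zero_of_tendsto_mul_atTop ht
  -- There are n - 1 variables at scale n. After an index shift the discrepancy is one q, which
  -- tends to 0.
  have ht' : Tendsto (fun n : ℕ => (n : ℝ) * q (n + 1)) atTop
      (𝓝 (c / (β - 1) * x ^ (-(β - 1)))) := by
    have h1 := (ht.comp (tendsto_add_atTop_nat 1)).sub (hq0.comp (tendsto_add_atTop_nat 1))
    rw [sub_zero] at h1
    refine h1.congr fun n => ?_
    simp only [Function.comp, hq]
    push_cast
    ring
  have hsum : Tendsto (fun n : ℕ => ∑ i ∈ Finset.range k,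
      (n.choose i : ℝ) * q (n + 1) ^ i * (1 - q (n + 1)) ^ (n - i)) atTop
      (𝓝 (limitCdf c (β - 1) k x)) :=
    tendsto_finsetSum _ fun i _ => tendsto_choose_mul_pow_of_tendsto_mul_atTop i ht'
  rw [← tendsto_add_atTop_iff_nat 1]
  refine hsum.congr' ?_
  filter_upwards [eventually_ge_atTop k] with n hn
  set N : ℝ := ((n + 1 : ℕ) : ℝ) ^ (1 / (β - 1)) with hN
  have hN0 : 0 < N := Real.rpow_pos_of_pos (by positivity) _
  have hNinv : ((n + 1 : ℕ) : ℝ) ^ (-(1 / (β - 1))) = N⁻¹ := Real.rpow_neg (by positivity) _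
  have hiff : ∀ l : ℕ, x < N⁻¹ * (l : ℝ) ↔ ⌊N * x⌋₊ + 1 ≤ l := by
    intro l
    rw [Nat.succ_le_iff, Nat.floor_lt (by positivity), inv_mul_eq_div, lt_div_iff₀ hN0, mul_comm]
  have hset : {v : Fin n → ℕ | N⁻¹ * (ordered v k : ℝ) ≤ x} =
      {v | (Finset.univ.filter fun i => ⌊N * x⌋₊ + 1 ≤ v i).card < k} := by
    ext v
    rw [Set.mem_ofPred_eq, Set.mem_ofPred_eq, ← not_lt, hiff, le_ordered_iff v hk hn, not_le]
  have hqn : q (n + 1) = P.real {l | ⌊N * x⌋₊ + 1 ≤ l} := by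
    simp only [hq, hNinv, hiff]
  rw [hNinv]
  change _ = (Measure.pi fun _ : Fin n => P).real {v : Fin n → ℕ | N⁻¹ * (ordered v k : ℝ) ≤ x}
  rw [hset, measureReal_pi_card_lt, hqn]

end OrderStatistics

/-! ### Typical sums and typical maxima -/

section LawOfLargeNumbers

theorem map_infinitePi_prefix (P : Measure ℕ) [IsProbabilityMeasure P] (n : ℕ) :
    (Measure.infinitePi fun _ : ℕ => P).map (fun ω (i : Fin n) => ω i) =
      Measure.pi fun _ : Fin n => P := by
  rw [Measure.map_infinitePi_infinitePi_of_inj (P := fun _ : ℕ => P)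
    (f := fun i : Fin n => (i : ℕ)) Fin.val_injective, Measure.infinitePi_eq_pi]

/-- The strong law on the infinite product implies convergence in measure, and each finite product
is the law of a prefix. The sum has n - 1 terms but is compared with ν n; the missing term is
harmless. -/
theorem tendsto_measureReal_sum_deviation {P : Measure ℕ} [IsProbabilityMeasure P]
    (hint : Integrable (fun k : ℕ => (k : ℝ)) P) {δ : ℝ} (hδ : 0 < δ) :
    Tendsto (fun n : ℕ => (Measure.pi fun _ : Fin (n - 1) => P).real
      {x | δ * n ≤ |∑ i, (x i : ℝ) - (∫ k : ℕ, (k : ℝ) ∂P) * n|}) atTop (𝓝 0) := by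
  set ν := ∫ k : ℕ, (k : ℝ) ∂P with hν
  set μ := Measure.infinitePi fun _ : ℕ => P with hμ
  let X : ℕ → (ℕ → ℕ) → ℝ := fun i ω => (ω i : ℝ)
  have hX : ∀ i, Measurable (X i) := fun i => by fun_prop
  have hmap : ∀ i, μ.map (X i) = P.map (fun k : ℕ => (k : ℝ)) := by
    intro i
    have := Measure.infinitePi_map_eval (fun _ : ℕ => P) i
    rw [← this, Measure.map_map (by fun_prop) (by fun_prop)]
    rfl
  have hX0 : Integrable (X 0) μ := by
    have h1 : Integrable (fun r : ℝ => r) (μ.map (X 0)) := by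
      rw [hmap, integrable_map_measure (by fun_prop) (by fun_prop)]
      exact hint
    exact (integrable_map_measure (f := X 0) (g := fun r : ℝ => r) (by fun_prop)
      (hX 0).aemeasurable).1 h1
  have hE : μ[X 0] = ν := by
    have h1 : ∫ r, r ∂(μ.map (X 0)) = ∫ ω, X 0 ω ∂μ := integral_map (by fun_prop) (by fun_prop)
    rw [← h1, hmap, integral_map (by fun_prop) (by fun_prop)]
  have hind : iIndepFun X μ :=
    iIndepFun_infinitePi (X := fun _ (k : ℕ) => (k : ℝ)) (by fun_prop)
  have hlaw := strong_law_ae_real X hX0 (fun i j hij => hind.indepFun hij)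
    (fun i => ⟨(hX i).aemeasurable, (hX 0).aemeasurable, by rw [hmap, hmap]⟩)
  rw [hE] at hlaw
  have hlaw' : ∀ᵐ ω ∂μ, Tendsto (fun n : ℕ => (∑ i ∈ Finset.range (n - 1), X i ω) / n) atTop
      (𝓝 ν) := by
    filter_upwards [hlaw] with ω hω
    rw [← tendsto_add_atTop_iff_nat 1]
    have h1 := hω.mul (tendsto_natCast_div_add_atTop (1 : ℝ))
    rw [mul_one] at h1
    refine h1.congr' ?_
    filter_upwards [eventually_gt_atTop 0] with n hn
    have : (n : ℝ) ≠ 0 := by exact_mod_cast hn.ne'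
    simp only [Nat.add_sub_cancel]
    push_cast
    field_simp
  have hm := tendstoInMeasure_of_tendsto_ae (fun n => Measurable.aestronglyMeasurable
    (by fun_prop)) hlaw' (ENNReal.ofReal δ) (by simpa using hδ)
  have h0 := (ENNReal.tendsto_toReal ENNReal.zero_ne_top).comp hm
  rw [ENNReal.toReal_zero] at h0
  refine h0.congr' ?_
  filter_upwards [eventually_gt_atTop 0] with n hn
  have hn0 : (0 : ℝ) < n := by exact_mod_cast hn
  rw [Function.comp, measureReal_def, ← map_infinitePi_prefix,
    Measure.map_apply (by fun_prop) MeasurableSet.of_discrete]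
  congr 2
  ext ω
  simp only [Set.mem_ofPred_eq, Set.mem_preimage, edist_dist, X]
  rw [ENNReal.ofReal_le_ofReal_iff dist_nonneg, Real.dist_eq, Finset.sum_range,
    div_sub' hn0.ne', abs_div, abs_of_pos hn0, le_div_iff₀ hn0, mul_comm (n : ℝ) ν]

theorem measureReal_le_mul_rpow {P : Measure ℕ} [IsProbabilityMeasure P] {γ : ℝ} (hγ : 0 ≤ γ)
    (hint : Integrable (fun k : ℕ => (k : ℝ) ^ γ) P) {u : ℝ} (hu : 0 < u) :
    P.real {k : ℕ | u ≤ k} ≤ (∫ k : ℕ, (k : ℝ) ^ γ ∂P) * u ^ (-γ) := by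
  have h := mul_meas_ge_le_integral_of_nonneg (ae_of_all _ fun k : ℕ => by positivity) hint (u ^ γ)
  have hsub : P.real {k : ℕ | u ≤ k} ≤ P.real {k : ℕ | u ^ γ ≤ (k : ℝ) ^ γ} :=
    measureReal_mono fun k hk => Real.rpow_le_rpow hu.le hk hγ
  rw [Real.rpow_neg hu.le, ← div_eq_mul_inv, le_div_iff₀ (Real.rpow_pos_of_pos hu _), mul_comm]
  exact (mul_le_mul_of_nonneg_left hsub (Real.rpow_nonneg hu.le _)).trans h

/-- Union bound with Markov's inequality for the γ-th moment: n (δn)^(-γ) → 0 because γ > 1. -/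
theorem tendsto_measureReal_exists_le {P : Measure ℕ} [IsProbabilityMeasure P] {γ : ℝ}
    (hγ : 1 < γ) (hint : Integrable (fun k : ℕ => (k : ℝ) ^ γ) P) {δ : ℝ} (hδ : 0 < δ) :
    Tendsto (fun n : ℕ => (Measure.pi fun _ : Fin (n - 1) => P).real
      {x | ∃ i, δ * n ≤ (x i : ℝ)}) atTop (𝓝 0) := by
  set M := ∫ k : ℕ, (k : ℝ) ^ γ ∂P
  have hM : 0 ≤ M := integral_nonneg fun k => by positivity
  have hlim : Tendsto (fun n : ℕ => M * δ ^ (-γ) * (n : ℝ) ^ (-(γ - 1))) atTop (𝓝 0) := by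
    have := ((tendsto_rpow_neg_atTop (show 0 < γ - 1 by linarith)).comp
      tendsto_natCast_atTop_atTop).const_mul (M * δ ^ (-γ))
    rwa [mul_zero] at this
  refine squeeze_zero' (Eventually.of_forall fun n => measureReal_nonneg) ?_ hlim
  filter_upwards [eventually_gt_atTop 0] with n hn
  have hn0 : (0 : ℝ) < n := by exact_mod_cast hn
  have hset : {x : Fin (n - 1) → ℕ | ∃ i, δ * n ≤ (x i : ℝ)} =
      ⋃ i ∈ (Finset.univ : Finset (Fin (n - 1))),
        (Function.eval i) ⁻¹' {k : ℕ | δ * n ≤ (k : ℝ)} := by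
    ext x; simp
  rw [hset]
  refine (measureReal_biUnion_finset_le _ _).trans ?_
  have hone : ∀ i : Fin (n - 1), (Measure.pi fun _ : Fin (n - 1) => P).real
      ((Function.eval i) ⁻¹' {k : ℕ | δ * n ≤ (k : ℝ)}) = P.real {k : ℕ | δ * n ≤ (k : ℝ)} := by
    intro i
    exact (measurePreserving_eval (fun _ : Fin (n - 1) => P) i).measureReal_preimage
      MeasurableSet.of_discrete.nullMeasurableSet
  simp_rw [hone]
  rw [Finset.sum_const, Finset.card_univ, Fintype.card_fin, nsmul_eq_mul]
  have h1 := measureReal_le_mul_rpow (by linarith) hint (mul_pos hδ hn0)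
  have h2 : ((n - 1 : ℕ) : ℝ) ≤ n := by exact_mod_cast Nat.sub_le n 1
  calc ((n - 1 : ℕ) : ℝ) * P.real {k : ℕ | δ * n ≤ (k : ℝ)} ≤ n * (M * (δ * n) ^ (-γ)) := by
        gcongr
    _ = M * δ ^ (-γ) * (n : ℝ) ^ (-(γ - 1)) := by
        rw [Real.mul_rpow hδ.le hn0.le, show -(γ - 1) = -γ + 1 by ring, Real.rpow_add hn0,
          Real.rpow_one]
        ring

end LawOfLargeNumbers

/-! ### Chernoff bound when no entry is large -/

section Chernoff

/-- A second-order expansion with x^γ in place of x², since P may lack a second moment. -/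
theorem exp_le_one_add_add {x γ : ℝ} (hx : 0 ≤ x) (h1 : 0 ≤ γ) (h2 : γ ≤ 2) :
    Real.exp x ≤ 1 + x + x ^ γ * Real.exp x := by
  rcases le_or_gt x 1 with hx1 | hx1
  · have ha : (1 - x) * Real.exp x ≤ 1 := by
      calc (1 - x) * Real.exp x ≤ Real.exp (-x) * Real.exp x :=
            mul_le_mul_of_nonneg_right (Real.one_sub_le_exp_neg x) (Real.exp_pos x).le
        _ = 1 := by rw [← Real.exp_add]; simp
    have hb : x ^ 2 ≤ x ^ γ := by
      rcases hx.eq_or_lt with rfl | h0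
      · simpa using Real.rpow_nonneg le_rfl γ
      · rw [← Real.rpow_two]
        exact Real.rpow_le_rpow_of_exponent_ge h0 hx1 h2
    nlinarith [Real.exp_pos x, mul_le_mul_of_nonneg_right hb (Real.exp_pos x).le]
  · have : 1 ≤ x ^ γ := Real.one_le_rpow hx1.le h1
    nlinarith [Real.exp_pos x, mul_le_mul_of_nonneg_right this (Real.exp_pos x).le]

/-- Markov's inequality for the product of the truncated exponentials e^(sk) 1{k ≤ K}. Truncation
gives a power law an exponential moment, at the price of e^(sK) in the error term. -/
theorem measureReal_sum_eq_le {P : Measure ℕ} [IsProbabilityMeasure P] {γ : ℝ} (h1 : 0 ≤ γ)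
    (h2 : γ ≤ 2) (hint1 : Integrable (fun k : ℕ => (k : ℝ)) P)
    (hint : Integrable (fun k : ℕ => (k : ℝ) ^ γ) P) {s : ℝ} (hs : 0 ≤ s) (K : ℝ) (n m : ℕ) :
    (Measure.pi fun _ : Fin n => P).real {y | (∀ i, (y i : ℝ) ≤ K) ∧ ∑ i, y i = m} ≤
      Real.exp (-(s * m) + n * (s * (∫ k : ℕ, (k : ℝ) ∂P) +
        s ^ γ * Real.exp (s * K) * ∫ k : ℕ, (k : ℝ) ^ γ ∂P)) := by
  let f : ℕ → ℝ := fun k => if (k : ℝ) ≤ K then Real.exp (s * k) else 0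
  have hf0 : ∀ k, 0 ≤ f k := fun k => by simp only [f]; split_ifs <;> positivity
  have hfK : ∀ k, f k ≤ Real.exp (s * K) := fun k => by
    simp only [f]; split_ifs with h
    · gcongr
    · positivity
  have hfi : Integrable f P := Integrable.of_bound
    (StronglyMeasurable.of_discrete.aestronglyMeasurable) (Real.exp (s * K))
    (ae_of_all _ fun k => by rw [Real.norm_of_nonneg (hf0 k)]; exact hfK k)
  have hfle : ∀ k : ℕ, f k ≤ 1 + s * k + s ^ γ * Real.exp (s * K) * (k : ℝ) ^ γ := by
    intro k
    simp only [f]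
    have hsk : 0 ≤ s * (k : ℝ) := by positivity
    split_ifs with h
    · refine (exp_le_one_add_add hsk h1 h2).trans ?_
      rw [Real.mul_rpow hs (by positivity)]
      have : Real.exp (s * k) ≤ Real.exp (s * K) := by gcongr
      have h3 : 0 ≤ s ^ γ * (k : ℝ) ^ γ :=
        mul_nonneg (Real.rpow_nonneg hs _) (Real.rpow_nonneg (by positivity) _)
      nlinarith [mul_le_mul_of_nonneg_left this h3]
    · have h3 : 0 ≤ s ^ γ * Real.exp (s * K) * (k : ℝ) ^ γ :=
        mul_nonneg (mul_nonneg (Real.rpow_nonneg hs _) (Real.exp_pos _).le)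
          (Real.rpow_nonneg (by positivity) _)
      linarith
  have hEf : ∫ k, f k ∂P ≤ Real.exp (s * (∫ k : ℕ, (k : ℝ) ∂P) +
      s ^ γ * Real.exp (s * K) * ∫ k : ℕ, (k : ℝ) ^ γ ∂P) := by
    have hi2 : Integrable (fun k : ℕ => s ^ γ * Real.exp (s * K) * (k : ℝ) ^ γ) P :=
      hint.const_mul _
    have hi1 : Integrable (fun k : ℕ => 1 + s * (k : ℝ)) P :=
      (integrable_const 1).add (hint1.const_mul s)
    calc ∫ k, f k ∂P ≤ ∫ k : ℕ, (1 + s * k + s ^ γ * Real.exp (s * K) * (k : ℝ) ^ γ) ∂P :=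
          integral_mono hfi (hi1.add hi2) hfle
      _ = s * (∫ k : ℕ, (k : ℝ) ∂P) +
          s ^ γ * Real.exp (s * K) * (∫ k : ℕ, (k : ℝ) ^ γ ∂P) + 1 := by
          rw [integral_add hi1 hi2, integral_add (integrable_const 1) (hint1.const_mul s),
            integral_const_mul, integral_const_mul]
          simp
          ring
      _ ≤ _ := Real.add_one_le_exp _
  set Q := Measure.pi fun _ : Fin n => P
  have hprod : ∫ y, ∏ i, f (y i) ∂Q = (∫ k, f k ∂P) ^ n := by
    have := integral_fintype_prod_eq_pow (ι := Fin n) f (μ := P)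
    rwa [Fintype.card_fin] at this
  have hpi : Integrable (fun y : Fin n → ℕ => ∏ i, f (y i)) Q := Integrable.fintype_prod fun _ => hfi
  set S : Set (Fin n → ℕ) := {y | (∀ i, (y i : ℝ) ≤ K) ∧ ∑ i, y i = m} with hS
  have hSle : S ⊆ {y | Real.exp (s * m) ≤ ∏ i, f (y i)} := by
    rintro y ⟨hy, hym⟩
    have : ∏ i, f (y i) = Real.exp (s * m) := by
      simp only [f, hy, if_true]
      rw [← Real.exp_sum, ← Finset.mul_sum, ← hym]
      push_cast
      rfl
    exact this.ge
  have hmarkov := mul_meas_ge_le_integral_of_nonneg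
    (ae_of_all _ fun y : Fin n → ℕ => Finset.prod_nonneg fun i _ => hf0 (y i)) hpi
    (Real.exp (s * m))
  rw [hprod] at hmarkov
  have h3 : Real.exp (s * m) * Q.real S ≤ (∫ k, f k ∂P) ^ n :=
    (mul_le_mul_of_nonneg_left (measureReal_mono hSle) (Real.exp_pos _).le).trans hmarkov
  have h4 : (∫ k, f k ∂P) ^ n ≤ Real.exp (n * (s * (∫ k : ℕ, (k : ℝ) ∂P) +
        s ^ γ * Real.exp (s * K) * ∫ k : ℕ, (k : ℝ) ^ γ ∂P)) := by
    rw [Real.exp_nat_mul]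
    exact pow_le_pow_left₀ (integral_nonneg hf0) hEf n
  rw [Real.exp_add, Real.exp_neg, inv_mul_eq_div, le_div_iff₀ (Real.exp_pos _), mul_comm]
  exact h3.trans h4

/-- With tilt s = A log n / n the gain s(m - νn) beats any chosen power of n for A large. The factor
e^(sδn) = n^(Aδ) stays small enough when δ is small relative to 1/A. -/
theorem exists_tendsto_small_jumps {P : Measure ℕ} [IsProbabilityMeasure P] {γ : ℝ} (h1 : 1 < γ)
    (h2 : γ ≤ 2) (hint1 : Integrable (fun k : ℕ => (k : ℝ)) P)
    (hint : Integrable (fun k : ℕ => (k : ℝ) ^ γ) P) {lam : ℝ} {m : ℕ → ℕ}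
    (hm : Tendsto (fun n : ℕ => (m n : ℝ) / n) atTop (𝓝 lam))
    (hlam : ∫ k : ℕ, (k : ℝ) ∂P < lam) {b : ℝ} (hb : 0 < b) :
    ∃ δ : ℝ, 0 < δ ∧ Tendsto (fun n : ℕ => (n : ℝ) ^ b * (Measure.pi fun _ : Fin n => P).real
      {y | (∀ i, (y i : ℝ) ≤ δ * n) ∧ ∑ i, y i = m n}) atTop (𝓝 0) := by
  set ν := ∫ k : ℕ, (k : ℝ) ∂P
  set M := ∫ k : ℕ, (k : ℝ) ^ γ ∂P
  have hM : 0 ≤ M := integral_nonneg fun k => by positivity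
  set a := lam - ν with ha
  have ha0 : 0 < a := sub_pos.2 hlam
  -- Eventually m - νn exceeds an/2, so the exponent gains at least A(a/2) log n = (b + 1) log n.
  set A := 2 * (b + 1) / a with hA
  have hA0 : 0 < A := by positivity
  -- This makes e^(sδn) = n^((γ-1)/2), so the error n s^γ e^(sδn) is of order n^(-(γ-1)/2) up to
  -- logarithms.
  set δ := (γ - 1) / (2 * A) with hδ
  have hδ0 : 0 < δ := div_pos (by linarith) (by linarith)
  refine ⟨δ, hδ0, ?_⟩
  have hAδ : A * δ = (γ - 1) / 2 := by rw [hδ]; field_simp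
  -- the error term tends to zero
  have herr : Tendsto (fun n : ℕ => A ^ γ * M * (Real.log n ^ γ * (n : ℝ) ^ (-((γ - 1) / 2))))
      atTop (𝓝 0) := by
    have h := (isLittleO_log_rpow_rpow_atTop γ (show 0 < (γ - 1) / 2 by linarith)).tendsto_div_nhds_zero
    have h' := (h.comp tendsto_natCast_atTop_atTop).const_mul (A ^ γ * M)
    rw [mul_zero] at h'
    refine h'.congr fun n => ?_
    simp only [Function.comp]
    rw [Real.rpow_neg (by positivity)]
    ring
  have hfin : Tendsto (fun n : ℕ => Real.exp 1 * (n : ℝ) ^ (-(1 : ℝ))) atTop (𝓝 0) := by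
    have := ((tendsto_rpow_neg_atTop (show (0 : ℝ) < 1 by norm_num)).comp
      tendsto_natCast_atTop_atTop).const_mul (Real.exp 1)
    rwa [mul_zero] at this
  refine squeeze_zero' (Eventually.of_forall fun n => by positivity) ?_ hfin
  filter_upwards [eventually_ge_atTop 2, herr.eventually (Iio_mem_nhds one_pos),
    hm.eventually (Ioi_mem_nhds (show lam - a / 2 < lam by linarith))] with n hn hne hmn
  have hn0 : (0 : ℝ) < n := by positivity
  have hlog : 0 < Real.log n := Real.log_pos (by exact_mod_cast hn)
  set s := A * Real.log n / n with hs
  have hs0 : 0 < s := by positivity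
  have hb1 := measureReal_sum_eq_le (by linarith) h2 hint1 hint hs0.le (δ * n) n (m n)
  have hsK : Real.exp (s * (δ * n)) = (n : ℝ) ^ ((γ - 1) / 2) := by
    rw [Real.rpow_def_of_pos hn0, ← hAδ, hs]
    congr 1; field_simp
  have hterm : (n : ℝ) * (s ^ γ * Real.exp (s * (δ * n)) * M) < 1 := by
    have : (n : ℝ) * (s ^ γ * Real.exp (s * (δ * n)) * M) =
        A ^ γ * M * (Real.log n ^ γ * (n : ℝ) ^ (-((γ - 1) / 2))) := by
      rw [hsK, hs, Real.div_rpow (by positivity) hn0.le, Real.mul_rpow hA0.le hlog.le]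
      have e1 : (n : ℝ) ^ (-((γ - 1) / 2)) = (n : ℝ) * (n : ℝ) ^ ((γ - 1) / 2) / (n : ℝ) ^ γ := by
        rw [show -((γ - 1) / 2) = 1 + (γ - 1) / 2 - γ by ring, Real.rpow_sub hn0,
          Real.rpow_add hn0, Real.rpow_one]
      rw [e1]; ring
    rw [this]; exact hne
  have hexp : -(s * m n) + n * (s * ν + s ^ γ * Real.exp (s * (δ * n)) * M) ≤
      1 - (b + 1) * Real.log n := by
    have e1 : lam - a / 2 < (m n : ℝ) / n := hmn
    rw [lt_div_iff₀ hn0] at e1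
    have e2 : s * n = A * Real.log n := by rw [hs]; field_simp
    have e3 : A * a = 2 * (b + 1) := by rw [hA]; field_simp
    have e4 : s * ((lam - a / 2) * n) ≤ s * m n := mul_le_mul_of_nonneg_left e1.le hs0.le
    have e5 : s * ((lam - a / 2) * n) - n * (s * ν) = (b + 1) * Real.log n := by
      calc s * ((lam - a / 2) * n) - n * (s * ν) = (s * n) * (a / 2) := by rw [ha]; ring
        _ = (A * a) * Real.log n / 2 := by rw [e2]; ring
        _ = _ := by rw [e3]; ring
    rw [mul_add]
    linarith
  calc (n : ℝ) ^ b * (Measure.pi fun _ : Fin n => P).real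
        {y | (∀ i, (y i : ℝ) ≤ δ * n) ∧ ∑ i, y i = m n}
      ≤ (n : ℝ) ^ b * Real.exp (1 - (b + 1) * Real.log n) := by
        gcongr
        exact hb1.trans (Real.exp_le_exp.2 hexp)
    _ = Real.exp 1 * (n : ℝ) ^ (-(1 : ℝ)) := by
        rw [Real.rpow_def_of_pos hn0, Real.rpow_def_of_pos hn0, ← Real.exp_add, ← Real.exp_add]
        congr 1; ring

end Chernoff

/-! ### Removing a maximal coordinate -/

section Insertion

theorem card_filter_le_succAbove {N : ℕ} (y : Fin (N + 1) → ℕ) (i : Fin (N + 1)) (t : ℕ) :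
    (Finset.univ.filter fun l => t ≤ y l).card =
      (if t ≤ y i then 1 else 0) + (Finset.univ.filter fun l => t ≤ i.removeNth y l).card := by
  rw [Finset.card_filter, Fin.sum_univ_succAbove _ i, Finset.card_filter]
  rfl

theorem ordered_one_of_forall_le {N : ℕ} (y : Fin (N + 1) → ℕ) (i : Fin (N + 1))
    (h : ∀ l, i.removeNth y l ≤ y i) : ordered y 1 = y i := by
  refine eq_of_forall_le_iff fun t => ?_
  rw [le_ordered_iff y le_rfl (by omega), Nat.one_le_iff_ne_zero, Finset.card_ne_zero]
  constructor
  · rintro ⟨l, hl⟩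
    have hl' : t ≤ y l := by simpa using hl
    rcases Fin.eq_self_or_eq_succAbove i l with rfl | ⟨l', rfl⟩
    · exact hl'
    · exact hl'.trans (h l')
  · exact fun ht => ⟨i, by simpa using ht⟩

theorem ordered_succ_of_forall_le {N : ℕ} (y : Fin (N + 1) → ℕ) (i : Fin (N + 1))
    (h : ∀ l, i.removeNth y l ≤ y i) {j : ℕ} (hj : 1 ≤ j) (hjN : j ≤ N) :
    ordered y (j + 1) = ordered (i.removeNth y) j := by
  refine eq_of_forall_le_iff fun t => ?_
  rw [le_ordered_iff y (by omega) (by omega), le_ordered_iff (i.removeNth y) hj hjN,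
    card_filter_le_succAbove y i]
  by_cases ht : t ≤ y i
  · rw [if_pos ht]; omega
  · have : (Finset.univ.filter fun l => t ≤ i.removeNth y l).card = 0 := by
      rw [Finset.card_eq_zero, Finset.filter_eq_empty_iff]
      exact fun l _ hl => ht (hl.trans (h l))
    rw [if_neg ht, this]; omega

/-- A removed maximal entry comes first in decreasing order, its value is forced by the total, and
the other order statistics are those of the remainder. -/
theorem orderedVector_eq_comparisonVector {N m : ℕ} (y : Fin (N + 1) → ℕ) (i : Fin (N + 1))
    (h : ∀ l, i.removeNth y l ≤ y i) (hm : ∑ l, y l = m) :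
    orderedVector y = comparisonVector (n := N + 1) m (i.removeNth y) := by
  funext l
  rw [orderedVector, comparisonVector]
  split_ifs with hl
  · rw [hl, zero_add, ordered_one_of_forall_le y i h, ← hm, Fin.sum_univ_succAbove _ i]
    push_cast
    exact (add_sub_cancel_right _ _).symm
  · rw [ordered_succ_of_forall_le y i h (by omega) (by omega)]

end Insertion

/-! ### Integrating out one coordinate -/

section OneCoordinate

variable {P : Measure ℕ} [IsProbabilityMeasure P]

/-- Fubini in coordinate i. Given the others, the sum constraint leaves at most one value, so the
inner measure is at most one atom of P; the next two lemmas turn bounds on that atom into bounds on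
the event. -/
theorem measure_pi_removeNth (N : ℕ) (i : Fin (N + 1)) (m : ℕ) (T : Set ℕ)
    (S : Set (Fin N → ℕ)) :
    (Measure.pi fun _ : Fin (N + 1) => P) {y | ∑ l, y l = m ∧ y i ∈ T ∧ i.removeNth y ∈ S} =
      ∫⁻ x in S, P {k | k + ∑ l, x l = m ∧ k ∈ T} ∂(Measure.pi fun _ : Fin N => P) := by
  have hmp := measurePreserving_piFinSuccAbove (fun _ : Fin (N + 1) => P) i
  have hset : {y : Fin (N + 1) → ℕ | ∑ l, y l = m ∧ y i ∈ T ∧ i.removeNth y ∈ S} =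
      (MeasurableEquiv.piFinSuccAbove (fun _ : Fin (N + 1) => ℕ) i) ⁻¹'
        {q : ℕ × (Fin N → ℕ) | q.1 + ∑ l, q.2 l = m ∧ q.1 ∈ T ∧ q.2 ∈ S} := by
    ext y
    simp only [Set.mem_ofPred_eq, Set.mem_preimage]
    rw [Fin.sum_univ_succAbove _ i]
    rfl
  rw [hset, hmp.measure_preimage MeasurableSet.of_discrete.nullMeasurableSet,
    Measure.prod_apply_symm MeasurableSet.of_discrete, ← lintegral_indicator
    MeasurableSet.of_discrete]
  refine lintegral_congr fun x => ?_
  by_cases hx : x ∈ S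
  · rw [Set.indicator_of_mem hx]
    congr 1
    ext k
    simp [hx]
  · rw [Set.indicator_of_notMem hx]
    have : (fun k : ℕ => (k, x)) ⁻¹' {q : ℕ × (Fin N → ℕ) |
        q.1 + ∑ l, q.2 l = m ∧ q.1 ∈ T ∧ q.2 ∈ S} = ∅ := by
      ext k
      simp [hx]
    rw [this, measure_empty]

theorem measureReal_pi_removeNth_le (N : ℕ) (i : Fin (N + 1)) (m : ℕ) (T : Set ℕ)
    (S : Set (Fin N → ℕ)) {u : ℝ} (hu : 0 ≤ u)
    (h : ∀ x ∈ S, ∀ k ∈ T, k + ∑ l, x l = m → P.real {k} ≤ u) :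
    (Measure.pi fun _ : Fin (N + 1) => P).real {y | ∑ l, y l = m ∧ y i ∈ T ∧ i.removeNth y ∈ S} ≤
      u * (Measure.pi fun _ : Fin N => P).real S := by
  rw [measureReal_def, measure_pi_removeNth]
  refine ENNReal.toReal_le_of_le_ofReal (by positivity) ?_
  rw [ENNReal.ofReal_mul hu, ofReal_measureReal, ← setLIntegral_const]
  refine setLIntegral_mono' MeasurableSet.of_discrete fun x hx => ?_
  by_cases hk : ∃ k ∈ T, k + ∑ l, x l = m
  · obtain ⟨k, hkT, hk⟩ := hk
    have hsub : {k | k + ∑ l, x l = m ∧ k ∈ T} ⊆ {k} := fun k' hk' => by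
      have := hk'.1
      simp only [Set.mem_singleton_iff]; omega
    refine (measure_mono hsub).trans ?_
    rw [← ofReal_measureReal]
    exact ENNReal.ofReal_le_ofReal (h x hx k hkT hk)
  · have : {k | k + ∑ l, x l = m ∧ k ∈ T} = ∅ := by
      ext k
      simp only [Set.mem_ofPred_eq, Set.mem_empty_iff_false, iff_false]
      exact fun hk' => hk ⟨k, hk'.2, hk'.1⟩
    rw [this, measure_empty]
    exact zero_le

theorem le_measureReal_pi_removeNth (N : ℕ) (i : Fin (N + 1)) (m : ℕ) (T : Set ℕ)
    (S : Set (Fin N → ℕ)) {u : ℝ} (hu : 0 ≤ u)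
    (h : ∀ x ∈ S, ∃ k ∈ T, k + ∑ l, x l = m ∧ u ≤ P.real {k}) :
    u * (Measure.pi fun _ : Fin N => P).real S ≤
    (Measure.pi fun _ : Fin (N + 1) => P).real
      {y | ∑ l, y l = m ∧ y i ∈ T ∧ i.removeNth y ∈ S} := by
  rw [measureReal_def (Measure.pi fun _ : Fin (N + 1) => P)]
  rw [← ENNReal.ofReal_le_iff_le_toReal (measure_ne_top _ _), measure_pi_removeNth,
    ENNReal.ofReal_mul hu, ofReal_measureReal, ← setLIntegral_const]
  refine setLIntegral_mono' MeasurableSet.of_discrete fun x hx => ?_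
  obtain ⟨k, hkT, hk, hle⟩ := h x hx
  refine (ENNReal.ofReal_le_ofReal hle).trans ?_
  rw [ofReal_measureReal]
  refine measure_mono ?_
  rintro _ rfl
  exact ⟨hk, hkT⟩

end OneCoordinate

/-! ### One big jump: upper and lower bounds -/

section OneBigJump

variable {P : Measure ℕ}

/-- The configurations of the small boxes with typical sum and no large entry. -/
def typicalSet (ν δ : ℝ) (n : ℕ) : Set (Fin (n - 1) → ℕ) :=
  {x | |∑ i, (x i : ℝ) - ν * n| < δ * n ∧ ∀ i, (x i : ℝ) < δ * n}

theorem tendsto_measureReal_typicalSet [IsProbabilityMeasure P] {γ : ℝ}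
    (hγ : 1 < γ) (hint1 : Integrable (fun k : ℕ => (k : ℝ)) P)
    (hint : Integrable (fun k : ℕ => (k : ℝ) ^ γ) P) {δ : ℝ} (hδ : 0 < δ) :
    Tendsto (fun n : ℕ => (Measure.pi fun _ : Fin (n - 1) => P).real
      (typicalSet (∫ k : ℕ, (k : ℝ) ∂P) δ n)) atTop (𝓝 1) := by
  have h1 := (tendsto_measureReal_sum_deviation hint1 hδ).add
    (tendsto_measureReal_exists_le hγ hint hδ)
  rw [add_zero] at h1
  have h2 := h1.const_sub 1
  rw [sub_zero] at h2
  refine tendsto_of_tendsto_of_tendsto_of_le_of_le h2 tendsto_const_nhds (fun n => ?_)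
    (fun n => measureReal_le_one)
  have hc := probReal_compl_eq_one_sub (μ := Measure.pi fun _ : Fin (n - 1) => P)
    (MeasurableSet.of_discrete (s := typicalSet (∫ k : ℕ, (k : ℝ) ∂P) δ n))
  have hle : (Measure.pi fun _ : Fin (n - 1) => P).real
      (typicalSet (∫ k : ℕ, (k : ℝ) ∂P) δ n)ᶜ ≤ _ :=
    (measureReal_mono (fun x hx => ?_)).trans (measureReal_union_le
      {x : Fin (n - 1) → ℕ | δ * n ≤ |∑ i, (x i : ℝ) - (∫ k : ℕ, (k : ℝ) ∂P) * n|}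
      {x : Fin (n - 1) → ℕ | ∃ i, δ * n ≤ (x i : ℝ)})
  · simp only
    linarith
  · by_contra hx'
    simp only [Set.mem_union, Set.mem_ofPred_eq, not_or, not_le, not_exists] at hx'
    exact hx hx'

/-- When the small boxes hold about νn balls, the big box must hold k ≈ (λ - ν)n. Then P{k} / n^(-β)
= (P{k} / k^(-β)) (k/n)^(-β) is close to its limit by continuity. -/
theorem exists_local_bounds {c β : ℝ} (hc : 0 < c)
    (h : (fun k => P.real {k}) ~[atTop] fun k : ℕ => c * (k : ℝ) ^ (-β))
    {ν lam : ℝ} {m : ℕ → ℕ} (hm : Tendsto (fun n : ℕ => (m n : ℝ) / n) atTop (𝓝 lam))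
    (hlam : ν < lam) {η : ℝ} (hη : 0 < η) :
    ∃ δ : ℝ, 0 < δ ∧ ∀ᶠ n : ℕ in atTop, ∀ S : ℕ, |(S : ℝ) - ν * n| < δ * n →
      ∃ k : ℕ, k + S = m n ∧ δ * n < k ∧
        (1 - η) * (c * (lam - ν) ^ (-β)) * (n : ℝ) ^ (-β) ≤ P.real {k} ∧
        P.real {k} ≤ (1 + η) * (c * (lam - ν) ^ (-β)) * (n : ℝ) ^ (-β) := by
  set a := lam - ν with ha
  have ha0 : 0 < a := sub_pos.2 hlam
  set L := c * a ^ (-β) with hL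
  have hL0 : 0 < L := mul_pos hc (Real.rpow_pos_of_pos ha0 _)
  have hpc : Tendsto (fun k : ℕ => P.real {k} / (k : ℝ) ^ (-β)) atTop (𝓝 c) := by
    have h1 : (fun k : ℕ => P.real {k} / (k : ℝ) ^ (-β)) ~[atTop]
      fun k : ℕ => c * (k : ℝ) ^ (-β) / (k : ℝ) ^ (-β) := h.div IsEquivalent.refl
    refine h1.symm.tendsto_nhds (tendsto_const_nhds.congr' ?_)
    filter_upwards [eventually_gt_atTop 0] with k hk
    have : (k : ℝ) ^ (-β) ≠ 0 := (Real.rpow_pos_of_pos (by exact_mod_cast hk) _).ne'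
    field_simp
  have hcont : ContinuousAt (fun q : ℝ × ℝ => q.1 * q.2 ^ (-β)) (c, a) :=
    continuousAt_fst.mul (continuousAt_snd.rpow_const (Or.inl ha0.ne'))
  obtain ⟨r, hr, hball⟩ := Metric.continuousAt_iff.1 hcont (η * L) (by positivity)
  -- Both m/n and S/n are off by less than δ, so k/n is within 2δ of a: r/3 keeps it in the
  -- continuity ball, and a/8 ensures k > an/2 > δn.
  set δ := min (r / 3) (a / 8) with hδ
  have hδ0 : 0 < δ := by positivity
  have hδr : δ ≤ r / 3 := min_le_left _ _
  have hδa : δ ≤ a / 8 := min_le_right _ _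
  refine ⟨δ, hδ0, ?_⟩
  obtain ⟨k₀, hk₀⟩ := eventually_atTop.1 (Metric.tendsto_nhds.1 hpc r hr)
  have hbig : ∀ᶠ n : ℕ in atTop, (k₀ : ℝ) + 1 < a / 2 * n :=
    (tendsto_natCast_atTop_atTop.const_mul_atTop (by positivity)).eventually_gt_atTop _
  filter_upwards [hbig, Metric.tendsto_nhds.1 hm δ hδ0, eventually_gt_atTop 0]
    with n hn1 hn2 hn3 S hS
  have hn0 : (0 : ℝ) < n := by exact_mod_cast hn3
  rw [Real.dist_eq, div_sub' hn0.ne', abs_div, abs_of_pos hn0, div_lt_iff₀ hn0] at hn2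
  rw [abs_lt] at hn2 hS
  have hkr1 : (a - 2 * δ) * n < (m n : ℝ) - S := by rw [ha]; nlinarith
  have hkr2 : (m n : ℝ) - S < (a + 2 * δ) * n := by rw [ha]; nlinarith
  have hSm : S ≤ m n := by
    have : (0 : ℝ) < (a - 2 * δ) * n := mul_pos (by linarith) hn0
    have h2 : (S : ℝ) < m n := by linarith
    exact_mod_cast h2.le
  obtain ⟨k, hk⟩ : ∃ k, k + S = m n := ⟨m n - S, by omega⟩
  have hkR : (k : ℝ) = (m n : ℝ) - S := by rw [← hk]; push_cast; ring
  rw [← hkR] at hkr1 hkr2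
  have hk1 : a / 2 * n < k := by nlinarith
  have hkk₀ : k₀ ≤ k := by
    have : (k₀ : ℝ) < k := by linarith
    exact_mod_cast this.le
  have hkpos : (0 : ℝ) < k := by nlinarith
  refine ⟨k, hk, by nlinarith, ?_⟩
  have hd1 := hk₀ k hkk₀
  have hd2 : dist ((k : ℝ) / n) a < r := by
    rw [Real.dist_eq, div_sub' hn0.ne', abs_div, abs_of_pos hn0, div_lt_iff₀ hn0, abs_lt]
    constructor <;> nlinarith
  have hd := hball (x := (P.real {k} / (k : ℝ) ^ (-β), (k : ℝ) / n)) (by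
    rw [Prod.dist_eq, max_lt_iff]; exact ⟨hd1, hd2⟩)
  have heq : P.real {k} / (k : ℝ) ^ (-β) * ((k : ℝ) / n) ^ (-β) = P.real {k} / (n : ℝ) ^ (-β) := by
    rw [Real.div_rpow hkpos.le hn0.le]
    have : (k : ℝ) ^ (-β) ≠ 0 := (Real.rpow_pos_of_pos hkpos _).ne'
    field_simp
  simp only [heq] at hd
  rw [← hL, Real.dist_eq, abs_lt] at hd
  have hnb : 0 < (n : ℝ) ^ (-β) := Real.rpow_pos_of_pos hn0 _
  constructor
  · rw [← le_div_iff₀ hnb]; linarith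
  · rw [← div_le_iff₀ hnb]; linarith

/-- Without an entry above δ'n, the Chernoff bound is o(n^(1-β)). Otherwise a union over the n
positions of such an entry contributes the main term, plus a term where the other entries have
atypical sum. -/
theorem eventually_measureReal_sum_le [IsProbabilityMeasure P] {c β γ : ℝ} (hc : 0 < c) (hβ : 2 < β)
    (h : (fun k => P.real {k}) ~[atTop] fun k : ℕ => c * (k : ℝ) ^ (-β))
    (h1 : 1 < γ) (h2 : γ ≤ 2) (hint1 : Integrable (fun k : ℕ => (k : ℝ)) P)
    (hint : Integrable (fun k : ℕ => (k : ℝ) ^ γ) P)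
    {lam : ℝ} {m : ℕ → ℕ} (hm : Tendsto (fun n : ℕ => (m n : ℝ) / n) atTop (𝓝 lam))
    (hlam : ∫ k : ℕ, (k : ℝ) ∂P < lam) {η : ℝ} (hη : 0 < η) :
    ∀ᶠ n : ℕ in atTop, (n : ℝ) ^ (β - 1) *
      (Measure.pi fun _ : Fin n => P).real {y | ∑ l, y l = m n} ≤
        (1 + η) * (c * (lam - ∫ k : ℕ, (k : ℝ) ∂P) ^ (-β)) := by
  set ν := ∫ k : ℕ, (k : ℝ) ∂P with hν
  set L := c * (lam - ν) ^ (-β) with hL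
  have hL0 : 0 < L := mul_pos hc (Real.rpow_pos_of_pos (sub_pos.2 hlam) _)
  obtain ⟨C, hC, hCk⟩ := exists_le_rpow (fun k => measureReal_nonneg) h
  obtain ⟨δ', hδ', hsmall⟩ := exists_tendsto_small_jumps h1 h2 hint1 hint hm hlam
    (show 0 < β - 1 by linarith)
  obtain ⟨δ, hδ, hloc⟩ := exists_local_bounds hc h hm hlam (half_pos hη)
  have hdev := (tendsto_measureReal_sum_deviation hint1 hδ).const_mul (C * δ' ^ (-β))
  rw [← hν, mul_zero] at hdev
  have hrest := hsmall.add hdev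
  rw [add_zero] at hrest
  filter_upwards [hloc, hrest.eventually (Iio_mem_nhds (show 0 < η / 2 * L by positivity)),
    eventually_ge_atTop 1] with n hn1 hn2 hn3
  obtain ⟨N, rfl⟩ : ∃ N, n = N + 1 := ⟨n - 1, by omega⟩
  set n := N + 1 with hn
  have hn0 : (0 : ℝ) < n := by positivity
  set Q := Measure.pi fun _ : Fin n => P with hQ
  set S1 : Set (Fin N → ℕ) := {x | δ * n ≤ |∑ i, (x i : ℝ) - ν * n|} with hS1
  set U := (1 + η / 2) * L * (n : ℝ) ^ (-β) with hU
  set V := C * (δ' * n) ^ (-β) with hV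
  have hU0 : 0 ≤ U := by positivity
  have hV0 : 0 ≤ V := by positivity
  set q := (Measure.pi fun _ : Fin N => P).real S1 with hq
  -- U is the sharp atom bound, available when the remainder has typical sum. On atypical remainders
  -- only the crude bound V holds, but their probability q tends to 0.
  have hpiece : ∀ i : Fin n, Q.real {y | ∑ l, y l = m n ∧ δ' * n < y i} ≤ U + V * q := by
    intro i
    have hsub : {y : Fin n → ℕ | ∑ l, y l = m n ∧ δ' * n < y i} ⊆
        {y | ∑ l, y l = m n ∧ y i ∈ Set.univ ∧ i.removeNth y ∈ S1ᶜ} ∪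
        {y | ∑ l, y l = m n ∧ y i ∈ {k : ℕ | δ' * n < k} ∧ i.removeNth y ∈ S1} := by
      rintro y ⟨hy1, hy2⟩
      by_cases hy : i.removeNth y ∈ S1
      · exact Or.inr ⟨hy1, hy2, hy⟩
      · exact Or.inl ⟨hy1, trivial, hy⟩
    refine (measureReal_mono hsub).trans ((measureReal_union_le _ _).trans (add_le_add ?_ ?_))
    · refine (measureReal_pi_removeNth_le N i (m n) _ _ hU0 ?_).trans
        (mul_le_of_le_one_right hU0 measureReal_le_one)
      intro x hx k _ hk
      have hx' : |((∑ l, x l : ℕ) : ℝ) - ν * n| < δ * n := by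
        push_cast; exact not_le.1 hx
      obtain ⟨k', hk', -, -, hle⟩ := hn1 _ hx'
      have : k = k' := by omega
      rw [this]; exact hle
    · refine measureReal_pi_removeNth_le N i (m n) _ _ hV0 ?_
      intro x _ k hk _
      have hk' : δ' * n < k := hk
      have hk1 : 1 ≤ k := by
        have : (0 : ℝ) < k := lt_trans (by positivity) hk'
        exact_mod_cast this
      refine (hCk k hk1).trans (mul_le_mul_of_nonneg_left ?_ hC.le)
      exact Real.rpow_le_rpow_of_nonpos (by positivity) hk'.le (by linarith)
  set R := Q.real {y | (∀ i, (y i : ℝ) ≤ δ' * n) ∧ ∑ i, y i = m n} with hR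
  have htot : Q.real {y | ∑ l, y l = m n} ≤ R + n * (U + V * q) := by
    have hsub : {y : Fin n → ℕ | ∑ l, y l = m n} ⊆
        {y | (∀ i, (y i : ℝ) ≤ δ' * n) ∧ ∑ i, y i = m n} ∪
        ⋃ i ∈ (Finset.univ : Finset (Fin n)), {y | ∑ l, y l = m n ∧ δ' * n < y i} := by
      intro y hy
      by_cases hall : ∀ i, (y i : ℝ) ≤ δ' * n
      · exact Or.inl ⟨hall, hy⟩
      · push Not at hall
        obtain ⟨i, hi⟩ := hall
        refine Or.inr ?_
        simp only [Set.mem_iUnion]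
        exact ⟨i, Finset.mem_univ i, hy, hi⟩
    refine (measureReal_mono hsub).trans ((measureReal_union_le _ _).trans ?_)
    gcongr
    refine (measureReal_biUnion_finset_le _ _).trans ((Finset.sum_le_sum fun i _ =>
      hpiece i).trans ?_)
    rw [Finset.sum_const, Finset.card_univ, Fintype.card_fin, nsmul_eq_mul]
  have hpow : (n : ℝ) ^ (β - 1) * n * (n : ℝ) ^ (-β) = 1 := by
    rw [mul_assoc, mul_comm (n : ℝ) ((n : ℝ) ^ (-β))]
    nth_rewrite 3 [← Real.rpow_one (n : ℝ)]
    rw [← Real.rpow_add hn0, ← Real.rpow_add hn0]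
    simp
  have hn2' : (n : ℝ) ^ (β - 1) * R + C * δ' ^ (-β) * q < η / 2 * L := hn2
  calc (n : ℝ) ^ (β - 1) * Q.real {y | ∑ l, y l = m n}
      ≤ (n : ℝ) ^ (β - 1) * (R + n * (U + V * q)) := by gcongr
    _ = ((n : ℝ) ^ (β - 1) * R + C * δ' ^ (-β) * q * ((n : ℝ) ^ (β - 1) * n * (n : ℝ) ^ (-β)))
          + (1 + η / 2) * L * ((n : ℝ) ^ (β - 1) * n * (n : ℝ) ^ (-β)) := by
        rw [hU, hV, Real.mul_rpow hδ'.le hn0.le]; ring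
    _ ≤ (1 + η) * L := by rw [hpow]; linarith

/-- Each position of the big entry contributes one atom times the measure of good remainders, and
the n contributions are disjoint. A threshold in n that serves every B is what later yields
domination of measures. -/
theorem exists_le_measureReal_orderedVector [IsProbabilityMeasure P] {c β : ℝ} (hc : 0 < c)
    (h : (fun k => P.real {k}) ~[atTop] fun k : ℕ => c * (k : ℝ) ^ (-β))
    {ν lam : ℝ} {m : ℕ → ℕ} (hm : Tendsto (fun n : ℕ => (m n : ℝ) / n) atTop (𝓝 lam))
    (hlam : ν < lam) {η : ℝ} (hη : 0 < η) (hη1 : η < 1) :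
    ∃ δ : ℝ, 0 < δ ∧ ∀ᶠ n : ℕ in atTop, ∀ B : Set (Fin n → ℤ),
      n * ((1 - η) * (c * (lam - ν) ^ (-β)) * (n : ℝ) ^ (-β)) *
        (Measure.pi fun _ : Fin (n - 1) => P).real
          (typicalSet ν δ n ∩ comparisonVector (m n) ⁻¹' B) ≤
      (Measure.pi fun _ : Fin n => P).real {y | ∑ l, y l = m n ∧ orderedVector y ∈ B} := by
  obtain ⟨δ, hδ, hloc⟩ := exists_local_bounds hc h hm hlam hη
  refine ⟨δ, hδ, ?_⟩
  filter_upwards [hloc, eventually_ge_atTop 1] with n hn1 hn3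
  obtain ⟨N, rfl⟩ : ∃ N, n = N + 1 := ⟨n - 1, by omega⟩
  set n := N + 1 with hn
  intro B
  set S : Set (Fin N → ℕ) := typicalSet ν δ n ∩ comparisonVector (n := n) (m n) ⁻¹' B with hS
  set u := (1 - η) * (c * (lam - ν) ^ (-β)) * (n : ℝ) ^ (-β) with hu
  have hu0 : 0 ≤ u := by
    have : 0 ≤ (lam - ν) ^ (-β) := Real.rpow_nonneg (by linarith) _
    have : 0 ≤ 1 - η := by linarith
    positivity
  let E : Fin n → Set (Fin n → ℕ) := fun i =>
    {y | ∑ l, y l = m n ∧ y i ∈ {k : ℕ | δ * n < k} ∧ i.removeNth y ∈ S}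
  have hE : ∀ i, u * (Measure.pi fun _ : Fin N => P).real S ≤
      (Measure.pi fun _ : Fin n => P).real (E i) := by
    intro i
    refine le_measureReal_pi_removeNth N i (m n) _ S hu0 fun x hx => ?_
    have hx' : |((∑ l, x l : ℕ) : ℝ) - ν * n| < δ * n := by
      push_cast; exact hx.1.1
    obtain ⟨k, hk, hkδ, hle, -⟩ := hn1 _ hx'
    exact ⟨k, hkδ, hk, hle⟩
  -- An entry above δn in one event belongs to the typical remainder of any other, where entries
  -- stay below δn.
  have hdisj : ∀ i j, i ≠ j → Disjoint (E i) (E j) := by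
    intro i j hij
    refine Set.disjoint_left.2 fun y hi hj => ?_
    obtain ⟨l, rfl⟩ := Fin.exists_succAbove_eq hij.symm
    have h1 : ((i.removeNth y l : ℕ) : ℝ) < δ * n := hi.2.2.1.2 l
    have h2 : δ * n < (y (i.succAbove l) : ℝ) := hj.2.1
    exact lt_irrefl _ (h1.trans h2)
  have hsub : (⋃ i ∈ (Finset.univ : Finset (Fin n)), E i) ⊆
      {y | ∑ l, y l = m n ∧ orderedVector y ∈ B} := by
    intro y hy
    simp only [Set.mem_iUnion] at hy
    obtain ⟨i, -, hy1, hy2, hy3⟩ := hy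
    refine ⟨hy1, ?_⟩
    rw [orderedVector_eq_comparisonVector y i (fun l => ?_) hy1]
    · exact hy3.2
    · have h1 : ((i.removeNth y l : ℕ) : ℝ) < δ * n := hy3.1.2 l
      have h2 : δ * n < (y i : ℝ) := hy2
      exact_mod_cast (h1.trans h2).le
  refine le_trans ?_ (measureReal_mono hsub)
  rw [measureReal_biUnion_finset (fun i _ j _ hij => hdisj i j hij)
    (fun i _ => MeasurableSet.of_discrete)]
  refine le_trans (le_of_eq ?_) (Finset.sum_le_sum fun i _ => hE i)
  rw [Finset.sum_const, Finset.card_univ, Fintype.card_fin, nsmul_eq_mul]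
  exact mul_assoc _ _ _

end OneBigJump

/-! ### Maximal couplings -/

section Coupling

/-- The common part is placed on the diagonal. The two leftovers have the same mass r, and their
product divided by r restores the marginals. -/
theorem exists_coupling_inf {E : Type*} [MeasurableSpace E] [Countable E]
    [MeasurableSingletonClass E] (μ ν : Measure E) [IsProbabilityMeasure μ]
    [IsProbabilityMeasure ν] :
    ∃ γ : Measure (E × E), γ.map Prod.fst = μ ∧ γ.map Prod.snd = ν ∧
      (μ ⊓ ν) Set.univ ≤ γ {p | p.1 = p.2} := by
  set κ := μ ⊓ ν with hκ
  have hκμ : κ ≤ μ := inf_le_left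
  have hκν : κ ≤ ν := inf_le_right
  have : IsFiniteMeasure κ := ⟨(hκμ Set.univ).trans_lt (measure_lt_top μ _)⟩
  set r := 1 - κ Set.univ with hr
  have hμr : (μ - κ) Set.univ = r := by
    rw [Measure.sub_apply MeasurableSet.univ hκμ, measure_univ]
  have hνr : (ν - κ) Set.univ = r := by
    rw [Measure.sub_apply MeasurableSet.univ hκν, measure_univ]
  have hrtop : r ≠ ⊤ := ENNReal.sub_ne_top ENNReal.one_ne_top
  have : IsFiniteMeasure (μ - κ) := ⟨by rw [hμr]; exact hrtop.lt_top⟩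
  have : IsFiniteMeasure (ν - κ) := ⟨by rw [hνr]; exact hrtop.lt_top⟩
  -- If r = 0 the leftover is the zero measure, so the infinite value of r⁻¹ does no harm.
  have hsmul : ∀ ρ : Measure E, ρ Set.univ = r → r⁻¹ • r • ρ = ρ := by
    intro ρ hρ
    rcases eq_or_ne r 0 with h0 | h0
    · have : ρ = 0 := by rwa [← Measure.measure_univ_eq_zero, hρ]
      simp [this]
    · rw [smul_smul, ENNReal.inv_mul_cancel h0 hrtop, one_smul]
  refine ⟨κ.map (fun x => (x, x)) + r⁻¹ • (μ - κ).prod (ν - κ), ?_, ?_, ?_⟩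
  · rw [Measure.map_add _ _ measurable_fst, Measure.map_map measurable_fst (by fun_prop),
      Measure.map_smul, Measure.map_fst_prod, hνr, hsmul _ hμr]
    rw [show (Prod.fst ∘ fun x : E => (x, x)) = id from rfl, Measure.map_id, add_comm,
      Measure.sub_add_cancel_of_le hκμ]
  · rw [Measure.map_add _ _ measurable_snd, Measure.map_map measurable_snd (by fun_prop),
      Measure.map_smul, Measure.map_snd_prod, hμr, hsmul _ hνr]
    rw [show (Prod.snd ∘ fun x : E => (x, x)) = id from rfl, Measure.map_id, add_comm,
      Measure.sub_add_cancel_of_le hκν]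
  · rw [Measure.add_apply, Measure.map_apply (by fun_prop) MeasurableSet.of_discrete]
    refine le_trans (le_of_eq ?_) le_self_add
    congr 1
    ext x
    simp

variable {E : ℕ → Type*} [∀ n, MeasurableSpace (E n)] [∀ n, Countable (E n)]
  [∀ n, MeasurableSingletonClass (E n)]

/-- The common part κ may depend on ε: the infimum dominates all of them, so one coupling serves
every ε. -/
theorem approxEqualLaws_of_forall_common_part (μ ν : ∀ n, Measure (E n))
    [∀ n, IsProbabilityMeasure (μ n)] [∀ n, IsProbabilityMeasure (ν n)]
    (h : ∀ ε : ℝ, 0 < ε → ∀ᶠ n in atTop, ∃ κ : Measure (E n), κ ≤ μ n ∧ κ ≤ ν n ∧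
      ENNReal.ofReal (1 - ε) ≤ κ Set.univ) :
    ApproxEqualLaws μ ν := by
  choose γ h1 h2 h3 using fun n => exists_coupling_inf (μ n) (ν n)
  refine ⟨γ, fun n => ⟨h1 n, h2 n⟩, ?_⟩
  have hle : ∀ n, γ n {p | p.1 = p.2} ≤ 1 := by
    intro n
    refine (measure_mono (Set.subset_univ _)).trans (le_of_eq ?_)
    rw [← Set.preimage_univ (f := Prod.fst), ← Measure.map_apply measurable_fst MeasurableSet.univ,
      h1, measure_univ]
  refine tendsto_order.2 ⟨fun a ha => ?_, fun a ha => Eventually.of_forall fun n =>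
    (hle n).trans_lt ha⟩
  have haT : a ≠ ⊤ := ha.ne_top
  have ha1 : a.toReal < 1 := by
    rw [← ENNReal.toReal_one]; exact ENNReal.toReal_strict_mono ENNReal.one_ne_top ha
  filter_upwards [h ((1 - a.toReal) / 2) (by linarith)] with n ⟨κ, hκ1, hκ2, hκ3⟩
  refine lt_of_lt_of_le ?_ (hκ3.trans ((le_inf hκ1 hκ2 Set.univ).trans (h3 n)))
  rw [ENNReal.lt_ofReal_iff_toReal_lt haT]
  linarith

/-- The error is the off-diagonal mass of the coupling, hence uniform over all sets. -/
theorem ApproxEqualLaws.exists_error {μ ν : ∀ n, Measure (E n)}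
    [∀ n, IsProbabilityMeasure (μ n)] (h : ApproxEqualLaws μ ν) :
    ∃ e : ℕ → ℝ≥0∞, Tendsto e atTop (𝓝 0) ∧
      ∀ n (S : Set (E n)), μ n S ≤ ν n S + e n ∧ ν n S ≤ μ n S + e n := by
  obtain ⟨γ, hγ, hlim⟩ := h
  have huniv : ∀ n, γ n Set.univ = 1 := by
    intro n
    rw [← Set.preimage_univ (f := Prod.fst), ← Measure.map_apply measurable_fst MeasurableSet.univ,
      (hγ n).1, measure_univ]
  have : ∀ n, IsProbabilityMeasure (γ n) := fun n => ⟨huniv n⟩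
  refine ⟨fun n => γ n {p | p.1 = p.2}ᶜ, ?_, fun n S => ?_⟩
  · have h1 := ENNReal.Tendsto.sub (tendsto_const_nhds (x := (1 : ℝ≥0∞)) (f := atTop (α := ℕ))) hlim
      (Or.inl ENNReal.one_ne_top)
    rw [tsub_self] at h1
    refine h1.congr fun n => ?_
    rw [prob_compl_eq_one_sub MeasurableSet.of_discrete]
  · have e1 : μ n S = γ n (Prod.fst ⁻¹' S) := by
      rw [← (hγ n).1, Measure.map_apply measurable_fst MeasurableSet.of_discrete]
    have e2 : ν n S = γ n (Prod.snd ⁻¹' S) := by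
      rw [← (hγ n).2, Measure.map_apply measurable_snd MeasurableSet.of_discrete]
    rw [e1, e2]
    constructor
    · refine (measure_mono fun p hp => ?_).trans (measure_union_le _ _)
      by_cases hpe : p.1 = p.2
      · exact Or.inl (show p.2 ∈ S from hpe ▸ hp)
      · exact Or.inr hpe
    · refine (measure_mono fun p hp => ?_).trans (measure_union_le _ _)
      by_cases hpe : p.1 = p.2
      · exact Or.inl (show p.1 ∈ S from hpe ▸ hp)
      · exact Or.inr hpe

end Coupling

/-! ### Transfer of limits in distribution -/

section Transfer

/-- By the portmanteau theorem, lower bounds on open sets already characterize weak convergence, so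
a one-sided comparison suffices. -/
theorem tendsto_probabilityMeasure_of_le_add {Ω : Type*} [MeasurableSpace Ω]
    [PseudoEMetricSpace Ω] [OpensMeasurableSpace Ω]
    {μs νs : ℕ → ProbabilityMeasure Ω} {μ : ProbabilityMeasure Ω} {e : ℕ → ℝ≥0∞}
    (he : Tendsto e atTop (𝓝 0))
    (hle : ∀ᶠ n in atTop, ∀ G : Set Ω, IsOpen G →
      (νs n : Measure Ω) G ≤ (μs n : Measure Ω) G + e n)
    (h : Tendsto νs atTop (𝓝 μ)) : Tendsto μs atTop (𝓝 μ) := by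
  refine tendsto_of_forall_isOpen_le_liminf' fun G hG => ?_
  refine (ProbabilityMeasure.le_liminf_measure_open_of_tendsto h hG).trans ?_
  refine ENNReal.le_of_forall_pos_le_add fun ε hε _ => ?_
  have hε' : (0 : ℝ≥0∞) < ε := by exact_mod_cast hε
  have h1 : liminf (fun n => (νs n : Measure Ω) G) atTop ≤
      liminf (fun n => (μs n : Measure Ω) G + ε) atTop := by
    refine liminf_le_liminf ?_
    filter_upwards [hle, he.eventually (Iic_mem_nhds hε')] with n hn hn2
    exact (hn G hG).trans (add_le_add le_rfl hn2)
  refine h1.trans (le_of_eq ?_)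
  exact liminf_add_const _ _ _ isCobounded_ge_of_top (isBounded_ge_of_bot)

theorem tendstoInDistribution_of_le_add {E : ℕ → Type*} [∀ n, MeasurableSpace (E n)]
    {A : ∀ n, Measure (E n)} [∀ n, IsProbabilityMeasure (A n)] {X : ∀ n, E n → ℝ}
    (hX : ∀ n, Measurable (X n)) {νs : ℕ → ProbabilityMeasure ℝ} {W : ProbabilityMeasure ℝ}
    {e : ℕ → ℝ≥0∞} (he : Tendsto e atTop (𝓝 0))
    (hle : ∀ᶠ n in atTop, ∀ G : Set ℝ, IsOpen G → (νs n : Measure ℝ) G ≤ A n (X n ⁻¹' G) + e n)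
    (h : Tendsto νs atTop (𝓝 W)) :
    TendstoInDistribution X atTop (fun x : ℝ => x) A (W : Measure ℝ) := by
  refine ⟨fun n => (hX n).aemeasurable, by fun_prop, ?_⟩
  have hW : (⟨(W : Measure ℝ).map (fun x : ℝ => x),
      Measure.isProbabilityMeasure_map (by fun_prop)⟩ : ProbabilityMeasure ℝ) = W := by
    apply Subtype.ext
    exact Measure.map_id
  rw [hW]
  refine tendsto_probabilityMeasure_of_le_add he ?_ h
  filter_upwards [hle] with n hn G hG
  refine (hn G hG).trans (le_of_eq ?_)
  congr 1
  exact (Measure.map_apply (hX n) hG.measurableSet).symm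

/-- Choose K so that the limit law gives mass below ε to the closed set |x| ≥ K; the portmanteau
bound for closed sets carries this to large n. -/
theorem isBigOp_of_tendstoInDistribution {E : ℕ → Type*} [∀ n, MeasurableSpace (E n)]
    {A : ∀ n, Measure (E n)} [∀ n, IsProbabilityMeasure (A n)] {X Y : ∀ n, E n → ℝ} {a : ℕ → ℝ}
    (hX : ∀ n, Measurable (X n)) {W : ProbabilityMeasure ℝ}
    (h : TendstoInDistribution X atTop (fun x : ℝ => x) A (W : Measure ℝ))
    (hXY : ∀ᶠ n in atTop, ∀ y, |Y n y / a n| = |X n y|) : IsBigOp A Y a := by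
  intro ε hε
  have hanti : Antitone fun K : ℕ => {x : ℝ | (K : ℝ) ≤ |x|} := by
    intro K K' hK x hx
    have : (K : ℝ) ≤ K' := by exact_mod_cast hK
    exact this.trans hx
  have hlim := tendsto_measure_iInter_atTop (μ := (W : Measure ℝ))
    (s := fun K : ℕ => {x : ℝ | (K : ℝ) ≤ |x|})
    (fun K => (measurableSet_le measurable_const (by fun_prop)).nullMeasurableSet) hanti
    ⟨0, measure_ne_top _ _⟩
  have hempty : ⋂ K : ℕ, {x : ℝ | (K : ℝ) ≤ |x|} = ∅ := by
    ext x
    simp only [Set.mem_iInter, Set.mem_ofPred_eq, Set.mem_empty_iff_false, iff_false, not_forall,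
      not_le]
    exact exists_nat_gt |x|
  rw [hempty, measure_empty] at hlim
  obtain ⟨K, hK⟩ := (hlim.eventually (Iio_mem_nhds hε)).exists
  refine ⟨K, ?_⟩
  have hcl : IsClosed {x : ℝ | (K : ℝ) ≤ |x|} := isClosed_le continuous_const continuous_abs
  have hls := ProbabilityMeasure.limsup_measure_closed_le_of_tendsto h.tendsto hcl
  have hmapW : ((W : Measure ℝ).map fun x : ℝ => x) = W := Measure.map_id
  simp only [ProbabilityMeasure.coe_mk, hmapW] at hls
  have hev := eventually_lt_of_limsup_lt (hls.trans_lt hK)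
  filter_upwards [hev, hXY] with n hn hn2
  rw [Measure.map_apply (hX n) hcl.measurableSet] at hn
  refine (measure_mono fun y hy => ?_).trans hn.le
  have hy' : (K : ℝ) < |Y n y / a n| := hy
  rw [hn2 y] at hy'
  exact hy'.le

end Transfer

/-! ### Local limit and coupling for the conditioned law -/

section ConditionedLaw

variable {P : Measure ℕ} [IsProbabilityMeasure P]

/-- The exponent must be below β - 1 for the moment to exist, at most 2 for the exponential
inequality, and above 1 to beat the n entries in union bounds. -/
theorem exists_rpow_integrable {c β : ℝ} (hβ : 2 < β)
    (h : (fun k => P.real {k}) ~[atTop] fun k : ℕ => c * (k : ℝ) ^ (-β)) :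
    ∃ γ : ℝ, 1 < γ ∧ γ ≤ 2 ∧ Integrable (fun k : ℕ => (k : ℝ)) P ∧
      Integrable (fun k : ℕ => (k : ℝ) ^ γ) P := by
  have h1 : 1 < min (β - 1) 2 := lt_min (by linarith) (by norm_num)
  have h2 : min (β - 1) 2 ≤ β - 1 := min_le_left _ _
  have h3 : min (β - 1) 2 ≤ 2 := min_le_right _ _
  refine ⟨(1 + min (β - 1) 2) / 2, by linarith, by linarith, ?_, integrable_rpow h (by linarith)⟩
  have := integrable_rpow (γ := 1) h (by linarith)
  simpa using this

theorem tendsto_measureReal_sum_eq {c β : ℝ} (hc : 0 < c) (hβ : 2 < β)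
    (h : (fun k => P.real {k}) ~[atTop] fun k : ℕ => c * (k : ℝ) ^ (-β))
    {lam : ℝ} {m : ℕ → ℕ} (hm : Tendsto (fun n : ℕ => (m n : ℝ) / n) atTop (𝓝 lam))
    (hlam : ∫ k : ℕ, (k : ℝ) ∂P < lam) :
    Tendsto (fun n : ℕ => (n : ℝ) ^ (β - 1) *
      (Measure.pi fun _ : Fin n => P).real {y | ∑ l, y l = m n}) atTop
      (𝓝 (c * (lam - ∫ k : ℕ, (k : ℝ) ∂P) ^ (-β))) := by
  obtain ⟨γ, h1, h2, hint1, hint⟩ := exists_rpow_integrable hβ h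
  set ν := ∫ k : ℕ, (k : ℝ) ∂P with hν
  set L := c * (lam - ν) ^ (-β) with hL
  have hL0 : 0 < L := mul_pos hc (Real.rpow_pos_of_pos (sub_pos.2 hlam) _)
  refine tendsto_order.2 ⟨fun a ha => ?_, fun a ha => ?_⟩
  · set η := min ((L - a) / (2 * L)) (1 / 2) with hη
    have hη0 : 0 < η := lt_min (div_pos (by linarith) (by linarith)) (by norm_num)
    have hη1 : η < 1 := (min_le_right _ _).trans_lt (by norm_num)
    have hηL : η * (2 * L) ≤ L - a := by
      rw [← le_div_iff₀ (by linarith)]; exact min_le_left _ _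
    obtain ⟨δ, hδ, hlow⟩ := exists_le_measureReal_orderedVector hc h hm hlam hη0 hη1
    have hA := (tendsto_measureReal_typicalSet h1 hint1 hint hδ).const_mul ((1 - η) * L)
    rw [mul_one] at hA
    have hlt : a < (1 - η) * L := by nlinarith
    filter_upwards [hlow, hA.eventually (Ioi_mem_nhds hlt), eventually_gt_atTop 0]
      with n hn1 hn2 hn3
    have hn0 : (0 : ℝ) < n := by exact_mod_cast hn3
    have h3 := hn1 Set.univ
    simp only [Set.preimage_univ, Set.inter_univ, Set.mem_univ, and_true] at h3
    have hpow : (n : ℝ) ^ (β - 1) * n * (n : ℝ) ^ (-β) = 1 := by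
      rw [Real.rpow_sub hn0, Real.rpow_neg hn0.le, Real.rpow_one]
      have := (Real.rpow_pos_of_pos hn0 β).ne'
      field_simp
    refine lt_of_lt_of_le hn2 ?_
    refine le_trans (le_of_eq ?_) (mul_le_mul_of_nonneg_left h3 (Real.rpow_nonneg hn0.le (β - 1)))
    rw [← hν]
    linear_combination (-(1 - η) * L * (Measure.pi fun _ : Fin (n - 1) => P).real
      (typicalSet ν δ n)) * hpow
  · have hη0 : 0 < (a - L) / (2 * L) := div_pos (by linarith) (by linarith)
    filter_upwards [eventually_measureReal_sum_le hc hβ h h1 h2 hint1 hint hm hlam hη0] with n hn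
    refine hn.trans_lt ?_
    have : (1 + (a - L) / (2 * L)) * L = L + (a - L) / 2 := by field_simp
    rw [← hν, ← hL, this]
    linarith

/-- Dividing the lower bound for all B by the upper bound for the total shows that the conditioned
law dominates r times the comparison law restricted to typical remainders. This is a common part of
mass close to 1. -/
theorem approxEqualLaws_orderedVector {c β : ℝ} (hc : 0 < c) (hβ : 2 < β)
    (h : (fun k => P.real {k}) ~[atTop] fun k : ℕ => c * (k : ℝ) ^ (-β))
    {lam : ℝ} {m : ℕ → ℕ} (hm : Tendsto (fun n : ℕ => (m n : ℝ) / n) atTop (𝓝 lam))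
    (hlam : ∫ k : ℕ, (k : ℝ) ∂P < lam)
    (A : ∀ n, Measure (Fin n → ℕ)) [∀ n, IsProbabilityMeasure (A n)]
    (hA : ∀ᶠ n in atTop,
      A n = ProbabilityTheory.cond (Measure.pi fun _ : Fin n => P) {y | ∑ l, y l = m n}) :
    ApproxEqualLaws (fun n => (A n).map orderedVector)
      (fun n => (Measure.pi fun _ : Fin (n - 1) => P).map (comparisonVector (m n))) := by
  obtain ⟨γ, h1, h2, hint1, hint⟩ := exists_rpow_integrable hβ h
  set ν := ∫ k : ℕ, (k : ℝ) ∂P with hν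
  set L := c * (lam - ν) ^ (-β) with hL
  have hL0 : 0 < L := mul_pos hc (Real.rpow_pos_of_pos (sub_pos.2 hlam) _)
  have hpos := (tendsto_measureReal_sum_eq hc hβ h hm hlam).eventually (Ioi_mem_nhds hL0)
  have : ∀ n, IsProbabilityMeasure ((A n).map orderedVector) := fun n =>
    Measure.isProbabilityMeasure_map Measurable.of_discrete.aemeasurable
  have : ∀ n, IsProbabilityMeasure
      ((Measure.pi fun _ : Fin (n - 1) => P).map (comparisonVector (n := n) (m n))) := fun n =>
    Measure.isProbabilityMeasure_map Measurable.of_discrete.aemeasurable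
  refine approxEqualLaws_of_forall_common_part _ _ fun ε hε => ?_
  set η := min (ε / 4) (1 / 2) with hη
  have hη0 : 0 < η := lt_min (by linarith) (by norm_num)
  have hη1 : η < 1 := (min_le_right _ _).trans_lt (by norm_num)
  have hηε : η ≤ ε / 4 := min_le_left _ _
  obtain ⟨δ, hδ, hlow⟩ := exists_le_measureReal_orderedVector hc h hm hlam hη0 hη1
  have hT := (tendsto_measureReal_typicalSet h1 hint1 hint hδ).eventually
    (Ioi_mem_nhds (show 1 - η < 1 by linarith))
  filter_upwards [hA, hpos, hlow, hT, eventually_gt_atTop 0,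
    eventually_measureReal_sum_le hc hβ h h1 h2 hint1 hint hm hlam hη0]
    with n hAn hn1 hn2 hn3 hn4 hn5
  have hn0 : (0 : ℝ) < n := by exact_mod_cast hn4
  set Q := Measure.pi fun _ : Fin n => P with hQ
  set Q' := Measure.pi fun _ : Fin (n - 1) => P with hQ'
  set D := Q.real {y | ∑ l, y l = m n} with hD
  set r := (1 - η) / (1 + η) with hr
  have hr0 : 0 ≤ r := div_nonneg (by linarith) (by linarith)
  have hr1 : r ≤ 1 := (div_le_one (by linarith)).2 (by linarith)
  have hnb : 0 < (n : ℝ) ^ (β - 1) := Real.rpow_pos_of_pos hn0 _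
  have hD0 : 0 < D := pos_of_mul_pos_right (show 0 < (n : ℝ) ^ (β - 1) * D from hn1) hnb.le
  have hcmp : Measurable (comparisonVector (n := n) (m n)) := Measurable.of_discrete
  have hpow : (n : ℝ) ^ (β - 1) * n * (n : ℝ) ^ (-β) = 1 := by
    rw [Real.rpow_sub hn0, Real.rpow_neg hn0.le, Real.rpow_one]
    have := (Real.rpow_pos_of_pos hn0 β).ne'
    field_simp
  refine ⟨ENNReal.ofReal r • (Q'.restrict (typicalSet ν δ n)).map (comparisonVector (m n)),
    ?_, ?_, ?_⟩
  · refine Measure.le_iff.2 fun B hB => ?_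
    rw [Measure.smul_apply, Measure.map_apply hcmp hB, Measure.restrict_apply
      MeasurableSet.of_discrete, smul_eq_mul, Measure.map_apply Measurable.of_discrete hB, hAn,
      cond_apply MeasurableSet.of_discrete, ← ofReal_measureReal, ← ofReal_measureReal (μ := Q),
      ← ofReal_measureReal (μ := Q), ← hD, ← ENNReal.ofReal_inv_of_pos hD0,
      ← ENNReal.ofReal_mul hr0, ← ENNReal.ofReal_mul (inv_nonneg.2 hD0.le)]
    refine ENNReal.ofReal_le_ofReal ?_
    have h3 := hn2 B
    rw [inv_mul_eq_div, le_div_iff₀ hD0, Set.inter_comm (comparisonVector (m n) ⁻¹' B)]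
    refine le_trans ?_ (h3.trans (le_of_eq rfl))
    set q := Q'.real (typicalSet ν δ n ∩ comparisonVector (m n) ⁻¹' B) with hq
    have hq0 : 0 ≤ q := measureReal_nonneg
    have hD1 : D ≤ (1 + η) * L * (n * (n : ℝ) ^ (-β)) := by
      have h5 : (n : ℝ) ^ (β - 1) * D ≤ (1 + η) * L := hn5
      have h6 : 0 < n * (n : ℝ) ^ (-β) := mul_pos hn0 (Real.rpow_pos_of_pos hn0 _)
      calc D = (n : ℝ) ^ (β - 1) * D * (n * (n : ℝ) ^ (-β)) := by
            linear_combination (-D) * hpow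
        _ ≤ _ := mul_le_mul_of_nonneg_right h5 h6.le
    calc r * q * D ≤ r * q * ((1 + η) * L * (n * (n : ℝ) ^ (-β))) := by gcongr
      _ = n * ((1 - η) * L * (n : ℝ) ^ (-β)) * q := by
        rw [hr]; field_simp
  · have hle : (Q'.restrict (typicalSet ν δ n)).map (comparisonVector (n := n) (m n)) ≤
        Q'.map (comparisonVector (m n)) := Measure.map_mono Measure.restrict_le_self hcmp
    refine Measure.le_iff.2 fun B hB => ?_
    rw [Measure.smul_apply, smul_eq_mul]
    calc _ ≤ 1 * (Q'.restrict (typicalSet ν δ n)).map (comparisonVector (n := n) (m n)) B := by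
          gcongr
          exact ENNReal.ofReal_le_one.2 hr1
      _ ≤ _ := by rw [one_mul]; exact hle B
  · rw [Measure.smul_apply, smul_eq_mul, Measure.map_apply hcmp MeasurableSet.univ,
      Set.preimage_univ, Measure.restrict_apply_univ, ← ofReal_measureReal,
      ← ENNReal.ofReal_mul hr0]
    refine ENNReal.ofReal_le_ofReal ?_
    have h3 : 1 - η < Q'.real (typicalSet ν δ n) := hn3
    -- With η ≤ ε/4, the common mass is at least (1 - 2η)(1 - η) ≥ 1 - ε.
    have h4 : 1 - 2 * η ≤ r := by
      rw [hr, le_div_iff₀ (by linarith)]; nlinarith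
    nlinarith

end ConditionedLaw

/-! ### The integral of the compensated exponential -/

section StableKernel

/-- The compensated exponential `e^{-ty} - 1 + ty`. -/
noncomputable def stableKernel (t : ℂ) (y : ℝ) : ℂ := Complex.exp (-(t * y)) - 1 + t * y

theorem norm_exp_neg_le_one {z : ℂ} (hz : 0 ≤ z.re) : ‖Complex.exp (-z)‖ ≤ 1 := by
  rw [Complex.norm_exp, Real.exp_le_one_iff, Complex.neg_re]
  linarith

/-- The kernel is quadratic at 0 and linear at infinity. This is the growth that y^(-β) can
integrate at both ends for 2 < β < 3. -/
theorem norm_stableKernel_le {t : ℂ} (ht : 0 ≤ t.re) {y : ℝ} (hy : 0 ≤ y) :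
    ‖stableKernel t y‖ ≤ 3 * (‖t‖ + ‖t‖ ^ 2) * min y (y ^ 2) := by
  have hn : ‖t * (y : ℂ)‖ = ‖t‖ * y := by
    rw [norm_mul, Complex.norm_real, Real.norm_of_nonneg hy]
  have hre : 0 ≤ (t * (y : ℂ)).re := by
    rw [Complex.re_mul_ofReal]; positivity
  have h1 : ‖stableKernel t y‖ ≤ 3 * (‖t‖ * y) ∧ ‖stableKernel t y‖ ≤ 3 * (‖t‖ * y) ^ 2 := by
    have hT : 0 ≤ ‖t‖ * y := by positivity
    rcases le_or_gt (‖t‖ * y) 1 with h | h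
    · have hb := Complex.norm_exp_sub_one_sub_id_le (x := -(t * (y : ℂ))) (by rwa [norm_neg, hn])
      rw [norm_neg, hn] at hb
      have : stableKernel t y = Complex.exp (-(t * y)) - 1 - -(t * y) := by
        rw [stableKernel]; ring
      rw [this]
      constructor <;> nlinarith
    · have hb : ‖stableKernel t y‖ ≤ 1 + 1 + ‖t‖ * y := by
        rw [stableKernel, ← hn]
        refine (norm_add_le _ _).trans (add_le_add_left ((norm_sub_le _ _).trans ?_) _)
        rw [norm_one]
        exact add_le_add_left (norm_exp_neg_le_one hre) _
      constructor <;> nlinarith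
  rcases min_cases y (y ^ 2) with ⟨h, -⟩ | ⟨h, -⟩ <;> rw [h]
  · have : 0 ≤ ‖t‖ ^ 2 * y := by positivity
    nlinarith [h1.1]
  · have : 0 ≤ ‖t‖ * y ^ 2 := by positivity
    nlinarith [h1.2]

theorem norm_one_sub_exp_neg_le {z : ℂ} (hz : 0 ≤ z.re) : ‖1 - Complex.exp (-z)‖ ≤ 2 * min 1 ‖z‖ := by
  rw [norm_sub_rev]
  rcases le_or_gt ‖z‖ 1 with h | h
  · rw [min_eq_right h]
    have := Complex.norm_exp_sub_one_le (x := -z) (by rwa [norm_neg])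
    rwa [norm_neg] at this
  · rw [min_eq_left h.le]
    refine (norm_sub_le _ _).trans ?_
    rw [norm_one]
    linarith [norm_exp_neg_le_one hz]

theorem integrableOn_min_rpow {β : ℝ} (h2 : 2 < β) (h3 : β < 3) :
    IntegrableOn (fun y : ℝ => y ^ (-β) * min y (y ^ 2)) (Set.Ioi 0) := by
  have hm : ∀ s : Set ℝ, AEStronglyMeasurable (fun y : ℝ => y ^ (-β) * min y (y ^ 2))
      (volume.restrict s) := fun s => Measurable.aestronglyMeasurable (by fun_prop)
  rw [← Set.Ioc_union_Ioi_eq_Ioi zero_le_one]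
  refine IntegrableOn.union ?_ ?_
  · have hi : IntegrableOn (fun y : ℝ => y ^ (2 - β)) (Set.Ioc 0 1) :=
      (intervalIntegrable_iff_integrableOn_Ioc_of_le zero_le_one).1
        (intervalIntegral.intervalIntegrable_rpow' (by linarith))
    refine Integrable.mono' hi (hm _)
      ((ae_restrict_iff' measurableSet_Ioc).2 (ae_of_all _ fun y hy => ?_))
    have hy0 : 0 < y := hy.1
    rw [Real.norm_of_nonneg (by positivity), sub_eq_neg_add, Real.rpow_add hy0, Real.rpow_two]
    gcongr
    exact min_le_right _ _
  · have hi : IntegrableOn (fun y : ℝ => y ^ (1 - β)) (Set.Ioi 1) :=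
      integrableOn_Ioi_rpow_of_lt (by linarith) one_pos
    refine Integrable.mono' hi (hm _)
      ((ae_restrict_iff' measurableSet_Ioi).2 (ae_of_all _ fun y hy => ?_))
    have hy0 : 0 < y := one_pos.trans hy
    rw [Real.norm_of_nonneg (by positivity), sub_eq_neg_add, Real.rpow_add hy0, Real.rpow_one]
    gcongr
    exact min_le_left _ _

theorem antitoneOn_min_rpow {β : ℝ} (h2 : 2 < β) :
    AntitoneOn (fun y : ℝ => y ^ (-β) * min y (y ^ 2)) (Set.Ioi 0) := by
  have heq : ∀ y : ℝ, 0 < y → y ^ (-β) * min y (y ^ 2) = min (y ^ (1 - β)) (y ^ (2 - β)) := by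
    intro y hy
    rw [mul_min_of_nonneg _ _ (Real.rpow_nonneg hy.le _), sub_eq_neg_add, sub_eq_neg_add,
      Real.rpow_add hy, Real.rpow_add hy, Real.rpow_one, Real.rpow_two]
  intro a ha b hb hab
  simp only
  rw [heq a ha, heq b hb]
  exact min_le_min (Real.rpow_le_rpow_of_nonpos ha hab (by linarith))
    (Real.rpow_le_rpow_of_nonpos ha hab (by linarith))

theorem integrableOn_stableKernel {β : ℝ} (h2 : 2 < β) (h3 : β < 3) {t : ℂ} (ht : 0 ≤ t.re) :
    IntegrableOn (fun y : ℝ => (y ^ (-β)) • stableKernel t y) (Set.Ioi 0) := by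
  refine Integrable.mono' ((integrableOn_min_rpow h2 h3).const_mul (3 * (‖t‖ + ‖t‖ ^ 2))) ?_
    ((ae_restrict_iff' measurableSet_Ioi).2 (ae_of_all _ fun y hy => ?_))
  · exact Measurable.aestronglyMeasurable (by unfold stableKernel; fun_prop)
  · have hy0 : (0 : ℝ) < y := hy
    rw [norm_smul, Real.norm_of_nonneg (Real.rpow_nonneg hy0.le _)]
    nlinarith [mul_le_mul_of_nonneg_left (norm_stableKernel_le ht hy0.le)
      (Real.rpow_nonneg hy0.le (-β))]

theorem integrableOn_rpow_mul_cexp {s : ℝ} (hs : 0 < s) {t : ℂ} (ht : 0 < t.re) :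
    IntegrableOn (fun x : ℝ => (x ^ (s - 1)) • Complex.exp (-(t * x))) (Set.Ioi 0) := by
  have hi := integrableOn_rpow_mul_exp_neg_mul_rpow (s := s - 1) (p := 1) (b := t.re)
    (by linarith) one_pos ht
  refine Integrable.mono' hi (Measurable.aestronglyMeasurable (by fun_prop))
    ((ae_restrict_iff' measurableSet_Ioi).2 (ae_of_all _ fun y hy => ?_))
  have hy0 : (0 : ℝ) < y := hy
  rw [norm_smul, Real.norm_of_nonneg (Real.rpow_nonneg hy0.le _), Complex.norm_exp,
    Complex.neg_re, Complex.re_mul_ofReal, Real.rpow_one, neg_mul]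

/-- In z = -t, both sides are analytic for Re z < 0, the left side as the complex moment generating
function of the measure x^(s-1) dx. They agree on the negative reals by the real Gamma integral, so
the identity theorem applies. -/
theorem integral_rpow_mul_cexp {s : ℝ} (hs : 0 < s) {t : ℂ} (ht : 0 < t.re) :
    ∫ x : ℝ in Set.Ioi 0, (x ^ (s - 1)) • Complex.exp (-(t * x)) =
      Real.Gamma s * t ^ (-(s : ℂ)) := by
  set μ : Measure ℝ := (volume.restrict (Set.Ioi 0)).withDensity
    (fun x => ENNReal.ofReal (x ^ (s - 1))) with hμ
  have hdm : Measurable fun x : ℝ => ENNReal.ofReal (x ^ (s - 1)) := by fun_prop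
  have hconv : ∀ x ∈ Set.Ioi (0 : ℝ), (ENNReal.ofReal (x ^ (s - 1))).toReal = x ^ (s - 1) :=
    fun x hx => ENNReal.toReal_ofReal (Real.rpow_nonneg (le_of_lt hx) _)
  have hF : ∀ z : ℂ, complexMGF id μ z =
      ∫ x : ℝ in Set.Ioi 0, (x ^ (s - 1)) • Complex.exp (z * x) := by
    intro z
    rw [complexMGF, hμ, integral_withDensity_eq_integral_toReal_smul hdm
      (ae_of_all _ fun x => ENNReal.ofReal_lt_top)]
    refine setIntegral_congr_fun measurableSet_Ioi fun x hx => ?_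
    simp only [hconv x hx, id]
  have hset : Set.Iio 0 ⊆ integrableExpSet id μ := by
    intro r hr
    have hi := integrableOn_rpow_mul_exp_neg_mul_rpow (s := s - 1) (p := 1) (b := -r)
      (by linarith) one_pos (by simpa using hr)
    change Integrable (fun x : ℝ => Real.exp (r * id x)) μ
    rw [hμ, integrable_withDensity_iff_integrable_smul' hdm
      (ae_of_all _ fun x => ENNReal.ofReal_lt_top)]
    refine (integrableOn_congr_fun (fun x hx => ?_) measurableSet_Ioi).1 hi
    simp only [hconv x hx, id, smul_eq_mul, Real.rpow_one, neg_neg]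
  have hsub : {z : ℂ | z.re < 0} ⊆ {z : ℂ | z.re ∈ interior (integrableExpSet id μ)} :=
    fun z hz => interior_maximal hset isOpen_Iio hz
  have hFa : AnalyticOnNhd ℂ (complexMGF id μ) {z : ℂ | z.re < 0} :=
    analyticOnNhd_complexMGF.mono hsub
  have hopen : IsOpen {z : ℂ | z.re < 0} := isOpen_lt Complex.continuous_re continuous_const
  have hGa : AnalyticOnNhd ℂ (fun z : ℂ => (Real.Gamma s : ℂ) * (-z) ^ (-(s : ℂ)))
      {z : ℂ | z.re < 0} := by
    refine DifferentiableOn.analyticOnNhd (fun z hz => ?_) hopen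
    have hz' : -z ∈ Complex.slitPlane := Or.inl (by simpa using hz)
    exact ((differentiableAt_id.neg.cpow_const hz').const_mul _).differentiableWithinAt
  have hreal : ∀ r : ℝ, r < 0 → complexMGF id μ (r : ℂ) =
      (Real.Gamma s : ℂ) * (-(r : ℂ)) ^ (-(s : ℂ)) := by
    intro r hr
    rw [hF]
    have h1 := Real.integral_rpow_mul_exp_neg_mul_Ioi hs (neg_pos.2 hr)
    have h2 : ∫ x : ℝ in Set.Ioi 0, (x ^ (s - 1)) • Complex.exp ((r : ℂ) * x) =
        ((∫ x : ℝ in Set.Ioi 0, x ^ (s - 1) * Real.exp (-(-r * x)) : ℝ) : ℂ) := by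
      rw [← integral_complex_ofReal]
      refine integral_congr_ae (ae_of_all _ fun x => ?_)
      simp only [Complex.real_smul]
      push_cast
      ring_nf
    rw [h2, h1, one_div, Real.inv_rpow (by linarith), ← Real.rpow_neg (by linarith)]
    push_cast
    rw [Complex.ofReal_cpow (by linarith)]
    push_cast
    ring
  have heq : Set.EqOn (complexMGF id μ) (fun z : ℂ => (Real.Gamma s : ℂ) * (-z) ^ (-(s : ℂ)))
      {z : ℂ | z.re < 0} := by
    refine hFa.eqOn_of_preconnected_of_frequently_eq hGa
      (convex_halfSpace_re_lt 0).isPreconnected (z₀ := ((-1 : ℝ) : ℂ)) (by simp) ?_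
    have hlim : Tendsto (fun n : ℕ => ((-1 - 1 / ((n : ℝ) + 1) : ℝ) : ℂ)) atTop
        (𝓝[≠] ((-1 : ℝ) : ℂ)) := by
      refine tendsto_nhdsWithin_iff.2 ⟨?_, Eventually.of_forall fun n => ?_⟩
      · refine (Complex.continuous_ofReal.tendsto (-1)).comp ?_
        simpa using (tendsto_one_div_add_atTop_nhds_zero_nat (𝕜 := ℝ)).const_sub (-1)
      · have : (0 : ℝ) < 1 / ((n : ℝ) + 1) := by positivity
        simp only [Set.mem_compl_iff, Set.mem_singleton_iff, Complex.ofReal_inj]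
        linarith
    refine hlim.frequently (Eventually.frequently (Eventually.of_forall fun n => ?_))
    refine hreal _ ?_
    have : (0 : ℝ) < 1 / ((n : ℝ) + 1) := by positivity
    linarith
  have := heq (x := -t) (by simpa using ht)
  simp only [neg_neg, hF, neg_mul] at this
  exact this

/-- Two integrations by parts, packed into one explicit H, trade y^(-α-1) times the kernel for t²
y^(1-α) e^(-ty) / (α(α-1)). That is a convergent Gamma integral, and Γ(2-α) = α(α-1) Γ(-α). -/
theorem integral_stableKernel_of_re_pos {α : ℝ} (h1 : 1 < α) (h2 : α < 2) {t : ℂ}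
    (ht : 0 < t.re) :
    ∫ y : ℝ in Set.Ioi 0, (y ^ (-(α + 1))) • stableKernel t y =
      Real.Gamma (-α) * t ^ (α : ℂ) := by
  have hα0 : α ≠ 0 := by linarith
  have hα1 : α - 1 ≠ 0 := by linarith
  have ht0 : t ≠ 0 := by rintro rfl; simp at ht
  set M := 3 * (‖t‖ + ‖t‖ ^ 2) with hM
  let H : ℝ → ℂ := fun y => (-(y ^ (-α) / α) : ℝ) • stableKernel t y -
    (y ^ (1 - α) / (α * (α - 1)) : ℝ) • (t * (1 - Complex.exp (-(t * y))))
  let H' : ℝ → ℂ := fun y => (y ^ (-(α + 1))) • stableKernel t y -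
    (t ^ 2 / (α * (α - 1))) * ((y ^ ((2 - α) - 1)) • Complex.exp (-(t * y)))
  have hder : ∀ y ∈ Set.Ioi (0 : ℝ), HasDerivAt H (H' y) y := by
    intro y hy
    have hy0 : (0 : ℝ) < y := hy
    have hlin : HasDerivAt (fun y : ℝ => t * (y : ℂ)) t y := by
      simpa using (Complex.ofRealCLM.hasDerivAt (x := y)).const_mul t
    have hexp : HasDerivAt (fun y : ℝ => Complex.exp (-(t * y)))
        (Complex.exp (-(t * y)) * -t) y := hlin.neg.cexp
    have hG : HasDerivAt (stableKernel t) (Complex.exp (-(t * y)) * -t + t) y :=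
      (hexp.sub_const 1).add hlin
    have hG' : HasDerivAt (fun y : ℝ => t * (1 - Complex.exp (-(t * y))))
        (t * -(Complex.exp (-(t * y)) * -t)) y := (hexp.const_sub 1).const_mul t
    have hv : HasDerivAt (fun y : ℝ => -(y ^ (-α) / α)) (y ^ (-(α + 1))) y := by
      have := ((Real.hasDerivAt_rpow_const (p := -α) (Or.inl hy0.ne')).div_const α).neg
      refine this.congr_deriv ?_
      rw [show -α - 1 = -(α + 1) by ring]
      field_simp
    have hv' : HasDerivAt (fun y : ℝ => y ^ (1 - α) / (α * (α - 1))) (-(y ^ (-α) / α)) y := by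
      have := (Real.hasDerivAt_rpow_const (p := 1 - α) (Or.inl hy0.ne')).div_const (α * (α - 1))
      refine this.congr_deriv ?_
      rw [show 1 - α - 1 = -α by ring]
      field_simp
      ring
    refine ((hv.smul hG).sub (hv'.smul hG')).congr_deriv ?_
    have hαC : (α : ℂ) ≠ 0 := by exact_mod_cast hα0
    have hαC1 : (α : ℂ) - 1 ≠ 0 := by exact_mod_cast hα1
    simp only [H', Complex.real_smul]
    push_cast
    rw [show (2 : ℝ) - α - 1 = 1 - α by ring]
    field_simp
    ring
  have hint1 := integrableOn_stableKernel (β := α + 1) (by linarith) (by linarith) ht.le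
  have hint2 := integrableOn_rpow_mul_cexp (s := 2 - α) (by linarith) ht
  have hH'int : IntegrableOn H' (Set.Ioi 0) := hint1.sub (hint2.const_mul _)
  have hbound : ∀ y : ℝ, 0 < y → ‖H y‖ ≤ M / α * (y ^ (-α) * min y (y ^ 2)) +
      2 * ‖t‖ / (α * (α - 1)) * (y ^ (1 - α) * min 1 (‖t‖ * y)) := by
    intro y hy
    have hre : 0 ≤ (t * (y : ℂ)).re := by
      rw [Complex.re_mul_ofReal]; positivity
    have hn : ‖t * (y : ℂ)‖ = ‖t‖ * y := by
      rw [norm_mul, Complex.norm_real, Real.norm_of_nonneg hy.le]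
    have e1 := norm_stableKernel_le ht.le hy.le
    have e2 := norm_one_sub_exp_neg_le hre
    rw [hn] at e2
    have hp1 : 0 ≤ y ^ (-α) / α := div_nonneg (Real.rpow_nonneg hy.le _) (by linarith)
    have hp2 : 0 ≤ y ^ (1 - α) / (α * (α - 1)) :=
      div_nonneg (Real.rpow_nonneg hy.le _) (mul_nonneg (by linarith) (by linarith))
    refine (norm_sub_le _ _).trans ?_
    rw [norm_smul, norm_smul, norm_neg, Real.norm_of_nonneg hp1, Real.norm_of_nonneg hp2, norm_mul]
    refine add_le_add ?_ ?_
    · calc _ ≤ y ^ (-α) / α * (M * min y (y ^ 2)) := by gcongr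
        _ = _ := by ring
    · calc _ ≤ y ^ (1 - α) / (α * (α - 1)) * (‖t‖ * (2 * min 1 (‖t‖ * y))) := by gcongr
        _ = _ := by ring
  have hα1' : 0 < α * (α - 1) := mul_pos (by linarith) (by linarith)
  have hM0 : 0 ≤ M / α := div_nonneg (by positivity) (by linarith)
  have hK0 : 0 ≤ 2 * ‖t‖ / (α * (α - 1)) := div_nonneg (by positivity) hα1'.le
  -- The junk value 0 of a negative power at 0 agrees with the one-sided limit of H, so H is
  -- continuous up to the endpoint.
  have hH0 : H 0 = 0 := by
    simp only [H]
    rw [Real.zero_rpow (by linarith), Real.zero_rpow (by linarith)]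
    simp
  have hzero : ContinuousWithinAt H (Set.Ici 0) 0 := by
    rw [← continuousWithinAt_Ioi_iff_Ici, ContinuousWithinAt, hH0]
    have hlim : Tendsto (fun y : ℝ => (M / α + 2 * ‖t‖ / (α * (α - 1)) * ‖t‖) * y ^ (2 - α))
        (𝓝[>] 0) (𝓝 0) := by
      have : Tendsto (fun y : ℝ => y ^ (2 - α)) (𝓝 0) (𝓝 ((0 : ℝ) ^ (2 - α))) :=
        (Real.continuousAt_rpow_const 0 (2 - α) (Or.inr (by linarith))).tendsto
      rw [Real.zero_rpow (by linarith)] at this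
      simpa using (this.mono_left nhdsWithin_le_nhds).const_mul
        (M / α + 2 * ‖t‖ / (α * (α - 1)) * ‖t‖)
    refine squeeze_zero_norm' ?_ hlim
    filter_upwards [self_mem_nhdsWithin] with y hy
    have hy0 : (0 : ℝ) < y := hy
    refine (hbound y hy0).trans ?_
    have e1 : y ^ (-α) * min y (y ^ 2) ≤ y ^ (2 - α) := by
      rw [sub_eq_neg_add, Real.rpow_add hy0, Real.rpow_two]
      gcongr
      exact min_le_right _ _
    have e2 : y ^ (1 - α) * min 1 (‖t‖ * y) ≤ ‖t‖ * y ^ (2 - α) := by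
      rw [show 2 - α = (1 - α) + 1 by ring, Real.rpow_add hy0, Real.rpow_one]
      calc _ ≤ y ^ (1 - α) * (‖t‖ * y) := by gcongr; exact min_le_right _ _
        _ = _ := by ring
    calc _ ≤ M / α * y ^ (2 - α) + 2 * ‖t‖ / (α * (α - 1)) * (‖t‖ * y ^ (2 - α)) := by gcongr
      _ = _ := by ring
  have htop : Tendsto H atTop (𝓝 0) := by
    have hlim : Tendsto (fun y : ℝ => (M / α + 2 * ‖t‖ / (α * (α - 1))) * y ^ (-(α - 1)))
        atTop (𝓝 0) := by
      simpa using (tendsto_rpow_neg_atTop (show 0 < α - 1 by linarith)).const_mul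
        (M / α + 2 * ‖t‖ / (α * (α - 1)))
    refine squeeze_zero_norm' ?_ hlim
    filter_upwards [eventually_gt_atTop 0] with y hy0
    refine (hbound y hy0).trans ?_
    have e1 : y ^ (-α) * min y (y ^ 2) ≤ y ^ (-(α - 1)) := by
      rw [show -(α - 1) = -α + 1 by ring, Real.rpow_add hy0, Real.rpow_one]
      gcongr
      exact min_le_left _ _
    have e2 : y ^ (1 - α) * min 1 (‖t‖ * y) ≤ y ^ (-(α - 1)) := by
      rw [show -(α - 1) = 1 - α by ring]
      exact mul_le_of_le_one_right (Real.rpow_nonneg hy0.le _) (min_le_left _ _)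
    calc _ ≤ M / α * y ^ (-(α - 1)) + 2 * ‖t‖ / (α * (α - 1)) * y ^ (-(α - 1)) := by gcongr
      _ = _ := by ring
  have hftc := integral_Ioi_of_hasDerivAt_of_tendsto hzero hder hH'int htop
  rw [hH0, sub_zero] at hftc
  simp only [H'] at hftc
  rw [integral_sub hint1 (hint2.const_mul _), integral_const_mul,
    integral_rpow_mul_cexp (by linarith) ht, sub_eq_zero] at hftc
  rw [hftc]
  have hΓ : Real.Gamma (2 - α) = α * (α - 1) * Real.Gamma (-α) := by
    have a1 := Real.Gamma_add_one (s := -α) (by linarith)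
    have a2 := Real.Gamma_add_one (s := -α + 1) (by linarith)
    rw [show 2 - α = -α + 1 + 1 by ring, a2, a1]
    ring
  have hαC : (α : ℂ) ≠ 0 := by exact_mod_cast hα0
  have hαC1 : (α : ℂ) - 1 ≠ 0 := by exact_mod_cast hα1
  have hpow : t ^ (-((2 - α : ℝ) : ℂ)) = t ^ (α : ℂ) / t ^ 2 := by
    rw [show (-((2 - α : ℝ) : ℂ)) = (α : ℂ) - 2 by push_cast; ring, Complex.cpow_sub _ _ ht0,
      Complex.cpow_ofNat]
  rw [hpow, hΓ]
  push_cast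
  field_simp

/-- The imaginary axis, needed for characteristic functions, is reached by dominated convergence
from t + 1/(n+1). -/
theorem integral_stableKernel {α : ℝ} (h1 : 1 < α) (h2 : α < 2) {t : ℂ} (ht : 0 ≤ t.re) :
    ∫ y : ℝ in Set.Ioi 0, (y ^ (-(α + 1))) • stableKernel t y =
      Real.Gamma (-α) * t ^ (α : ℂ) := by
  let u : ℕ → ℂ := fun n => t + ((1 / ((n : ℝ) + 1) : ℝ) : ℂ)
  have hre : ∀ n, 0 < (u n).re := fun n => by
    have : (0 : ℝ) < 1 / ((n : ℝ) + 1) := by positivity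
    rw [Complex.add_re, Complex.ofReal_re]; linarith
  have hu : Tendsto u atTop (𝓝 t) := by
    have h0 : Tendsto (fun n : ℕ => ((1 / ((n : ℝ) + 1) : ℝ) : ℂ)) atTop (𝓝 0) := by
      have := (Complex.continuous_ofReal.tendsto 0).comp
        (tendsto_one_div_add_atTop_nhds_zero_nat (𝕜 := ℝ))
      rwa [Complex.ofReal_zero] at this
    have := h0.const_add t
    rwa [add_zero] at this
  have hR : Tendsto (fun n => (Real.Gamma (-α) : ℂ) * u n ^ (α : ℂ)) atTop
      (𝓝 (Real.Gamma (-α) * t ^ (α : ℂ))) := by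
    have hc : ContinuousAt (fun z : ℂ => z ^ (α : ℂ)) t :=
      Complex.continuousAt_cpow_const_of_re_pos (Or.inl ht) (by rw [Complex.ofReal_re]; linarith)
    exact (hc.tendsto.comp hu).const_mul _
  have hnorm : ∀ n, ‖u n‖ ≤ ‖t‖ + 1 := by
    intro n
    refine (norm_add_le _ _).trans (add_le_add_right ?_ _)
    rw [Complex.norm_real, Real.norm_of_nonneg (by positivity), div_le_one (by positivity)]
    linarith [Nat.cast_nonneg (α := ℝ) n]
  have hL : Tendsto (fun n => ∫ y : ℝ in Set.Ioi 0, (y ^ (-(α + 1))) • stableKernel (u n) y) atTop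
      (𝓝 (∫ y : ℝ in Set.Ioi 0, (y ^ (-(α + 1))) • stableKernel t y)) := by
    refine tendsto_integral_of_dominated_convergence
      (fun y => 3 * ((‖t‖ + 1) + (‖t‖ + 1) ^ 2) * (y ^ (-(α + 1)) * min y (y ^ 2)))
      (fun n => Measurable.aestronglyMeasurable (by unfold stableKernel; fun_prop))
      ((integrableOn_min_rpow (by linarith) (by linarith)).const_mul _) (fun n => ?_) ?_
    · refine (ae_restrict_iff' measurableSet_Ioi).2 (ae_of_all _ fun y hy => ?_)
      have hy0 : (0 : ℝ) < y := hy
      rw [norm_smul, Real.norm_of_nonneg (Real.rpow_nonneg hy0.le _)]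
      calc _ ≤ y ^ (-(α + 1)) * (3 * (‖u n‖ + ‖u n‖ ^ 2) * min y (y ^ 2)) :=
            mul_le_mul_of_nonneg_left (norm_stableKernel_le (hre n).le hy0.le)
              (Real.rpow_nonneg hy0.le _)
        _ ≤ y ^ (-(α + 1)) * (3 * ((‖t‖ + 1) + (‖t‖ + 1) ^ 2) * min y (y ^ 2)) := by
            gcongr <;> exact hnorm n
        _ = _ := by ring
    · refine ae_of_all _ fun y => ?_
      have hc : Continuous fun z : ℂ => (y ^ (-(α + 1))) • stableKernel z y := by
        unfold stableKernel; fun_prop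
      exact (hc.tendsto t).comp hu
  refine tendsto_nhds_unique hL (hR.congr fun n => ?_)
  exact (integral_stableKernel_of_re_pos h1 h2 (hre n)).symm

end StableKernel

/-! ### Laplace transforms of the normalized sums -/

section StableLimit

theorem norm_one_sub_mul_exp_sub_one_le {z : ℂ} (hz : ‖z‖ ≤ 1) :
    ‖(1 - z) * Complex.exp z - 1‖ ≤ 3 * ‖z‖ ^ 2 := by
  have h1 := Complex.norm_exp_sub_one_sub_id_le hz
  have h2 : (1 - z) * Complex.exp z - 1 = (1 - z) * (Complex.exp z - 1 - z) - z ^ 2 := by ring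
  have h3 : ‖1 - z‖ ≤ 2 := (norm_sub_le _ _).trans (by rw [norm_one]; linarith)
  rw [h2]
  refine (norm_sub_le _ _).trans ?_
  rw [norm_mul, norm_pow]
  nlinarith [norm_nonneg (1 - z), norm_nonneg (Complex.exp z - 1 - z)]

variable {P : Measure ℕ} [IsProbabilityMeasure P]

theorem integral_cexp_neg_eq (hint : Integrable (fun k : ℕ => (k : ℝ)) P) (t : ℂ) (ht : 0 ≤ t.re)
    {a : ℝ} (ha : 0 ≤ a) :
    ∫ k : ℕ, Complex.exp (-(t * (a * k : ℝ))) ∂P =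
      1 - t * (a * ∫ k : ℕ, (k : ℝ) ∂P : ℝ) + ∫ k : ℕ, stableKernel t (a * k) ∂P := by
  have hre : ∀ k : ℕ, 0 ≤ (t * ((a * k : ℝ) : ℂ)).re := fun k => by
    rw [Complex.re_mul_ofReal]; positivity
  have h1 : Integrable (fun k : ℕ => Complex.exp (-(t * (a * k : ℝ)))) P :=
    Integrable.of_bound (Measurable.of_discrete.aestronglyMeasurable) 1
      (ae_of_all _ fun k => norm_exp_neg_le_one (hre k))
  have h2 : Integrable (fun k : ℕ => t * ((a * k : ℝ) : ℂ)) P :=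
    ((hint.const_mul a).ofReal).const_mul t
  have h3 : ∫ k : ℕ, stableKernel t (a * k) ∂P =
      ∫ k : ℕ, Complex.exp (-(t * (a * k : ℝ))) ∂P - 1 + t * (a * ∫ k : ℕ, (k : ℝ) ∂P : ℝ) := by
    have h12 : Integrable (fun k : ℕ => Complex.exp (-(t * (a * k : ℝ))) - 1) P :=
      h1.sub (integrable_const _)
    unfold stableKernel
    rw [integral_add h12 h2, integral_sub h1 (integrable_const _),
      integral_const_mul, integral_complex_ofReal, integral_const_mul]
    simp
  rw [h3]
  ring

theorem tendsto_mul_integral_stableKernel {c β : ℝ} (hβ : 2 < β) (hβ3 : β < 3)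
    (h : (fun k => P.real {k}) ~[atTop] fun k : ℕ => c * (k : ℝ) ^ (-β)) {t : ℂ}
    (ht : 0 ≤ t.re) :
    Tendsto (fun n : ℕ => (n : ℂ) * ∫ k : ℕ, stableKernel t ((n : ℝ) ^ (-(1 / (β - 1))) * k) ∂P)
      atTop (𝓝 (c * Real.Gamma (-(β - 1)) * t ^ ((β - 1 : ℝ) : ℂ))) := by
  have hk := tendsto_mul_integral_scaled hβ h (g := stableKernel t)
    (D := fun y => 3 * (‖t‖ + ‖t‖ ^ 2) * (y ^ (-β) * min y (y ^ 2)))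
    (by simp [stableKernel])
    (fun x hx y hy hxy => mul_le_mul_of_nonneg_left (antitoneOn_min_rpow hβ hx hy hxy)
      (by positivity))
    ((integrableOn_min_rpow hβ hβ3).const_mul _)
    (fun y hy => by
      calc _ ≤ y ^ (-β) * (3 * (‖t‖ + ‖t‖ ^ 2) * min y (y ^ 2)) :=
            mul_le_mul_of_nonneg_left (norm_stableKernel_le ht hy.le) (Real.rpow_nonneg hy.le _)
        _ = _ := by ring)
    (ae_of_all _ fun y => by
      have : Continuous (stableKernel t) := by unfold stableKernel; fun_prop
      exact this.continuousAt)
  have hv : ∫ y in Set.Ioi (0 : ℝ), (c * y ^ (-β)) • stableKernel t y =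
      c * Real.Gamma (-(β - 1)) * t ^ ((β - 1 : ℝ) : ℂ) := by
    have := integral_stableKernel (α := β - 1) (by linarith) (by linarith) ht
    simp only [sub_add_cancel] at this
    simp only [mul_smul]
    rw [integral_smul c (fun y : ℝ => y ^ (-β) • stableKernel t y), this, Complex.real_smul]
    ring
  rw [hv] at hk
  refine hk.congr fun n => ?_
  rw [Complex.real_smul, Complex.ofReal_natCast]

/-- The law of `n^(-1/(β-1)) (∑ᵢ xᵢ - ν n)` for `n - 1` independent variables `xᵢ` with law `P`
and mean `ν`. -/
noncomputable def normalizedSumLaw (P : Measure ℕ) [IsProbabilityMeasure P] (β : ℝ) (n : ℕ) :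
    ProbabilityMeasure ℝ :=
  ⟨(Measure.pi fun _ : Fin (n - 1) => P).map fun x =>
    (n : ℝ) ^ (-(1 / (β - 1))) * (∑ i, (x i : ℝ) - (∫ k : ℕ, (k : ℝ) ∂P) * n),
    Measure.isProbabilityMeasure_map Measurable.of_discrete.aemeasurable⟩

/-- The summands are non-negative, so for fixed n the variable is bounded below and the exponential
is bounded. -/
theorem integrable_cexp_normalizedSumLaw (β : ℝ) (n : ℕ) {t : ℂ} (ht : 0 ≤ t.re) :
    Integrable (fun x : ℝ => Complex.exp (-(t * x))) (normalizedSumLaw P β n : Measure ℝ) := by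
  have hm : Continuous fun x : ℝ => Complex.exp (-(t * x)) := by fun_prop
  set a := (n : ℝ) ^ (-(1 / (β - 1))) with ha
  have ha0 : 0 ≤ a := by positivity
  rw [normalizedSumLaw, ProbabilityMeasure.coe_mk, integrable_map_measure
    hm.aestronglyMeasurable Measurable.of_discrete.aemeasurable]
  refine Integrable.of_bound (Measurable.of_discrete.aestronglyMeasurable)
    (Real.exp (t.re * (a * ((∫ k : ℕ, (k : ℝ) ∂P) * n)))) (ae_of_all _ fun x => ?_)
  rw [Function.comp_apply, Complex.norm_exp, Complex.neg_re, Complex.re_mul_ofReal]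
  refine Real.exp_le_exp.2 ?_
  have hs : 0 ≤ t.re * (a * ∑ i, (x i : ℝ)) := by positivity
  linarith

theorem integral_cexp_normalizedSumLaw (β : ℝ) (n : ℕ) (t : ℂ) :
    ∫ x : ℝ, Complex.exp (-(t * x)) ∂(normalizedSumLaw P β n : Measure ℝ) =
      (∫ k : ℕ, Complex.exp (-(t * ((n : ℝ) ^ (-(1 / (β - 1))) * k : ℝ))) ∂P) ^ (n - 1) *
        Complex.exp (t * ((n : ℝ) ^ (-(1 / (β - 1))) * ∫ k : ℕ, (k : ℝ) ∂P : ℝ)) ^ n := by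
  have hm : Continuous fun x : ℝ => Complex.exp (-(t * x)) := by fun_prop
  set a := (n : ℝ) ^ (-(1 / (β - 1))) with ha
  rw [normalizedSumLaw, ProbabilityMeasure.coe_mk, integral_map
    Measurable.of_discrete.aemeasurable hm.aestronglyMeasurable]
  have hpow := integral_fintype_prod_eq_pow (ι := Fin (n - 1)) (μ := P)
    (fun k : ℕ => Complex.exp (-(t * (a * k : ℝ))))
  rw [Fintype.card_fin] at hpow
  rw [← hpow, ← integral_mul_const (Complex.exp _ ^ n)]
  refine integral_congr_ae (Eventually.of_forall fun x => ?_)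
  simp only
  rw [← Complex.exp_sum, ← Complex.exp_nat_mul, ← Complex.exp_add]
  congr 1
  push_cast
  rw [Finset.sum_neg_distrib, ← Finset.mul_sum, ← Finset.mul_sum]
  ring

/-- Each centred summand contributes 1 + u = (1 - z + K) e^z, where z is the scaled mean and K the
expected kernel. Since α < 2, the second-order terms in z vanish after multiplication by n, so n u →
L and (1 + u)^n → e^L. -/
theorem tendsto_integral_cexp_normalizedSumLaw {c β : ℝ} (hβ : 2 < β) (hβ3 : β < 3)
    (h : (fun k => P.real {k}) ~[atTop] fun k : ℕ => c * (k : ℝ) ^ (-β)) {t : ℂ}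
    (ht : 0 ≤ t.re) :
    Tendsto (fun n : ℕ => ∫ x : ℝ, Complex.exp (-(t * x)) ∂(normalizedSumLaw P β n : Measure ℝ))
      atTop (𝓝 (Complex.exp (c * Real.Gamma (-(β - 1)) * t ^ ((β - 1 : ℝ) : ℂ)))) := by
  have hint : Integrable (fun k : ℕ => (k : ℝ)) P := by
    have := integrable_rpow (γ := 1) h (by linarith)
    simpa using this
  set ν := ∫ k : ℕ, (k : ℝ) ∂P with hν
  set L : ℂ := c * Real.Gamma (-(β - 1)) * t ^ ((β - 1 : ℝ) : ℂ) with hL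
  let a : ℕ → ℝ := fun n => (n : ℝ) ^ (-(1 / (β - 1)))
  let z : ℕ → ℂ := fun n => t * (a n * ν : ℝ)
  let K : ℕ → ℂ := fun n => ∫ k : ℕ, stableKernel t (a n * k) ∂P
  let u : ℕ → ℂ := fun n => ((1 - z n) * Complex.exp (z n) - 1) + K n * Complex.exp (z n)
  have hK : Tendsto (fun n : ℕ => (n : ℂ) * K n) atTop (𝓝 L) :=
    tendsto_mul_integral_stableKernel hβ hβ3 h ht
  have hα : 0 < 1 / (β - 1) := by
    have : 0 < β - 1 := by linarith
    positivity
  have hα2 : 1 < 2 / (β - 1) := by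
    rw [lt_div_iff₀ (by linarith)]; linarith
  have ha : Tendsto a atTop (𝓝 0) :=
    (tendsto_rpow_neg_atTop hα).comp tendsto_natCast_atTop_atTop
  have hz : Tendsto z atTop (𝓝 0) := by
    have h1 : Tendsto (fun n => ((a n * ν : ℝ) : ℂ)) atTop (𝓝 0) := by
      have := (Complex.continuous_ofReal.tendsto 0).comp
        (show Tendsto (fun n => a n * ν) atTop (𝓝 0) by simpa using ha.mul_const ν)
      rwa [Complex.ofReal_zero] at this
    have := h1.const_mul t
    rwa [mul_zero] at this
  have hez : Tendsto (fun n => Complex.exp (z n)) atTop (𝓝 1) := by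
    have := (Complex.continuous_exp.tendsto 0).comp hz
    rwa [Complex.exp_zero] at this
  have hsq : Tendsto (fun n : ℕ => (n : ℂ) * ((1 - z n) * Complex.exp (z n) - 1)) atTop
      (𝓝 0) := by
    have hlim : Tendsto (fun n : ℕ => 3 * (‖t‖ * |ν|) ^ 2 * (n : ℝ) ^ (-(2 / (β - 1) - 1))) atTop
        (𝓝 0) := by
      simpa using ((tendsto_rpow_neg_atTop (show 0 < 2 / (β - 1) - 1 by linarith)).comp
        tendsto_natCast_atTop_atTop).const_mul (3 * (‖t‖ * |ν|) ^ 2)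
    refine squeeze_zero_norm' ?_ hlim
    have hz1 : ∀ᶠ n in atTop, ‖z n‖ < 1 := by
      have := hz.norm
      rw [norm_zero] at this
      exact this.eventually (gt_mem_nhds one_pos)
    filter_upwards [hz1, eventually_ge_atTop 1] with n hn hn1
    have hn0 : (0 : ℝ) < n := by exact_mod_cast hn1
    rw [norm_mul, Complex.norm_natCast]
    have e1 : ‖z n‖ = ‖t‖ * |ν| * a n := by
      simp only [z]
      rw [norm_mul, Complex.norm_real, Real.norm_eq_abs, abs_mul,
        abs_of_nonneg (Real.rpow_nonneg hn0.le _)]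
      ring
    have e2 : (n : ℝ) * a n ^ 2 = (n : ℝ) ^ (-(2 / (β - 1) - 1)) := by
      rw [show -(2 / (β - 1) - 1) = 1 + (-(1 / (β - 1))) * (2 : ℕ) by push_cast; ring,
        Real.rpow_add hn0, Real.rpow_one, Real.rpow_mul_natCast hn0.le]
    calc (n : ℝ) * ‖(1 - z n) * Complex.exp (z n) - 1‖ ≤ n * (3 * ‖z n‖ ^ 2) := by
          gcongr; exact norm_one_sub_mul_exp_sub_one_le hn.le
      _ = 3 * (‖t‖ * |ν|) ^ 2 * (n * a n ^ 2) := by rw [e1]; ring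
      _ = _ := by rw [e2]
  have hu : Tendsto (fun n : ℕ => (n : ℂ) * u n) atTop (𝓝 L) := by
    have := hsq.add (hK.mul hez)
    rw [zero_add, mul_one] at this
    refine this.congr fun n => ?_
    simp only [u]; ring
  have hu0 : Tendsto u atTop (𝓝 0) := by
    have hinv : Tendsto (fun n : ℕ => ((n : ℂ))⁻¹) atTop (𝓝 0) := tendsto_inv_atTop_nhds_zero_nat
    have := hinv.mul hu
    rw [zero_mul] at this
    refine this.congr' ?_
    filter_upwards [eventually_ge_atTop 1] with n hn
    have : (n : ℂ) ≠ 0 := by exact_mod_cast (by omega : n ≠ 0)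
    field_simp
  have hu1 : Tendsto (fun n => 1 + u n) atTop (𝓝 1) := by simpa using hu0.const_add 1
  have hpow : Tendsto (fun n : ℕ => (1 + u n) ^ n) atTop (𝓝 (Complex.exp L)) :=
    Complex.tendsto_one_add_pow_exp_of_tendsto hu
  -- There are n - 1 summands but the centring is by n ν: one factor 1 + u is removed and one e^z
  -- put back, both tending to 1.
  have hfin := (hpow.mul (hu1.inv₀ one_ne_zero)).mul hez
  rw [inv_one, mul_one, mul_one] at hfin
  refine hfin.congr' ?_
  filter_upwards [hu1.eventually_ne one_ne_zero, eventually_ge_atTop 1] with n hn hn1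
  obtain ⟨k, rfl⟩ : ∃ k, n = k + 1 := ⟨n - 1, by omega⟩
  have hφ := integral_cexp_neg_eq hint t ht (a := a (k + 1))
    (Real.rpow_nonneg (Nat.cast_nonneg _) _)
  rw [integral_cexp_normalizedSumLaw]
  change _ = (∫ l : ℕ, Complex.exp (-(t * (a (k + 1) * l : ℝ))) ∂P) ^ (k + 1 - 1) *
    Complex.exp (z (k + 1)) ^ (k + 1)
  rw [hφ]
  change _ = (1 - z (k + 1) + K (k + 1)) ^ (k + 1 - 1) * Complex.exp (z (k + 1)) ^ (k + 1)
  have e3 : 1 + u (k + 1) = (1 - z (k + 1) + K (k + 1)) * Complex.exp (z (k + 1)) := by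
    simp only [u]; ring
  rw [pow_succ, mul_assoc ((1 + u (k + 1)) ^ k), mul_inv_cancel₀ hn, mul_one, e3,
    Nat.add_sub_cancel, mul_pow, pow_succ]
  ring

end StableLimit

/-! ### Existence and stability of the limit law -/

section StableLaw

theorem norm_cexp_neg_mul_ofReal (t : ℂ) (x : ℝ) :
    ‖Complex.exp (-(t * x))‖ = Real.exp (-(t.re * x)) := by
  rw [Complex.norm_exp, Complex.neg_re, Complex.re_mul_ofReal]

/-- Truncation at -K makes the exponential bounded. The error lives on x < -K, where one factor
e^(-Re(t) K) is gained over the exponential of doubled rate. -/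
theorem norm_cexp_truncation_sub_le {t : ℂ} (ht : 0 ≤ t.re) {K : ℝ} (x : ℝ) :
    ‖Complex.exp (-(t * (max x (-K) : ℝ))) - Complex.exp (-(t * x))‖ ≤
      2 * Real.exp (-(t.re * K)) * Real.exp (-(2 * t.re * x)) := by
  rcases le_or_gt (-K) x with h | h
  · rw [max_eq_left h, sub_self, norm_zero]; positivity
  · rw [max_eq_right h.le]
    have e : Real.exp (-(t.re * K)) * Real.exp (-(2 * t.re * x)) =
        Real.exp (-(t.re * (K + 2 * x))) := by
      rw [← Real.exp_add]; ring_nf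
    refine (norm_sub_le _ _).trans ?_
    rw [norm_cexp_neg_mul_ofReal, norm_cexp_neg_mul_ofReal, mul_assoc, e, two_mul]
    refine add_le_add ?_ ?_ <;> refine Real.exp_le_exp.2 ?_ <;> nlinarith

/-- Fatou's lemma for weak limits of a non-negative continuous function. -/
theorem integrable_exp_of_tendsto {μs : ℕ → ProbabilityMeasure ℝ} {μ : ProbabilityMeasure ℝ}
    (h : Tendsto μs atTop (𝓝 μ)) {r M : ℝ}
    (hint : ∀ n, Integrable (fun x : ℝ => Real.exp (-(r * x))) (μs n : Measure ℝ))
    (hM : ∀ n, ∫ x, Real.exp (-(r * x)) ∂(μs n : Measure ℝ) ≤ M) :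
    Integrable (fun x : ℝ => Real.exp (-(r * x))) (μ : Measure ℝ) ∧
      ∫ x, Real.exp (-(r * x)) ∂(μ : Measure ℝ) ≤ M := by
  have hM0 : 0 ≤ M := (integral_nonneg fun x => (Real.exp_pos _).le).trans (hM 0)
  have hle : ∫⁻ x, ENNReal.ofReal (Real.exp (-(r * x))) ∂(μ : Measure ℝ) ≤ ENNReal.ofReal M := by
    refine (lintegral_le_liminf_lintegral_of_forall_isOpen_measure_le_liminf_measure
      (μs := fun n => (μs n : Measure ℝ)) (by fun_prop) (fun x => (Real.exp_pos _).le)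
      fun G hG => ProbabilityMeasure.le_liminf_measure_open_of_tendsto h hG).trans ?_
    refine (liminf_le_liminf (Eventually.of_forall fun n => ?_)).trans
      (liminf_const (ENNReal.ofReal M)).le
    rw [← ofReal_integral_eq_lintegral_ofReal (hint n) (ae_of_all _ fun x => (Real.exp_pos _).le)]
    exact ENNReal.ofReal_le_ofReal (hM n)
  have hi : Integrable (fun x : ℝ => Real.exp (-(r * x))) (μ : Measure ℝ) := by
    refine ⟨by fun_prop, ?_⟩
    rw [hasFiniteIntegral_iff_ofReal (ae_of_all _ fun x => (Real.exp_pos _).le)]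
    exact hle.trans_lt ENNReal.ofReal_lt_top
  refine ⟨hi, ?_⟩
  rwa [← ofReal_integral_eq_lintegral_ofReal hi (ae_of_all _ fun x => (Real.exp_pos _).le),
    ENNReal.ofReal_le_ofReal_iff hM0] at hle

/-- Convergence of Laplace transforms passes to the weak limit. -/
theorem integral_cexp_of_tendsto {μs : ℕ → ProbabilityMeasure ℝ} {μ : ProbabilityMeasure ℝ}
    (h : Tendsto μs atTop (𝓝 μ)) {f : ℂ → ℂ}
    (hint : ∀ n (t : ℂ), 0 ≤ t.re →
      Integrable (fun x : ℝ => Complex.exp (-(t * x))) (μs n : Measure ℝ))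
    (hlim : ∀ t : ℂ, 0 ≤ t.re →
      Tendsto (fun n => ∫ x : ℝ, Complex.exp (-(t * x)) ∂(μs n : Measure ℝ)) atTop (𝓝 (f t)))
    {t : ℂ} (ht : 0 ≤ t.re) :
    Integrable (fun x : ℝ => Complex.exp (-(t * x))) (μ : Measure ℝ) ∧
      ∫ x : ℝ, Complex.exp (-(t * x)) ∂(μ : Measure ℝ) = f t := by
  have hreal : ∀ (r : ℝ) (n : ℕ), 0 ≤ r →
      Integrable (fun x : ℝ => Real.exp (-(r * x))) (μs n : Measure ℝ) := by
    intro r n hr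
    refine (hint n (r : ℂ) (by simpa using hr)).norm.congr (ae_of_all _ fun x => ?_)
    simp only [norm_cexp_neg_mul_ofReal, Complex.ofReal_re]
  have hbdd : ∀ r : ℝ, 0 ≤ r → ∃ M : ℝ, ∀ n,
      ∫ x, Real.exp (-(r * x)) ∂(μs n : Measure ℝ) ≤ M := by
    intro r hr
    obtain ⟨M, hM⟩ := ((hlim (r : ℂ) (by simpa using hr)).norm).bddAbove_range
    refine ⟨M, fun n => le_trans (le_of_eq ?_) (hM ⟨n, rfl⟩)⟩
    have e : ∫ x : ℝ, Complex.exp (-((r : ℂ) * x)) ∂(μs n : Measure ℝ) =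
        ((∫ x, Real.exp (-(r * x)) ∂(μs n : Measure ℝ) : ℝ) : ℂ) := by
      rw [← integral_complex_ofReal]
      refine integral_congr_ae (ae_of_all _ fun x => ?_)
      simp only
      push_cast
      ring_nf
    simp only [e, Complex.norm_real]
    rw [Real.norm_of_nonneg (integral_nonneg fun x => (Real.exp_pos _).le)]
  have hcont : Continuous fun x : ℝ => Complex.exp (-(t * x)) := by fun_prop
  obtain ⟨M1, hM1⟩ := hbdd t.re ht
  obtain ⟨hi1, -⟩ := integrable_exp_of_tendsto h (fun n => hreal _ n ht) hM1
  have hI : Integrable (fun x : ℝ => Complex.exp (-(t * x))) (μ : Measure ℝ) := by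
    refine hi1.mono' hcont.aestronglyMeasurable (ae_of_all _ fun x => ?_)
    rw [norm_cexp_neg_mul_ofReal]
  refine ⟨hI, ?_⟩
  have ht2 : 0 ≤ 2 * t.re := by positivity
  obtain ⟨M, hM⟩ := hbdd (2 * t.re) ht2
  obtain ⟨hi2, hM'⟩ := integrable_exp_of_tendsto h (fun n => hreal _ n ht2) hM
  let F : ℝ → ℝ → ℂ := fun K x => Complex.exp (-(t * (max x (-K) : ℝ)))
  have hFc : ∀ K, Continuous (F K) := fun K => by
    simp only [F]; fun_prop
  have hFb : ∀ K x, ‖F K x‖ ≤ Real.exp (t.re * K) := by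
    intro K x
    simp only [F]
    rw [norm_cexp_neg_mul_ofReal]
    refine Real.exp_le_exp.2 ?_
    nlinarith [le_max_right x (-K)]
  have hFi : ∀ K (ρ : ProbabilityMeasure ℝ), Integrable (F K) (ρ : Measure ℝ) := fun K ρ =>
    Integrable.of_bound (hFc K).aestronglyMeasurable _ (ae_of_all _ (hFb K))
  have hFlim : ∀ K, Tendsto (fun n => ∫ x, F K x ∂(μs n : Measure ℝ)) atTop
      (𝓝 (∫ x, F K x ∂(μ : Measure ℝ))) := fun K =>
    (ProbabilityMeasure.tendsto_iff_forall_integral_rclike_tendsto ℂ).1 h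
      (BoundedContinuousFunction.ofNormedAddCommGroup (F K) (hFc K) _ (hFb K))
  have herr : ∀ K (ρ : ProbabilityMeasure ℝ),
      Integrable (fun x : ℝ => Complex.exp (-(t * x))) (ρ : Measure ℝ) →
      Integrable (fun x : ℝ => Real.exp (-(2 * t.re * x))) (ρ : Measure ℝ) →
      ∫ x, Real.exp (-(2 * t.re * x)) ∂(ρ : Measure ℝ) ≤ M →
      ‖∫ x, F K x ∂(ρ : Measure ℝ) - ∫ x : ℝ, Complex.exp (-(t * x)) ∂(ρ : Measure ℝ)‖ ≤
        2 * Real.exp (-(t.re * K)) * M := by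
    intro K ρ h1 h2 h3
    rw [← integral_sub (hFi K ρ) h1]
    refine (norm_integral_le_of_norm_le (h2.const_mul _)
      (ae_of_all _ fun x => norm_cexp_truncation_sub_le ht x)).trans ?_
    rw [integral_const_mul]
    gcongr
  -- For Re t = 0 the truncation error does not decay in K, but the exponential is already bounded
  -- and weak convergence applies directly.
  rcases ht.eq_or_lt with ht0 | ht0
  · have hb : ∀ x : ℝ, ‖Complex.exp (-(t * x))‖ ≤ 1 := fun x => by
      rw [norm_cexp_neg_mul_ofReal, ← ht0]; simp
    exact tendsto_nhds_unique
      ((ProbabilityMeasure.tendsto_iff_forall_integral_rclike_tendsto ℂ).1 h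
        (BoundedContinuousFunction.ofNormedAddCommGroup _ hcont _ hb)) (hlim t ht)
  · have hK : ∀ K : ℝ, ‖∫ x : ℝ, Complex.exp (-(t * x)) ∂(μ : Measure ℝ) - f t‖ ≤
        2 * (2 * Real.exp (-(t.re * K)) * M) := by
      intro K
      have h1 : ‖∫ x, F K x ∂(μ : Measure ℝ) - f t‖ ≤ 2 * Real.exp (-(t.re * K)) * M :=
        le_of_tendsto ((hFlim K).sub (hlim t ht)).norm
          (Eventually.of_forall fun n => herr K (μs n) (hint n t ht) (hreal _ n ht2) (hM n))
      have h2 := herr K μ hI hi2 hM'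
      rw [norm_sub_rev] at h2
      calc _ = ‖(∫ x : ℝ, Complex.exp (-(t * x)) ∂(μ : Measure ℝ) -
            ∫ x, F K x ∂(μ : Measure ℝ)) + (∫ x, F K x ∂(μ : Measure ℝ) - f t)‖ := by
            congr 1; ring
        _ ≤ _ := (norm_add_le _ _).trans (by linarith)
    have hz : Tendsto (fun K : ℝ => 2 * (2 * Real.exp (-(t.re * K)) * M)) atTop (𝓝 0) := by
      have h1 : Tendsto (fun K : ℝ => Real.exp (-(t.re * K))) atTop (𝓝 0) :=
        Real.tendsto_exp_neg_atTop_nhds_zero.comp (tendsto_id.const_mul_atTop ht0)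
      simpa using ((h1.const_mul 2).mul_const M).const_mul 2
    have := ge_of_tendsto hz (Eventually.of_forall hK)
    exact sub_eq_zero.1 (norm_le_zero_iff.1 this)

/-- Lévy's continuity theorem with no candidate limit given. Continuity at 0 gives tightness,
Prokhorov gives a limit along an ultrafilter, its characteristic function must be f, and so the
whole sequence converges. -/
theorem exists_tendsto_of_tendsto_charFun {μs : ℕ → ProbabilityMeasure ℝ} {f : ℝ → ℂ}
    (hf : ContinuousAt f 0)
    (h : ∀ u, Tendsto (fun n => charFun (μs n : Measure ℝ) u) atTop (𝓝 (f u))) :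
    ∃ μ : ProbabilityMeasure ℝ, Tendsto μs atTop (𝓝 μ) := by
  have htight : IsTightMeasureSet (Set.range fun n => (μs n : Measure ℝ)) :=
    isTightMeasureSet_of_tendsto_charFun hf h
  have hcomp : IsCompact (closure (Set.range μs)) := by
    refine isCompact_closure_of_isTightMeasureSet ?_
    have : {((μ : ProbabilityMeasure ℝ) : Measure ℝ) | μ ∈ Set.range μs} =
        Set.range fun n => (μs n : Measure ℝ) := by
      ext ρ; simp
    rw [this]; exact htight
  obtain ⟨μ, -, hμ⟩ := hcomp.ultrafilter_le_nhds ((hyperfilter ℕ).map μs)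
    (.trans (by simp) (monotone_principal subset_closure))
  have hμ' : Tendsto μs (hyperfilter ℕ) (𝓝 μ) := hμ
  refine ⟨μ, ProbabilityMeasure.tendsto_iff_tendsto_charFun.2 fun u => ?_⟩
  have : charFun (μ : Measure ℝ) u = f u := by
    refine tendsto_nhds_unique ?_ ((h u).mono_left (Nat.hyperfilter_le_atTop))
    rw [ProbabilityMeasure.tendsto_iff_forall_integral_rclike_tendsto ℂ] at hμ'
    simp_rw [charFun_eq_integral_innerProbChar]
    exact hμ' (BoundedContinuousFunction.innerProbChar u)
  rw [this]
  exact h u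

/-- The exponent b t^α is homogeneous under positive scaling, so independent scaled copies add in
the exponent and no shift is needed. A point mass would make b r^α linear in r, which r = 1 and r =
2 refute. -/
theorem isStableLaw_of_integral_cexp {α b : ℝ} (hα : 1 < α) (hb : b ≠ 0)
    {X : ProbabilityMeasure ℝ}
    (h : ∀ t : ℂ, 0 ≤ t.re → ∫ x : ℝ, Complex.exp (-(t * x)) ∂(X : Measure ℝ) =
      Complex.exp ((b : ℂ) * t ^ (α : ℂ))) : IsStableLaw α (X : Measure ℝ) := by
  have hchar : ∀ u : ℝ, charFun (X : Measure ℝ) u =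
      Complex.exp ((b : ℂ) * (-(u * Complex.I)) ^ (α : ℂ)) := by
    intro u
    rw [charFun_apply_real, ← h _ (by simp)]
    refine integral_congr_ae (ae_of_all _ fun x => ?_)
    simp only
    ring_nf
  refine ⟨fun x hx => ?_, fun a d ha hd => ⟨0, ?_⟩⟩
  · have hr : ∀ r : ℝ, 0 ≤ r → -(r * x) = b * r ^ α := by
      intro r hr0
      have := h r (by simpa using hr0)
      rw [hx, integral_dirac, ← Complex.ofReal_cpow hr0] at this
      refine Real.exp_injective ?_
      exact_mod_cast this
    have h1 := hr 1 zero_le_one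
    have h2 := hr 2 zero_le_two
    rw [Real.one_rpow] at h1
    have h3 : b * (2 : ℝ) ^ α = b * 2 := by linarith
    have h4 := mul_left_cancel₀ hb h3
    have h5 : (2 : ℝ) ^ (1 : ℝ) < 2 ^ α := Real.rpow_lt_rpow_of_exponent_lt one_lt_two hα
    rw [Real.rpow_one] at h5
    linarith
  · have hs : 0 < a ^ α + d ^ α := by positivity
    have hscale : ∀ (q u : ℝ), 0 < q →
        (-(((q * u : ℝ) : ℂ) * Complex.I)) ^ (α : ℂ) =
          ((q ^ α : ℝ) : ℂ) * (-((u : ℂ) * Complex.I)) ^ (α : ℂ) := by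
      intro q u hq
      rw [show -(((q * u : ℝ) : ℂ) * Complex.I) = (q : ℂ) * (-((u : ℂ) * Complex.I)) by
        push_cast; ring]
      have hqC : (q : ℂ) ≠ 0 := by exact_mod_cast hq.ne'
      have hα0 : (α : ℂ) ≠ 0 := by exact_mod_cast (by linarith : α ≠ 0)
      rcases eq_or_ne (-((u : ℂ) * Complex.I)) 0 with hz | hz
      · rw [hz, mul_zero, Complex.zero_cpow hα0, mul_zero]
      · rw [Complex.cpow_def_of_ne_zero (mul_ne_zero hqC hz), Complex.log_ofReal_mul hq hz,
          add_mul, Complex.exp_add, Complex.cpow_def_of_ne_zero hz, Complex.ofReal_cpow hq.le,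
          Complex.cpow_def_of_ne_zero hqC, Complex.ofReal_log hq.le]
    have hprod : ((X : Measure ℝ).prod X).map (fun p : ℝ × ℝ => a * p.1 + d * p.2) =
        (((X : Measure ℝ).map (a * ·)).prod ((X : Measure ℝ).map (d * ·))).map
          (fun p => p.1 + p.2) := by
      rw [Measure.map_prod_map _ _ (by fun_prop) (by fun_prop),
        Measure.map_map (by fun_prop) (by fun_prop)]
      rfl
    have : IsProbabilityMeasure ((X : Measure ℝ).map (a * ·)) :=
      Measure.isProbabilityMeasure_map (by fun_prop)
    have : IsProbabilityMeasure ((X : Measure ℝ).map (d * ·)) :=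
      Measure.isProbabilityMeasure_map (by fun_prop)
    simp only [add_zero]
    refine Measure.ext_of_charFun ?_
    rw [hprod, charFun_map_add_prod_eq_mul]
    ext u
    rw [Pi.mul_apply, charFun_map_mul, charFun_map_mul, charFun_map_mul, hchar, hchar, hchar,
      ← Complex.exp_add, hscale a u ha, hscale d u hd,
      hscale _ u (Real.rpow_pos_of_pos hs _), ← Real.rpow_mul hs.le,
      one_div_mul_cancel (by linarith), Real.rpow_one]
    congr 1
    push_cast
    ring

theorem exists_stable_limit {P : Measure ℕ} [IsProbabilityMeasure P] {c β : ℝ} (hc : 0 < c)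
    (hβ : 2 < β) (hβ3 : β < 3)
    (h : (fun k => P.real {k}) ~[atTop] fun k : ℕ => c * (k : ℝ) ^ (-β)) :
    ∃ X : ProbabilityMeasure ℝ, IsStableLaw (β - 1) (X : Measure ℝ) ∧
      (∀ t : ℂ, 0 ≤ t.re →
        Integrable (fun x : ℝ => Complex.exp (-(t * (x : ℂ)))) (X : Measure ℝ) ∧
        ∫ x : ℝ, Complex.exp (-(t * (x : ℂ))) ∂(X : Measure ℝ) =
          Complex.exp (c * Real.Gamma (-(β - 1)) * t ^ ((β - 1 : ℝ) : ℂ))) ∧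
      Tendsto (normalizedSumLaw P β) atTop (𝓝 X) := by
  let f : ℂ → ℂ := fun t => Complex.exp (c * Real.Gamma (-(β - 1)) * t ^ ((β - 1 : ℝ) : ℂ))
  have hlim := fun (t : ℂ) (ht : 0 ≤ t.re) => tendsto_integral_cexp_normalizedSumLaw hβ hβ3 h ht
  have hchar : ∀ u : ℝ, Tendsto (fun n => charFun (normalizedSumLaw P β n : Measure ℝ) u) atTop
      (𝓝 (f (-(u * Complex.I)))) := by
    intro u
    refine (hlim (-(u * Complex.I)) (by simp)).congr fun n => ?_
    rw [charFun_apply_real]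
    refine integral_congr_ae (ae_of_all _ fun x => ?_)
    simp only
    ring_nf
  have hcont : ContinuousAt (fun u : ℝ => f (-(u * Complex.I))) 0 := by
    have h1 : ContinuousAt (fun z : ℂ => z ^ ((β - 1 : ℝ) : ℂ)) (-(((0 : ℝ) : ℂ) * Complex.I)) :=
      Complex.continuousAt_cpow_const_of_re_pos (Or.inl (by simp))
        (by rw [Complex.ofReal_re]; linarith)
    have h2 : ContinuousAt (fun u : ℝ => -((u : ℂ) * Complex.I)) 0 := by fun_prop
    have h3 := ContinuousAt.comp (f := fun u : ℝ => -((u : ℂ) * Complex.I)) h1 h2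
    exact Complex.continuous_exp.continuousAt.comp (h3.const_mul _)
  obtain ⟨X, hX⟩ := exists_tendsto_of_tendsto_charFun hcont hchar
  have hLap := fun (t : ℂ) (ht : 0 ≤ t.re) => integral_cexp_of_tendsto hX (f := f)
    (fun n t ht => integrable_cexp_normalizedSumLaw β n ht) hlim ht
  refine ⟨X, ?_, hLap, hX⟩
  -- The argument lies strictly between -2 and -1, hence is not a pole, where `Real.Gamma` takes the
  -- value 0.
  have hΓ : Real.Gamma (-(β - 1)) ≠ 0 := by
    refine Real.Gamma_ne_zero fun m hm => ?_
    have h1 : (1 : ℝ) < m := by linarith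
    have h2 : (m : ℝ) < 2 := by linarith
    norm_cast at h1 h2
    omega
  refine isStableLaw_of_integral_cexp (b := c * Real.Gamma (-(β - 1))) (by linarith)
    (mul_ne_zero hc.ne' hΓ) fun t ht => ?_
  rw [(hLap t ht).2]
  simp only [f]
  push_cast
  rfl

end StableLaw

/-! ### Limit laws of the order statistics -/

section OrderLimit

/-- Half-open intervals with endpoints in D form a π-system containing arbitrarily small
neighbourhoods of every point, and their measures are differences of distribution functions. -/
theorem tendsto_of_tendsto_measureReal_Iic {μs : ℕ → ProbabilityMeasure ℝ}
    {μ : ProbabilityMeasure ℝ} {D : Set ℝ} (hD : Dense D)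
    (h : ∀ x ∈ D, Tendsto (fun n => (μs n : Measure ℝ).real (Set.Iic x)) atTop
      (𝓝 ((μ : Measure ℝ).real (Set.Iic x)))) : Tendsto μs atTop (𝓝 μ) := by
  let S : Set (Set ℝ) := {s | ∃ a ∈ D, ∃ b ∈ D, a < b ∧ s = Set.Ioc a b}
  have hS : IsPiSystem S := by
    rintro - ⟨a, ha, b, hb, hab, rfl⟩ - ⟨a', ha', b', hb', hab', rfl⟩ hne
    rw [Set.Ioc_inter_Ioc] at hne ⊢
    refine ⟨a ⊔ a', ?_, b ⊓ b', ?_, Set.nonempty_Ioc.1 hne, rfl⟩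
    · rcases le_total a a' with hle | hle
      · rwa [sup_eq_right.2 hle]
      · rwa [sup_eq_left.2 hle]
    · rcases le_total b b' with hle | hle
      · rwa [inf_eq_left.2 hle]
      · rwa [inf_eq_right.2 hle]
  have hIoc : ∀ (ρ : ProbabilityMeasure ℝ) (a b : ℝ), a ≤ b → (ρ : Measure ℝ).real (Set.Ioc a b) =
      (ρ : Measure ℝ).real (Set.Iic b) - (ρ : Measure ℝ).real (Set.Iic a) := by
    intro ρ a b hab
    rw [← Set.Iic_sdiff_Iic, measureReal_sdiff (Set.Iic_subset_Iic.2 hab) measurableSet_Iic]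
  refine hS.tendsto_probabilityMeasure_of_tendsto_of_mem ?_ ?_ ?_
  · rintro - ⟨a, -, b, -, -, rfl⟩
    exact measurableSet_Ioc
  · intro u hu x hx
    obtain ⟨ε, hε, hball⟩ := Metric.isOpen_iff.1 hu x hx
    obtain ⟨a, ha, ha1, ha2⟩ := hD.exists_between (show x - ε < x by linarith)
    obtain ⟨b, hb, hb1, hb2⟩ := hD.exists_between (show x < x + ε by linarith)
    refine ⟨Set.Ioc a b, ⟨a, ha, b, hb, ha2.trans hb1, rfl⟩, Ioc_mem_nhds ha2 hb1,
      fun y hy => hball ?_⟩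
    rw [Real.ball_eq_Ioo]
    exact ⟨ha1.trans hy.1, hy.2.trans_lt hb2⟩
  · rintro - ⟨a, ha, b, hb, hab, rfl⟩
    have := (h b hb).sub (h a ha)
    simp only [← hIoc _ a b hab.le] at this
    exact NNReal.tendsto_coe.1 this

variable {c α : ℝ}

theorem hasDerivAt_const_mul_rpow_neg (hα : 0 < α) {x : ℝ} (hx : 0 < x) :
    HasDerivAt (fun x : ℝ => c * α⁻¹ * x ^ (-α)) (-(c * x ^ (-α - 1))) x := by
  refine ((Real.hasDerivAt_rpow_const (p := -α) (Or.inl hx.ne')).const_mul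
    (c * α⁻¹)).congr_deriv ?_
  field_simp

theorem injOn_const_mul_rpow_neg (hc : 0 < c) (hα : 0 < α) :
    Set.InjOn (fun x : ℝ => c * α⁻¹ * x ^ (-α)) (Set.Ioi 0) := by
  intro x hx y hy hxy
  have h1 : x ^ (-α) = y ^ (-α) := mul_left_cancel₀ (by positivity) hxy
  exact (Real.rpow_left_inj (le_of_lt hx) (le_of_lt hy) (by linarith)).1 h1

theorem image_const_mul_rpow_neg (hc : 0 < c) (hα : 0 < α) (S : Set ℝ) :
    (fun x : ℝ => c * α⁻¹ * x ^ (-α)) '' (Set.Ioi 0 ∩ (fun x : ℝ => c * α⁻¹ * x ^ (-α)) ⁻¹' S) =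
      Set.Ioi 0 ∩ S := by
  ext y
  constructor
  · rintro ⟨x, ⟨hx, hxS⟩, rfl⟩
    have hx0 : (0 : ℝ) < x := hx
    exact ⟨show 0 < c * α⁻¹ * x ^ (-α) by positivity, hxS⟩
  · rintro ⟨hy, hyS⟩
    have hy0 : (0 : ℝ) < y := hy
    have hp : 0 < y / (c * α⁻¹) := by positivity
    have he : c * α⁻¹ * ((y / (c * α⁻¹)) ^ (-α)⁻¹) ^ (-α) = y := by
      rw [Real.rpow_inv_rpow hp.le (by linarith), mul_div_cancel₀ _ (by positivity)]
    refine ⟨(y / (c * α⁻¹)) ^ (-α)⁻¹, ⟨Real.rpow_pos_of_pos hp _, ?_⟩, he⟩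
    rw [Set.mem_preimage, he]
    exact hyS

theorem lintegral_densityW_inter (c α : ℝ) (j : ℕ) {S : Set ℝ} (hS : MeasurableSet S) :
    ∫⁻ x in S, ENNReal.ofReal (densityW c α j x) =
      ∫⁻ x in Set.Ioi 0 ∩ S, ENNReal.ofReal (densityW c α j x) := by
  rw [← lintegral_indicator hS, ← lintegral_indicator (measurableSet_Ioi.inter hS)]
  congr 1
  ext x
  by_cases hx : 0 < x
  · by_cases hxS : x ∈ S
    · rw [Set.indicator_of_mem hxS, Set.indicator_of_mem (show x ∈ Set.Ioi 0 ∩ S from ⟨hx, hxS⟩)]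
    · rw [Set.indicator_of_notMem hxS, Set.indicator_of_notMem fun h => hxS h.2]
  · rw [Set.indicator_of_notMem (s := Set.Ioi 0 ∩ S) fun h => hx h.1]
    by_cases hxS : x ∈ S
    · rw [Set.indicator_of_mem hxS, densityW, if_neg hx, ENNReal.ofReal_zero]
    · rw [Set.indicator_of_notMem hxS]

/-- Change of variables u = (c/α) x^(-α), a bijection of (0, ∞) whose Jacobian c x^(-α-1) is the
first factor of the density. It also shows that the density has total mass 1. -/
theorem map_withDensity_densityW (hc : 0 < c) (hα : 0 < α) {j : ℕ} (hj : 2 ≤ j) :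
    (volume.withDensity fun x => ENNReal.ofReal (densityW c α j x)).map
      (fun x => c * α⁻¹ * x ^ (-α)) = gammaMeasure ((j : ℝ) - 1) 1 := by
  have hfm : Measurable fun x : ℝ => c * α⁻¹ * x ^ (-α) := by fun_prop
  ext S hS
  have hpre := hfm hS
  have hmeas := measurableSet_Ioi (a := (0 : ℝ)).inter hpre
  rw [Measure.map_apply hfm hS, withDensity_apply _ hpre, lintegral_densityW_inter c α j hpre,
    gammaMeasure, withDensity_apply _ hS]
  have hgam : ∫⁻ x in S, gammaPDF ((j : ℝ) - 1) 1 x =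
      ∫⁻ x in Set.Ioi 0 ∩ S, gammaPDF ((j : ℝ) - 1) 1 x := by
    rw [← lintegral_indicator hS, ← lintegral_indicator (measurableSet_Ioi.inter hS)]
    refine lintegral_congr_ae ?_
    have h0 : ∀ᵐ x : ℝ, x ≠ 0 := Measure.ae_ne volume 0
    filter_upwards [h0] with x hx
    rcases lt_or_gt_of_ne hx with hx | hx
    · rw [Set.indicator_of_notMem (s := Set.Ioi 0 ∩ S) fun h => (not_lt.2 hx.le) h.1]
      by_cases hxS : x ∈ S
      · rw [Set.indicator_of_mem hxS, gammaPDF_of_neg hx]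
      · rw [Set.indicator_of_notMem hxS]
    · by_cases hxS : x ∈ S
      · rw [Set.indicator_of_mem hxS, Set.indicator_of_mem (show x ∈ Set.Ioi 0 ∩ S from ⟨hx, hxS⟩)]
      · rw [Set.indicator_of_notMem hxS, Set.indicator_of_notMem fun h => hxS h.2]
  rw [hgam, ← image_const_mul_rpow_neg hc hα S, lintegral_image_eq_lintegral_abs_deriv_mul hmeas
    (fun x hx => (hasDerivAt_const_mul_rpow_neg hα hx.1).hasDerivWithinAt)
    ((injOn_const_mul_rpow_neg hc hα).mono Set.inter_subset_left)]
  refine setLIntegral_congr_fun hmeas fun x hx => ?_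
  have hx0 : (0 : ℝ) < x := hx.1
  have hu : 0 ≤ c * α⁻¹ * x ^ (-α) := by positivity
  obtain ⟨k, rfl⟩ : ∃ k, j = k + 2 := ⟨j - 2, by omega⟩
  have e1 : ((k + 2 : ℕ) : ℝ) - 1 = k + 1 := by push_cast; ring
  rw [gammaPDF_of_nonneg hu, ← ENNReal.ofReal_mul (abs_nonneg _), abs_neg,
    abs_of_nonneg (by positivity), densityW, if_pos hx0, e1, Real.Gamma_nat_eq_factorial,
    Real.one_rpow, add_sub_cancel_right, Real.rpow_natCast, Nat.add_sub_cancel]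
  congr 1
  ring_nf

theorem isProbabilityMeasure_densityW (hc : 0 < c) (hα : 0 < α) {j : ℕ} (hj : 2 ≤ j) :
    IsProbabilityMeasure (volume.withDensity fun x => ENNReal.ofReal (densityW c α j x)) := by
  have hfm : Measurable fun x : ℝ => c * α⁻¹ * x ^ (-α) := by fun_prop
  have hj' : (2 : ℝ) ≤ j := by exact_mod_cast hj
  have := isProbabilityMeasure_gammaMeasure (a := (j : ℝ) - 1) (r := 1) (by linarith) one_pos
  refine ⟨?_⟩
  rw [← Set.preimage_univ (f := fun x : ℝ => c * α⁻¹ * x ^ (-α)),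
    ← Measure.map_apply hfm MeasurableSet.univ, map_withDensity_densityW hc hα hj, measure_univ]

/-- Differentiating the Poisson sum telescopes to its last term. This makes `densityW` the
derivative of `limitCdf`. -/
theorem hasDerivAt_sum_exp_neg_mul_pow (k : ℕ) (u : ℝ) :
    HasDerivAt (fun u : ℝ => ∑ i ∈ Finset.range (k + 1), Real.exp (-u) * u ^ i / (i.factorial : ℝ))
      (-(Real.exp (-u) * u ^ k / (k.factorial : ℝ))) u := by
  have hexp : HasDerivAt (fun u : ℝ => Real.exp (-u)) (-Real.exp (-u)) u := by
    simpa using (hasDerivAt_neg u).exp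
  induction k with
  | zero => simpa using hexp
  | succ k ih =>
    have h1 := ih.add ((hexp.mul (hasDerivAt_pow (k + 1) u)).div_const ((k + 1).factorial : ℝ))
    have h2 : (fun u : ℝ => ∑ i ∈ Finset.range (k + 1 + 1),
        Real.exp (-u) * u ^ i / (i.factorial : ℝ)) = (fun u : ℝ => ∑ i ∈ Finset.range (k + 1),
        Real.exp (-u) * u ^ i / (i.factorial : ℝ)) +
        fun u => Real.exp (-u) * u ^ (k + 1) / ((k + 1).factorial : ℝ) := by
      ext v
      rw [Finset.sum_range_succ]
      rfl
    rw [h2]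
    refine h1.congr_deriv ?_
    rw [Nat.factorial_succ, Nat.add_sub_cancel]
    have : (k.factorial : ℝ) ≠ 0 := by positivity
    have : ((k : ℝ) + 1) ≠ 0 := by positivity
    push_cast
    field_simp
    ring

theorem measureReal_densityW_Ioi (hc : 0 < c) (hα : 0 < α) {j : ℕ} (hj : 2 ≤ j) {x : ℝ}
    (hx : 0 < x) :
    (volume.withDensity fun x => ENNReal.ofReal (densityW c α j x)).real (Set.Ioi x) =
      1 - limitCdf c α (j - 1) x := by
  obtain ⟨k, rfl⟩ : ∃ k, j = k + 2 := ⟨j - 2, by omega⟩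
  have hdiv : ∀ y : ℝ, c / α * y ^ (-α) = c * α⁻¹ * y ^ (-α) := fun y => by
    rw [div_eq_mul_inv]
  have hder : ∀ y ∈ Set.Ici x, HasDerivAt (limitCdf c α (k + 1)) (densityW c α (k + 2) y) y := by
    intro y hy
    have hy0 : 0 < y := hx.trans_le hy
    have h1 := (hasDerivAt_sum_exp_neg_mul_pow k (c * α⁻¹ * y ^ (-α))).comp y
      (hasDerivAt_const_mul_rpow_neg hα hy0)
    have h2 : limitCdf c α (k + 1) = (fun u : ℝ => ∑ i ∈ Finset.range (k + 1),
        Real.exp (-u) * u ^ i / (i.factorial : ℝ)) ∘ fun y : ℝ => c * α⁻¹ * y ^ (-α) := by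
      ext v
      simp only [limitCdf, Function.comp, hdiv]
    rw [h2]
    refine h1.congr_deriv ?_
    rw [densityW, if_pos hy0, Nat.add_sub_cancel]
    ring
  have hnn : ∀ y ∈ Set.Ioi x, 0 ≤ densityW c α (k + 2) y := by
    intro y hy
    have hy0 : 0 < y := hx.trans hy
    rw [densityW, if_pos hy0]
    positivity
  have hlim : Tendsto (limitCdf c α (k + 1)) atTop (𝓝 1) := by
    have h1 : Tendsto (fun y : ℝ => c / α * y ^ (-α)) atTop (𝓝 0) := by
      simpa using (tendsto_rpow_neg_atTop hα).const_mul (c / α)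
    have hc : Continuous fun u : ℝ => ∑ i ∈ Finset.range (k + 1),
        Real.exp (-u) * u ^ i / (i.factorial : ℝ) := by fun_prop
    have h2 := (hc.tendsto 0).comp h1
    have h3 : ∑ i ∈ Finset.range (k + 1), Real.exp (-0) * (0 : ℝ) ^ i / (i.factorial : ℝ) = 1 := by
      rw [Finset.sum_range_succ']
      simp
    rw [h3] at h2
    exact h2
  have hint := integral_Ioi_of_hasDerivAt_of_nonneg' hder hnn hlim
  have hion := integrableOn_Ioi_deriv_of_nonneg' hder hnn hlim
  rw [measureReal_def, withDensity_apply _ measurableSet_Ioi,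
    ← ofReal_integral_eq_lintegral_ofReal hion
      ((ae_restrict_iff' measurableSet_Ioi).2 (ae_of_all _ hnn)),
    ENNReal.toReal_ofReal (setIntegral_nonneg measurableSet_Ioi hnn), hint]
  rfl

theorem measureReal_densityW_Iic (hc : 0 < c) (hα : 0 < α) {j : ℕ} (hj : 2 ≤ j) (x : ℝ) :
    (volume.withDensity fun x => ENNReal.ofReal (densityW c α j x)).real (Set.Iic x) =
      if 0 < x then limitCdf c α (j - 1) x else 0 := by
  split_ifs with hx
  · have := isProbabilityMeasure_densityW hc hα hj
    rw [← Set.compl_Ioi, probReal_compl_eq_one_sub measurableSet_Ioi,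
      measureReal_densityW_Ioi hc hα hj hx]
    ring
  · rw [measureReal_def, withDensity_apply _ measurableSet_Iic,
      lintegral_densityW_inter c α j measurableSet_Iic]
    have : Set.Ioi 0 ∩ Set.Iic x = ∅ := by
      ext y
      simp only [Set.mem_inter_iff, Set.mem_Ioi, Set.mem_Iic, Set.mem_empty_iff_false, iff_false,
        not_and, not_le]
      intro hy
      linarith
    rw [this]
    simp

/-- The law of `n^(-1/(β-1)) x_(k)` for `n - 1` independent variables `xᵢ` with law `P`. -/
noncomputable def normalizedOrderedLaw (P : Measure ℕ) [IsProbabilityMeasure P] (β : ℝ) (k n : ℕ) :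
    ProbabilityMeasure ℝ :=
  ⟨(Measure.pi fun _ : Fin (n - 1) => P).map fun x =>
    (n : ℝ) ^ (-(1 / (β - 1))) * (ordered x k : ℝ),
    Measure.isProbabilityMeasure_map Measurable.of_discrete.aemeasurable⟩

theorem exists_tendsto_normalizedOrderedLaw {P : Measure ℕ} [IsProbabilityMeasure P] {β : ℝ}
    (hc : 0 < c) (hβ : 2 < β)
    (h : (fun k => P.real {k}) ~[atTop] fun k : ℕ => c * (k : ℝ) ^ (-β)) {j : ℕ} (hj : 2 ≤ j) :
    ∃ W : ProbabilityMeasure ℝ, (W : Measure ℝ) =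
        volume.withDensity (fun x => ENNReal.ofReal (densityW c (β - 1) j x)) ∧
      Tendsto (normalizedOrderedLaw P β (j - 1)) atTop (𝓝 W) := by
  have hα : 0 < β - 1 := by linarith
  refine ⟨⟨_, isProbabilityMeasure_densityW hc hα hj⟩, rfl,
    -- Leaving out x = 0 avoids bounding the probability that the order statistic vanishes; for x <
    -- 0 both sides are 0.
    tendsto_of_tendsto_measureReal_Iic (dense_compl_singleton (0 : ℝ)) fun x hx => ?_⟩
  have hl : ∀ n, (normalizedOrderedLaw P β (j - 1) n : Measure ℝ).real (Set.Iic x) =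
      (Measure.pi fun _ : Fin (n - 1) => P).real
        {v | (n : ℝ) ^ (-(1 / (β - 1))) * (ordered v (j - 1) : ℝ) ≤ x} := fun n => by
    rw [normalizedOrderedLaw, ProbabilityMeasure.coe_mk,
      map_measureReal_apply Measurable.of_discrete measurableSet_Iic]
    rfl
  simp only [hl]
  rw [ProbabilityMeasure.coe_mk, measureReal_densityW_Iic hc hα hj]
  split_ifs with hx0
  · exact tendsto_measureReal_ordered_le hβ h (by omega) hx0
  · have hneg : x < 0 := lt_of_le_of_ne (not_lt.1 hx0) hx
    refine tendsto_const_nhds.congr fun n => ?_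
    have : {v : Fin (n - 1) → ℕ | (n : ℝ) ^ (-(1 / (β - 1))) * (ordered v (j - 1) : ℝ) ≤ x} = ∅ := by
      ext v
      simp only [Set.mem_ofPred_eq, Set.mem_empty_iff_false, iff_false, not_le]
      exact hneg.trans_le (by positivity)
    rw [this, measureReal_empty]

end OrderLimit

/-! ### From weights to the canonical distribution -/

section Weights

variable {w : ℕ → ℝ} {c β : ℝ}

theorem eventually_weight_pos (hc : 0 < c)
    (hwc : w ~[atTop] fun k : ℕ => c * (k : ℝ) ^ (-β)) : ∀ᶠ k in atTop, 0 < w k := by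
  obtain ⟨u, hu, hwu⟩ := hwc.exists_eq_mul
  filter_upwards [hwu, hu.eventually (lt_mem_nhds one_pos), eventually_ge_atTop 1] with k hk hk1 hk2
  have : (0 : ℝ) < k := by exact_mod_cast hk2
  rw [hk, Pi.mul_apply]
  positivity

/-- Roots of order k of constants and of powers of k tend to 1. -/
theorem radius_eq_one (hc : 0 < c) (hwc : w ~[atTop] fun k : ℕ => c * (k : ℝ) ^ (-β)) :
    radius w = 1 := by
  obtain ⟨u, hu, hwu⟩ := hwc.exists_eq_mul
  have hinv : Tendsto (fun k : ℕ => 1 / (k : ℝ)) atTop (𝓝 0) := tendsto_one_div_atTop_nhds_zero_nat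
  have h1 : Tendsto (fun k : ℕ => (u k * c) ^ (1 / (k : ℝ))) atTop (𝓝 1) := by
    have := (hu.mul_const c).rpow hinv (Or.inl (by rw [one_mul]; exact hc.ne'))
    rwa [Real.rpow_zero] at this
  have h2 : Tendsto (fun k : ℕ => ((k : ℝ) ^ (1 / (k : ℝ))) ^ (-β)) atTop (𝓝 1) := by
    have := (tendsto_rpow_div.comp tendsto_natCast_atTop_atTop).rpow_const (p := -β)
      (Or.inl one_ne_zero)
    rwa [Real.one_rpow] at this
  have h3 := h1.mul h2
  rw [one_mul] at h3
  have h4 : Tendsto (fun k : ℕ => ENNReal.ofReal (w k) ^ (1 / (k : ℝ))) atTop (𝓝 1) := by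
    have := ENNReal.tendsto_ofReal h3
    rw [ENNReal.ofReal_one] at this
    refine this.congr' ?_
    filter_upwards [hwu, hu.eventually (lt_mem_nhds one_pos), eventually_ge_atTop 1,
      eventually_weight_pos hc hwc] with k hk hk1 hk2 hk3
    have hk0 : (0 : ℝ) < k := by exact_mod_cast hk2
    rw [ENNReal.ofReal_rpow_of_pos hk3, hk, Pi.mul_apply, ← mul_assoc,
      Real.mul_rpow (x := u k * c) (by positivity) (by positivity), ← Real.rpow_mul hk0.le, ← Real.rpow_mul hk0.le,
      mul_comm (-β)]
  rw [radius, h4.limsup_eq, inv_one]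

theorem summable_weight_mul_rpow (hw : ∀ k, 0 ≤ w k)
    (hwc : w ~[atTop] fun k : ℕ => c * (k : ℝ) ^ (-β)) {γ : ℝ} (hγ : γ < β - 1) :
    Summable fun k : ℕ => (k : ℝ) ^ γ * w k := by
  obtain ⟨C, -, hle⟩ := exists_le_rpow hw hwc
  have hs : Summable fun k : ℕ => C * (k : ℝ) ^ (γ - β) :=
    (Real.summable_nat_rpow.2 (by linarith)).mul_left C
  rw [← summable_nat_add_iff 1] at hs ⊢
  refine Summable.of_nonneg_of_le (fun k => mul_nonneg (by positivity) (hw _)) (fun k => ?_) hs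
  have hk : (0 : ℝ) < ((k + 1 : ℕ) : ℝ) := by positivity
  calc _ ≤ ((k + 1 : ℕ) : ℝ) ^ γ * (C * ((k + 1 : ℕ) : ℝ) ^ (-β)) := by
        gcongr; exact hle _ (by omega)
    _ = C * ((k + 1 : ℕ) : ℝ) ^ (γ - β) := by
        rw [sub_eq_add_neg, Real.rpow_add hk]; ring

theorem Phi_one_eq (w : ℕ → ℝ) : Phi w 1 = ∑' k : ℕ, ENNReal.ofReal (w k) := by
  simp [Phi]

theorem Phi_one_ne_top (hβ : 2 < β) (hw : ∀ k, 0 ≤ w k)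
    (hwc : w ~[atTop] fun k : ℕ => c * (k : ℝ) ^ (-β)) : Phi w 1 ≠ ⊤ := by
  have hs := summable_weight_mul_rpow hw hwc (γ := 0) (by linarith)
  simp only [Real.rpow_zero, one_mul] at hs
  rw [Phi_one_eq, ← ENNReal.ofReal_tsum_of_nonneg hw hs]
  exact ENNReal.ofReal_ne_top

theorem Phi_one_ne_zero (hc : 0 < c) (hwc : w ~[atTop] fun k : ℕ => c * (k : ℝ) ^ (-β)) :
    Phi w 1 ≠ 0 := by
  obtain ⟨k, hk⟩ := (eventually_weight_pos hc hwc).exists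
  rw [Phi_one_eq]
  intro h0
  have := ENNReal.tsum_eq_zero.1 h0 k
  rw [ENNReal.ofReal_eq_zero] at this
  linarith

theorem canonical_singleton (hc : 0 < c) (hβ : 2 < β) (hw : ∀ k, 0 ≤ w k)
    (hwc : w ~[atTop] fun k : ℕ => c * (k : ℝ) ^ (-β)) (k : ℕ) :
    canonical w {k} = ENNReal.ofReal (w k) * (Phi w 1)⁻¹ := by
  have hr := radius_eq_one hc hwc
  have hf : ∑' k : ℕ, ENNReal.ofReal (w k) * radius w ^ k = Phi w 1 := by rw [hr, Phi]
  rw [canonical, proportional, dif_pos ⟨by rw [hf]; exact Phi_one_ne_zero hc hwc,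
    by rw [hf]; exact Phi_one_ne_top hβ hw hwc⟩,
    PMF.toMeasure_apply_singleton _ _ (measurableSet_singleton k), PMF.normalize_apply, hf, hr,
    one_pow, mul_one]

theorem canonical_real_singleton (hc : 0 < c) (hβ : 2 < β) (hw : ∀ k, 0 ≤ w k)
    (hwc : w ~[atTop] fun k : ℕ => c * (k : ℝ) ^ (-β)) (k : ℕ) :
    (canonical w).real {k} = w k / (Phi w 1).toReal := by
  rw [measureReal_def, canonical_singleton hc hβ hw hwc, ENNReal.toReal_mul,
    ENNReal.toReal_ofReal (hw k), ENNReal.toReal_inv, div_eq_mul_inv]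

theorem canonical_isEquivalent (hc : 0 < c) (hβ : 2 < β) (hw : ∀ k, 0 ≤ w k)
    (hwc : w ~[atTop] fun k : ℕ => c * (k : ℝ) ^ (-β)) :
    (fun k => (canonical w).real {k}) ~[atTop]
      fun k : ℕ => c / (Phi w 1).toReal * (k : ℝ) ^ (-β) := by
  have h := hwc.mul (IsEquivalent.refl (u := fun _ : ℕ => ((Phi w 1).toReal)⁻¹))
  refine (h.congr_left (Eventually.of_forall fun k => ?_)).congr_right
    (Eventually.of_forall fun k => ?_)
  · simp only [Pi.mul_apply, canonical_real_singleton hc hβ hw hwc, div_eq_mul_inv]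
  · simp only [Pi.mul_apply, div_eq_mul_inv]
    ring

/-- As Φ(1) is finite, the quotient branch of `nu` applies, and it is the mean of the canonical law.
-/
theorem nu_eq (hc : 0 < c) (hβ : 2 < β) (hw : ∀ k, 0 ≤ w k)
    (hwc : w ~[atTop] fun k : ℕ => c * (k : ℝ) ^ (-β)) :
    nu w = ENNReal.ofReal (∫ k : ℕ, (k : ℝ) ∂canonical w) := by
  have hint : Integrable (fun k : ℕ => (k : ℝ)) (canonical w) := by
    simpa using integrable_rpow (γ := 1) (canonical_isEquivalent hc hβ hw hwc) (by linarith)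
  rw [nu, radius_eq_one hc hwc, if_pos (Phi_one_ne_top hβ hw hwc).lt_top, Psi,
    ofReal_integral_eq_lintegral_ofReal hint (ae_of_all _ fun k => Nat.cast_nonneg k),
    lintegral_countable', div_eq_mul_inv, ← ENNReal.tsum_mul_right]
  congr 1
  ext k
  rw [canonical_singleton hc hβ hw hwc, ENNReal.ofReal_natCast, one_pow, mul_one, mul_assoc]

variable (w) in
/-- The unnormalized weight of an allocation `y` of `m` balls. -/
noncomputable def allocationWeight (m n : ℕ) (y : Fin n → ℕ) : ℝ≥0∞ :=
  if ∑ i, y i = m then ENNReal.ofReal (∏ i, w (y i)) else 0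

theorem tsum_allocationWeight (hw : ∀ k, 0 ≤ w k) (m n : ℕ) :
    ∑' y, allocationWeight w m n y = ENNReal.ofReal (Z w m n) := by
  rw [Z, ENNReal.ofReal_sum_of_nonneg fun y _ => Finset.prod_nonneg fun i _ => hw _,
    tsum_eq_sum (s := Finset.Nat.antidiagonalTuple n m) fun y hy => ?_]
  · refine Finset.sum_congr rfl fun y hy => ?_
    rw [allocationWeight, if_pos (Finset.Nat.mem_antidiagonalTuple.1 hy)]
  · rw [Finset.Nat.mem_antidiagonalTuple] at hy
    rw [allocationWeight, if_neg hy]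

theorem pi_canonical_inter_singleton (hc : 0 < c) (hβ : 2 < β) (hw : ∀ k, 0 ≤ w k)
    (hwc : w ~[atTop] fun k : ℕ => c * (k : ℝ) ^ (-β)) (m n : ℕ) (y : Fin n → ℕ) :
    (Measure.pi fun _ : Fin n => canonical w) ({y | ∑ l, y l = m} ∩ {y}) =
      allocationWeight w m n y * (Phi w 1)⁻¹ ^ n := by
  rw [allocationWeight]
  split_ifs with hy
  · have h : y ∈ {y : Fin n → ℕ | ∑ l, y l = m} := hy
    rw [Set.inter_eq_self_of_subset_right (Set.singleton_subset_iff.2 h), Measure.pi_singleton]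
    simp only [canonical_singleton hc hβ hw hwc]
    rw [Finset.prod_mul_distrib, ENNReal.ofReal_prod_of_nonneg fun i _ => hw _,
      Finset.prod_const, Finset.card_univ, Fintype.card_fin]
  · have h : y ∉ {y : Fin n → ℕ | ∑ l, y l = m} := hy
    rw [Set.inter_singleton_eq_empty.2 h, measure_empty, zero_mul]

theorem pi_canonical_sum_eq (hc : 0 < c) (hβ : 2 < β) (hw : ∀ k, 0 ≤ w k)
    (hwc : w ~[atTop] fun k : ℕ => c * (k : ℝ) ^ (-β)) (m n : ℕ) :
    (Measure.pi fun _ : Fin n => canonical w) {y | ∑ l, y l = m} =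
      ENNReal.ofReal (Z w m n) * (Phi w 1)⁻¹ ^ n := by
  rw [← tsum_allocationWeight hw, ← ENNReal.tsum_mul_right,
    ← Measure.tsum_indicator_apply_singleton _ _ MeasurableSet.of_discrete]
  congr 1
  ext y
  rw [← pi_canonical_inter_singleton hc hβ hw hwc]
  by_cases hy : y ∈ {y : Fin n → ℕ | ∑ l, y l = m}
  · rw [Set.indicator_of_mem hy, Set.inter_eq_self_of_subset_right (Set.singleton_subset_iff.2 hy)]
  · rw [Set.indicator_of_notMem hy, Set.inter_singleton_eq_empty.2 hy, measure_empty]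

theorem Z_nonneg (hw : ∀ k, 0 ≤ w k) (m n : ℕ) : 0 ≤ Z w m n :=
  Finset.sum_nonneg fun _ _ => Finset.prod_nonneg fun _ _ => hw _

theorem pi_canonical_real_sum_eq (hc : 0 < c) (hβ : 2 < β) (hw : ∀ k, 0 ≤ w k)
    (hwc : w ~[atTop] fun k : ℕ => c * (k : ℝ) ^ (-β)) (m n : ℕ) :
    (Measure.pi fun _ : Fin n => canonical w).real {y | ∑ l, y l = m} =
      Z w m n / (Phi w 1).toReal ^ n := by
  rw [measureReal_def, pi_canonical_sum_eq hc hβ hw hwc, ENNReal.toReal_mul,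
    ENNReal.toReal_ofReal (Z_nonneg hw m n), ENNReal.toReal_pow, ENNReal.toReal_inv, inv_pow,
    div_eq_mul_inv]

/-- Each atom of the product law carries the same factor Φ(1)^(-n), which cancels on conditioning.
-/
theorem allocation_eq_cond (hc : 0 < c) (hβ : 2 < β) (hw : ∀ k, 0 ≤ w k)
    (hwc : w ~[atTop] fun k : ℕ => c * (k : ℝ) ^ (-β)) {m n : ℕ} (hZ : 0 < Z w m n) :
    allocation w m n =
      ProbabilityTheory.cond (Measure.pi fun _ : Fin n => canonical w) {y | ∑ l, y l = m} := by
  have hT := tsum_allocationWeight hw m n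
  have h0 : ENNReal.ofReal (Z w m n) ≠ 0 := (ENNReal.ofReal_pos.2 hZ).ne'
  refine Measure.ext_of_singleton fun y => ?_
  have hall : allocation w m n {y} = allocationWeight w m n y * (ENNReal.ofReal (Z w m n))⁻¹ := by
    rw [allocation, PMF.toMeasure_apply_singleton _ _ (measurableSet_singleton y)]
    change proportional (allocationWeight w m n) y = _
    rw [proportional, dif_pos ⟨by rw [hT]; exact h0, by rw [hT]; exact ENNReal.ofReal_ne_top⟩,
      PMF.normalize_apply, hT]
  have hq0 : (Phi w 1)⁻¹ ^ n ≠ 0 := pow_ne_zero _ (ENNReal.inv_ne_zero.2 (Phi_one_ne_top hβ hw hwc))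
  have hqT : (Phi w 1)⁻¹ ^ n ≠ ⊤ :=
    ENNReal.pow_ne_top (ENNReal.inv_ne_top.2 (Phi_one_ne_zero hc hwc))
  rw [hall, cond_apply MeasurableSet.of_discrete, pi_canonical_inter_singleton hc hβ hw hwc,
    pi_canonical_sum_eq hc hβ hw hwc, ENNReal.mul_inv (Or.inr hqT) (Or.inr hq0),
    mul_mul_mul_comm, mul_comm _ ((Phi w 1)⁻¹ ^ n), ENNReal.mul_inv_cancel hq0 hqT]
  ring

end Weights

/-! ### Transfer to the allocation -/

section Transfer

theorem orderedVector_apply {n : ℕ} (y : Fin n → ℕ) {j : ℕ} (hj : 1 ≤ j) (hjn : j ≤ n) :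
    orderedVector y ⟨j - 1, by omega⟩ = (ordered y j : ℤ) := by
  simp only [orderedVector, Nat.sub_add_cancel hj]

theorem exists_ordered_one_eq {n : ℕ} (hn : 1 ≤ n) (y : Fin n → ℕ) : ∃ i, ordered y 1 = y i := by
  rw [ordered, dif_pos ⟨le_rfl, hn⟩]
  exact ⟨_, rfl⟩

variable {P : Measure ℕ} {A : ∀ n : ℕ, Measure (Fin n → ℕ)} {m : ℕ → ℕ}

/-- Coordinatewise form of the coupling: the largest box matches the missing mass, and the j-th
largest matches the (j - 1)-th largest independent variable. -/
theorem exists_error_ordered [∀ n, IsProbabilityMeasure (A n)]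
    (h : ApproxEqualLaws (fun n => (A n).map orderedVector)
      (fun n => (Measure.pi fun _ : Fin (n - 1) => P).map (comparisonVector (m n)))) :
    ∃ e : ℕ → ℝ≥0∞, Tendsto e atTop (𝓝 0) ∧
      (∀ n, 1 ≤ n → ∀ S : Set ℤ,
        A n {y | (ordered y 1 : ℤ) ∈ S} ≤
          (Measure.pi fun _ : Fin (n - 1) => P) {x | (m n : ℤ) - ∑ l, (x l : ℤ) ∈ S} + e n ∧
        (Measure.pi fun _ : Fin (n - 1) => P) {x | (m n : ℤ) - ∑ l, (x l : ℤ) ∈ S} ≤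
          A n {y | (ordered y 1 : ℤ) ∈ S} + e n) ∧
      ∀ j, 2 ≤ j → ∀ n, j ≤ n → ∀ S : Set ℤ,
        A n {y | (ordered y j : ℤ) ∈ S} ≤
          (Measure.pi fun _ : Fin (n - 1) => P) {x | (ordered x (j - 1) : ℤ) ∈ S} + e n ∧
        (Measure.pi fun _ : Fin (n - 1) => P) {x | (ordered x (j - 1) : ℤ) ∈ S} ≤
          A n {y | (ordered y j : ℤ) ∈ S} + e n := by
  have : ∀ n, IsProbabilityMeasure ((A n).map orderedVector) := fun n =>
    Measure.isProbabilityMeasure_map Measurable.of_discrete.aemeasurable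
  obtain ⟨e, he, hle⟩ := h.exists_error
  have key : ∀ (n : ℕ) (i : Fin n) (S : Set ℤ),
      A n {y | orderedVector y i ∈ S} ≤
        (Measure.pi fun _ : Fin (n - 1) => P) {x | comparisonVector (m n) x i ∈ S} + e n ∧
      (Measure.pi fun _ : Fin (n - 1) => P) {x | comparisonVector (m n) x i ∈ S} ≤
        A n {y | orderedVector y i ∈ S} + e n := by
    intro n i S
    have := hle n {v | v i ∈ S}
    rw [Measure.map_apply Measurable.of_discrete MeasurableSet.of_discrete,
      Measure.map_apply Measurable.of_discrete MeasurableSet.of_discrete] at this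
    exact this
  refine ⟨e, he, fun n hn S => ?_, fun j hj n hjn S => ?_⟩
  · have := key n ⟨0, hn⟩ S
    simpa only [orderedVector, comparisonVector, if_pos] using this
  · have := key n ⟨j - 1, by omega⟩ S
    have hj0 : ¬ j - 1 = 0 := by omega
    simpa only [orderedVector_apply _ (show 1 ≤ j by omega) hjn, comparisonVector, hj0,
      if_false] using this

theorem isLittleOp_ordered_one [IsProbabilityMeasure P]
    (hint : Integrable (fun k : ℕ => (k : ℝ)) P) {lam : ℝ}
    (hm : Tendsto (fun n : ℕ => (m n : ℝ) / n) atTop (𝓝 lam)) {e : ℕ → ℝ≥0∞}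
    (he : Tendsto e atTop (𝓝 0))
    (hle : ∀ n, 1 ≤ n → ∀ S : Set ℤ, A n {y | (ordered y 1 : ℤ) ∈ S} ≤
      (Measure.pi fun _ : Fin (n - 1) => P) {x | (m n : ℤ) - ∑ l, (x l : ℤ) ∈ S} + e n) :
    IsLittleOp A (fun n y => (ordered y 1 : ℝ) - (lam - ∫ k : ℕ, (k : ℝ) ∂P) * n)
      (fun n => (n : ℝ)) := by
  intro ε hε
  set ν := ∫ k : ℕ, (k : ℝ) ∂P with hν
  have hdev := ENNReal.tendsto_ofReal
    (tendsto_measureReal_sum_deviation hint (δ := ε / 2) (by positivity))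
  rw [ENNReal.ofReal_zero] at hdev
  have hsum := hdev.add he
  rw [add_zero] at hsum
  refine tendsto_of_tendsto_of_tendsto_of_le_of_le' tendsto_const_nhds hsum
    (Eventually.of_forall fun n => zero_le) ?_
  have hm' := (tendsto_order.1 (tendsto_iff_dist_tendsto_zero.1 hm)).2 (ε / 2) (by positivity)
  filter_upwards [eventually_ge_atTop 1, hm'] with n hn hmn
  have hn0 : (0 : ℝ) < n := by exact_mod_cast hn
  have h1 := hle n hn {z : ℤ | ε ≤ |((z : ℝ) - (lam - ν) * n) / n|}
  simp only [Set.mem_ofPred_eq, Int.cast_natCast] at h1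
  refine h1.trans (add_le_add_left ?_ _)
  rw [ofReal_measureReal]
  refine measure_mono fun x hx => ?_
  rw [Set.mem_ofPred_eq] at hx ⊢
  rw [Real.dist_eq] at hmn
  push_cast at hx
  have h2 : ((m n : ℝ) - ∑ l, (x l : ℝ) - (lam - ν) * n) / n =
      ((m n : ℝ) / n - lam) - (∑ l, (x l : ℝ) - ν * n) / n := by
    field_simp
    ring
  rw [h2] at hx
  have h3 : ε / 2 ≤ |(∑ l, (x l : ℝ) - ν * n) / n| := by
    have := abs_sub ((m n : ℝ) / n - lam) ((∑ l, (x l : ℝ) - ν * n) / n)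
    linarith
  rwa [abs_div, abs_of_pos hn0, le_div_iff₀ hn0] at h3

theorem isLittleOp_ordered_two [IsProbabilityMeasure P] {γ : ℝ} (hγ : 1 < γ)
    (hint : Integrable (fun k : ℕ => (k : ℝ) ^ γ) P) {e : ℕ → ℝ≥0∞}
    (he : Tendsto e atTop (𝓝 0))
    (hle : ∀ n, 2 ≤ n → ∀ S : Set ℤ, A n {y | (ordered y 2 : ℤ) ∈ S} ≤
      (Measure.pi fun _ : Fin (n - 1) => P) {x | (ordered x 1 : ℤ) ∈ S} + e n) :
    IsLittleOp A (fun _ y => (ordered y 2 : ℝ)) (fun n => (n : ℝ)) := by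
  intro ε hε
  have hdev := ENNReal.tendsto_ofReal (tendsto_measureReal_exists_le hγ hint hε)
  rw [ENNReal.ofReal_zero] at hdev
  have hsum := hdev.add he
  rw [add_zero] at hsum
  refine tendsto_of_tendsto_of_tendsto_of_le_of_le' tendsto_const_nhds hsum
    (Eventually.of_forall fun n => zero_le) ?_
  filter_upwards [eventually_ge_atTop 2] with n hn
  have hn0 : (0 : ℝ) < n := by exact_mod_cast (by omega : 0 < n)
  have h1 := hle n hn {z : ℤ | ε ≤ |(z : ℝ) / n|}
  simp only [Set.mem_ofPred_eq, Int.cast_natCast] at h1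
  refine h1.trans (add_le_add_left ?_ _)
  rw [ofReal_measureReal]
  refine measure_mono fun x hx => ?_
  obtain ⟨i, hi⟩ := exists_ordered_one_eq (show 1 ≤ n - 1 by omega) x
  rw [Set.mem_ofPred_eq, hi, abs_of_nonneg (by positivity), le_div_iff₀ hn0] at hx
  exact ⟨i, hx⟩

theorem abs_div_rpow_eq (z s : ℝ) (n : ℕ) : |z / (n : ℝ) ^ s| = |(n : ℝ) ^ (-s) * z| := by
  rw [Real.rpow_neg (Nat.cast_nonneg n), div_eq_inv_mul]

theorem tendstoInDistribution_ordered [IsProbabilityMeasure P]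
    [∀ n, IsProbabilityMeasure (A n)] {β : ℝ} {j : ℕ} {W : ProbabilityMeasure ℝ}
    (hW : Tendsto (normalizedOrderedLaw P β (j - 1)) atTop (𝓝 W)) {e : ℕ → ℝ≥0∞}
    (he : Tendsto e atTop (𝓝 0))
    (hle : ∀ n, j ≤ n → ∀ S : Set ℤ,
      (Measure.pi fun _ : Fin (n - 1) => P) {x | (ordered x (j - 1) : ℤ) ∈ S} ≤
        A n {y | (ordered y j : ℤ) ∈ S} + e n) :
    TendstoInDistribution
      (fun (n : ℕ) (y : Fin n → ℕ) => (n : ℝ) ^ (-(1 / (β - 1))) * (ordered y j : ℝ))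
      atTop (fun x : ℝ => x) A (W : Measure ℝ) := by
  refine tendstoInDistribution_of_le_add (fun n => Measurable.of_discrete) he ?_ hW
  filter_upwards [eventually_ge_atTop j] with n hn G hG
  have := hle n hn {z : ℤ | (n : ℝ) ^ (-(1 / (β - 1))) * (z : ℝ) ∈ G}
  simp only [Set.mem_ofPred_eq, Int.cast_natCast] at this
  rw [normalizedOrderedLaw, ProbabilityMeasure.coe_mk,
    Measure.map_apply Measurable.of_discrete hG.measurableSet]
  exact this

theorem isBigOp_ordered [∀ n, IsProbabilityMeasure (A n)] {β : ℝ} {j : ℕ} {W : ProbabilityMeasure ℝ}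
    (h : TendstoInDistribution
      (fun (n : ℕ) (y : Fin n → ℕ) => (n : ℝ) ^ (-(1 / (β - 1))) * (ordered y j : ℝ))
      atTop (fun x : ℝ => x) A (W : Measure ℝ)) :
    IsBigOp A (fun _ y => (ordered y j : ℝ)) (fun n => (n : ℝ) ^ (1 / (β - 1))) :=
  isBigOp_of_tendstoInDistribution (fun _ => Measurable.of_discrete) h
    (Eventually.of_forall fun _ _ => abs_div_rpow_eq _ _ _)

theorem tendstoInDistribution_sub_ordered_one [IsProbabilityMeasure P]
    [∀ n, IsProbabilityMeasure (A n)] {β : ℝ} {X : ProbabilityMeasure ℝ}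
    (hX : Tendsto (normalizedSumLaw P β) atTop (𝓝 X)) {e : ℕ → ℝ≥0∞}
    (he : Tendsto e atTop (𝓝 0))
    (hle : ∀ n, 1 ≤ n → ∀ S : Set ℤ,
      (Measure.pi fun _ : Fin (n - 1) => P) {x | (m n : ℤ) - ∑ l, (x l : ℤ) ∈ S} ≤
        A n {y | (ordered y 1 : ℤ) ∈ S} + e n) :
    TendstoInDistribution
      (fun (n : ℕ) (y : Fin n → ℕ) => (n : ℝ) ^ (-(1 / (β - 1))) *
        ((m n : ℝ) - (∫ k : ℕ, (k : ℝ) ∂P) * n - (ordered y 1 : ℝ)))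
      atTop (fun x : ℝ => x) A (X : Measure ℝ) := by
  refine tendstoInDistribution_of_le_add (fun n => Measurable.of_discrete) he ?_ hX
  filter_upwards [eventually_ge_atTop 1] with n hn G hG
  have := hle n hn {z : ℤ | (n : ℝ) ^ (-(1 / (β - 1))) *
    ((m n : ℝ) - (∫ k : ℕ, (k : ℝ) ∂P) * n - (z : ℝ)) ∈ G}
  simp only [Set.mem_ofPred_eq, Int.cast_natCast, Int.cast_sub, Int.cast_sum] at this
  have hre : ∀ x : Fin (n - 1) → ℕ, (m n : ℝ) - (∫ k : ℕ, (k : ℝ) ∂P) * n -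
      ((m n : ℝ) - ∑ l, (x l : ℝ)) = ∑ l, (x l : ℝ) - (∫ k : ℕ, (k : ℝ) ∂P) * n := fun x => by ring
  simp only [hre] at this
  rw [normalizedSumLaw, ProbabilityMeasure.coe_mk,
    Measure.map_apply Measurable.of_discrete hG.measurableSet]
  exact this

end Transfer

/-! ### Asymptotics of the partition function -/

section PartitionFunction

variable {w : ℕ → ℝ} {c β : ℝ}

theorem isEquivalent_Z (hc : 0 < c) (hβ : 2 < β) (hw : ∀ k, 0 ≤ w k)
    (hwc : w ~[atTop] fun k : ℕ => c * (k : ℝ) ^ (-β)) {lam : ℝ} {m : ℕ → ℕ}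
    (hm : Tendsto (fun n : ℕ => (m n : ℝ) / n) atTop (𝓝 lam))
    (hlam : ∫ k : ℕ, (k : ℝ) ∂canonical w < lam) :
    (fun n : ℕ => Z w (m n) n) ~[atTop] fun n : ℕ =>
      c * (lam - ∫ k : ℕ, (k : ℝ) ∂canonical w) ^ (-β) * (Phi w 1).toReal ^ (n - 1) *
        (n : ℝ) ^ (1 - β) := by
  set Φ := (Phi w 1).toReal with hΦ
  have hΦ0 : 0 < Φ := ENNReal.toReal_pos (Phi_one_ne_zero hc hwc) (Phi_one_ne_top hβ hw hwc)
  set L := (lam - ∫ k : ℕ, (k : ℝ) ∂canonical w) ^ (-β) with hL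
  have hL0 : 0 < L := Real.rpow_pos_of_pos (by linarith) _
  have h := tendsto_measureReal_sum_eq (div_pos hc hΦ0) hβ (canonical_isEquivalent hc hβ hw hwc)
    hm hlam
  have h1 := h.div_const (c / Φ * L)
  rw [div_self (by positivity)] at h1
  refine isEquivalent_of_tendsto_one (h1.congr' ?_)
  filter_upwards [eventually_ge_atTop 1] with n hn
  obtain ⟨k, rfl⟩ : ∃ k, n = k + 1 := ⟨n - 1, by omega⟩
  rw [pi_canonical_real_sum_eq hc hβ hw hwc, Pi.div_apply, Nat.add_sub_cancel,
    show (1 : ℝ) - β = -(β - 1) by ring, Real.rpow_neg (Nat.cast_nonneg _), ← hΦ, pow_succ]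
  have : (0 : ℝ) < ((k + 1 : ℕ) : ℝ) ^ (β - 1) := by positivity
  field_simp

end PartitionFunction

end BallsInBoxes

/-! ### Assembly of the main theorem -/

theorem mainTheorem10 (w : ℕ → ℝ) (hw : ∀ k, 0 ≤ w k) (c β : ℝ) (hc : 0 < c) (hβ : 2 < β)
    (hwc : w ~[atTop] fun k : ℕ => c * (k : ℝ) ^ (-β)) :
    BallsInBoxes.nu w < ⊤ ∧
    ∀ (ν Φ₁ α c' lam : ℝ) (m : ℕ → ℕ),
      ν = (BallsInBoxes.nu w).toReal →
      Φ₁ = (BallsInBoxes.Phi w 1).toReal →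
      α = β - 1 →
      c' = c / Φ₁ →
      ν < lam →
      Tendsto (fun n : ℕ => (m n : ℝ) / n) atTop (𝓝 lam) →
      -- (i)
      (BallsInBoxes.IsLittleOp (fun n => BallsInBoxes.allocation w (m n) n)
          (fun n y => (BallsInBoxes.ordered y 1 : ℝ) - (lam - ν) * n) (fun n => (n : ℝ)) ∧
        BallsInBoxes.IsLittleOp (fun n => BallsInBoxes.allocation w (m n) n)
          (fun _ y => (BallsInBoxes.ordered y 2 : ℝ)) (fun n => (n : ℝ))) ∧
      -- (ii)
      ((fun n : ℕ => BallsInBoxes.Z w (m n) n) ~[atTop]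
        fun n : ℕ => c * (lam - ν) ^ (-β) * Φ₁ ^ (n - 1) * (n : ℝ) ^ (1 - β)) ∧
      -- (iii)
      BallsInBoxes.ApproxEqualLaws
        (fun n => (BallsInBoxes.allocation w (m n) n).map BallsInBoxes.orderedVector)
        (fun n => (Measure.pi fun _ : Fin (n - 1) => BallsInBoxes.canonical w).map
          (BallsInBoxes.comparisonVector (m n))) ∧
      -- (iv)
      (β < 3 →
        BallsInBoxes.IsBigOp (fun n => BallsInBoxes.allocation w (m n) n)
          (fun n y => (BallsInBoxes.ordered y 1 : ℝ) - ((m n : ℝ) - ν * n))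
          (fun n => (n : ℝ) ^ (1 / α)) ∧
        ∃ X : ProbabilityMeasure ℝ,
          BallsInBoxes.IsStableLaw α (X : Measure ℝ) ∧
          (∀ t : ℂ, 0 ≤ t.re →
            Integrable (fun x : ℝ => Complex.exp (-(t * (x : ℂ)))) (X : Measure ℝ) ∧
            ∫ x : ℝ, Complex.exp (-(t * (x : ℂ))) ∂(X : Measure ℝ) =
              Complex.exp ((c' : ℂ) * (Real.Gamma (-α) : ℂ) * t ^ (α : ℂ))) ∧
          TendstoInDistribution
            (fun (n : ℕ) (y : Fin n → ℕ) =>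
              (n : ℝ) ^ (-(1 / α)) * ((m n : ℝ) - ν * n - (BallsInBoxes.ordered y 1 : ℝ)))
            atTop (fun x : ℝ => x)
            (fun n => BallsInBoxes.allocation w (m n) n) (X : Measure ℝ)) ∧
      -- (v)
      (BallsInBoxes.IsBigOp (fun n => BallsInBoxes.allocation w (m n) n)
          (fun _ y => (BallsInBoxes.ordered y 2 : ℝ)) (fun n => (n : ℝ) ^ (1 / α)) ∧
        ∃ W : ProbabilityMeasure ℝ,
          (∀ x : ℝ, cdf (W : Measure ℝ) x =
            if 0 < x then Real.exp (-(c' / α * x ^ (-α))) else 0) ∧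
          TendstoInDistribution
            (fun (n : ℕ) (y : Fin n → ℕ) =>
              (n : ℝ) ^ (-(1 / α)) * (BallsInBoxes.ordered y 2 : ℝ))
            atTop (fun x : ℝ => x)
            (fun n => BallsInBoxes.allocation w (m n) n) (W : Measure ℝ)) ∧
      -- (vi)
      (∀ j : ℕ, 2 ≤ j →
        BallsInBoxes.IsBigOp (fun n => BallsInBoxes.allocation w (m n) n)
          (fun _ y => (BallsInBoxes.ordered y j : ℝ)) (fun n => (n : ℝ) ^ (1 / α)) ∧
        ∃ W : ProbabilityMeasure ℝ,
          (W : Measure ℝ) =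
            volume.withDensity (fun x => ENNReal.ofReal (BallsInBoxes.densityW c' α j x)) ∧
          (W : Measure ℝ).map (fun x => c' * α⁻¹ * x ^ (-α)) = gammaMeasure ((j : ℝ) - 1) 1 ∧
          TendstoInDistribution
            (fun (n : ℕ) (y : Fin n → ℕ) =>
              (n : ℝ) ^ (-(1 / α)) * (BallsInBoxes.ordered y j : ℝ))
            atTop (fun x : ℝ => x)
            (fun n => BallsInBoxes.allocation w (m n) n) (W : Measure ℝ)) := by
  have hmean0 : 0 ≤ ∫ k : ℕ, (k : ℝ) ∂BallsInBoxes.canonical w :=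
    integral_nonneg fun k => Nat.cast_nonneg k
  have hnu := BallsInBoxes.nu_eq hc hβ hw hwc
  refine ⟨by rw [hnu]; exact ENNReal.ofReal_lt_top, ?_⟩
  rintro ν Φ₁ α c' lam m hν rfl rfl rfl hlam hm
  rw [hnu, ENNReal.toReal_ofReal hmean0] at hν
  subst hν
  have hc' : 0 < c / (BallsInBoxes.Phi w 1).toReal :=
    div_pos hc (ENNReal.toReal_pos (BallsInBoxes.Phi_one_ne_zero hc hwc)
      (BallsInBoxes.Phi_one_ne_top hβ hw hwc))
  have hα : 0 < β - 1 := by linarith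
  have hP := BallsInBoxes.canonical_isEquivalent hc hβ hw hwc
  obtain ⟨γ, hγ, -, hint, hintγ⟩ := BallsInBoxes.exists_rpow_integrable hβ hP
  have hsum := BallsInBoxes.tendsto_measureReal_sum_eq hc' hβ hP hm hlam
  have hA : ∀ᶠ n in atTop, BallsInBoxes.allocation w (m n) n = ProbabilityTheory.cond
      (Measure.pi fun _ : Fin n => BallsInBoxes.canonical w) {y | ∑ l, y l = m n} := by
    have hpos : 0 < c / (BallsInBoxes.Phi w 1).toReal *
        (lam - ∫ k : ℕ, (k : ℝ) ∂BallsInBoxes.canonical w) ^ (-β) :=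
      mul_pos hc' (Real.rpow_pos_of_pos (by linarith) _)
    filter_upwards [hsum.eventually (lt_mem_nhds hpos)] with n hn
    refine BallsInBoxes.allocation_eq_cond hc hβ hw hwc
      ((BallsInBoxes.Z_nonneg hw _ _).lt_of_ne fun hZ => ?_)
    rw [BallsInBoxes.pi_canonical_real_sum_eq hc hβ hw hwc, ← hZ, zero_div, mul_zero] at hn
    exact hn.false
  have hcoup := BallsInBoxes.approxEqualLaws_orderedVector hc' hβ hP hm hlam
    (fun n => BallsInBoxes.allocation w (m n) n) hA
  obtain ⟨e, he, hfirst, hother⟩ := BallsInBoxes.exists_error_ordered hcoup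
  have horder : ∀ j : ℕ, 2 ≤ j → ∃ W : ProbabilityMeasure ℝ,
      (W : Measure ℝ) = volume.withDensity (fun x => ENNReal.ofReal
        (BallsInBoxes.densityW (c / (BallsInBoxes.Phi w 1).toReal) (β - 1) j x)) ∧
      TendstoInDistribution
        (fun (n : ℕ) (y : Fin n → ℕ) =>
          (n : ℝ) ^ (-(1 / (β - 1))) * (BallsInBoxes.ordered y j : ℝ))
        atTop (fun x : ℝ => x)
        (fun n => BallsInBoxes.allocation w (m n) n) (W : Measure ℝ) := by
    intro j hj
    obtain ⟨W, hW, hlim⟩ := BallsInBoxes.exists_tendsto_normalizedOrderedLaw hc' hβ hP hj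
    exact ⟨W, hW, BallsInBoxes.tendstoInDistribution_ordered hlim he
      fun n hn S => (hother j hj n hn S).2⟩
  refine ⟨⟨BallsInBoxes.isLittleOp_ordered_one hint hm he fun n hn S => (hfirst n hn S).1,
    BallsInBoxes.isLittleOp_ordered_two hγ hintγ he fun n hn S => (hother 2 le_rfl n hn S).1⟩,
    BallsInBoxes.isEquivalent_Z hc hβ hw hwc hm hlam, hcoup, fun hβ3 => ?_, ?_, fun j hj => ?_⟩
  · obtain ⟨X, hst, hlap, hlim⟩ := BallsInBoxes.exists_stable_limit hc' hβ hβ3 hP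
    have hX := BallsInBoxes.tendstoInDistribution_sub_ordered_one
      (A := fun n => BallsInBoxes.allocation w (m n) n) hlim he fun n hn S => (hfirst n hn S).2
    refine ⟨BallsInBoxes.isBigOp_of_tendstoInDistribution (fun _ => Measurable.of_discrete) hX
      (Eventually.of_forall fun n y => ?_), X, hst, hlap, hX⟩
    rw [BallsInBoxes.abs_div_rpow_eq, abs_mul, abs_mul, abs_sub_comm]
  · obtain ⟨W, hW, hlim⟩ := horder 2 le_rfl
    refine ⟨BallsInBoxes.isBigOp_ordered hlim, W, fun x => ?_, hlim⟩
    rw [cdf_eq_real, hW, BallsInBoxes.measureReal_densityW_Iic hc' hα le_rfl]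
    -- For j = 2 the Poisson sum has the single term e^(-τ), the Fréchet distribution function.
    simp [BallsInBoxes.limitCdf]
  · obtain ⟨W, hW, hlim⟩ := horder j hj
    refine ⟨BallsInBoxes.isBigOp_ordered hlim, W, hW, ?_, hlim⟩
    rw [hW]
    exact BallsInBoxes.map_withDensity_densityW hc' hα hj
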